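/- An arena $A=\langle N,\mathrm{Ac},\mathrm{St},s_0,\mathrm{tr},\lambda\rangle$ consists of finite non-empty sets of players, actions and states, an initial state $s_0$, a transition function $\mathrm{tr}:\mathrm{St}\times\mathrm{Ac}^N\to\mathrm{St}$ and a labelling $\lambda:\mathrm{St}\to 2^{\mathrm{AP}}$ over a finite set $\mathrm{AP}$ of atomic propositions, with a non-empty set $\mathrm{Ac}_i\subseteq\mathrm{Ac}$ of actions for each player $i$ (possibly all of $\mathrm{Ac}$). A strategy of player $i$ is a finite-state transducer that reads action profiles in $\mathrm{Ac}^N$ and outputs actions in $\mathrm{Ac}_i$; a state $s$ and a profile $\vec\sigma$ of strategies determine a path $\pi(\vec\sigma,s)$ in $A$. A GR(1) game $\mathcal G=\langle A,(\gamma_i)_{i\in N}\rangle$ adds to an arena, for each player $i$, a goal given by an LTL formula of the form $$\gamma_i=\bigwedge_{l}\mathbf{G}\mathbf{F}\,\psi^i_l\;\to\;\bigwedge_{r}\mathbf{G}\mathbf{F}\,\theta^i_r,$$ where the $\psi^i_l,\theta^i_r$ are Boolean combinations of atomic propositions. For a player $j$, the punishing region $\mathrm{Pun}_j(\mathcal G)$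 is the set of all states $s$ for which there is a profile $\vec\sigma_{-j}$ of strategies of the players other than $j$ such that $\lambda(\pi((\vec\sigma_{-j},\sigma'_j),s))\not\models\gamma_j$ for every strategy $\sigma'_j$ of player $j$. **Theorem.** There are a random access machine (unit cost, with addition and truncated subtraction but no multiplication) and a polynomial $p$ such that, for every GR(1) game $\mathcal G$ over an arena $A$, given explicitly by tables, and every player $j$, the machine on input $(\mathcal G,j)$ halts after at most $p(|A|+|\gamma_j|)$ steps with the characteristic vector of $\mathrm{Pun}_j(\mathcal G)$ as output. Here $|\gamma_j|$ is the number of symbols of the formula $\gamma_j$, and $$|A|=|N|+|\mathrm{Ac}|+|\mathrm{St}|+|N|\,|\mathrm{Ac}|+|\mathrm{St}|\,|\mathrm{Ac}|^{|N|}+|\mathrm{St}|\,|\mathrm{AP}|.$$ In particular, $\mathrm{Pun}_j(\mathcal G)$ is computable in time polynomial in the sizes of $\mathcal G$ and $\gamma_j$. -/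

import Mathlib

namespace GRGame

/-! ### Linear temporal logic and its fragment GR(1) -/

/-- Syntax of LTL over the atomic propositions `AP`. -/
inductive LTL (AP : Type) : Type
  | top : LTL AP
  | atom : AP → LTL AP
  | neg : LTL AP → LTL AP
  | or : LTL AP → LTL AP → LTL AP
  | next : LTL AP → LTL AP
  | untl : LTL AP → LTL AP → LTL AP

namespace LTL

variable {AP : Type}

def and (f g : LTL AP) : LTL AP := neg (or (neg f) (neg g))

def imp (f g : LTL AP) : LTL AP := or (neg f) g

def eventually (f : LTL AP) : LTL AP := untl top f

def always (f : LTL AP) : LTL AP := neg (eventually (neg f))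

/-- Finite conjunctions; the empty conjunction is `⊤`. -/
def conj (l : List (LTL AP)) : LTL AP := l.foldr and top

/-- `(α, t) ⊨ f`, for an infinite sequence `α` of sets of atomic propositions. -/
def SatAt (α : ℕ → Set AP) : LTL AP → ℕ → Prop
  | top, _ => True
  | atom p, t => p ∈ α t
  | neg f, t => ¬ SatAt α f t
  | or f g, t => SatAt α f t ∨ SatAt α g t
  | next f, t => SatAt α f (t + 1)
  | untl f g, t => ∃ t', t ≤ t' ∧ SatAt α g t' ∧ ∀ t'', t ≤ t'' → t'' < t' → SatAt α f t''

/-- `α ⊨ f`. -/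
def Sat (α : ℕ → Set AP) (f : LTL AP) : Prop := SatAt α f 0

/-- The number of symbols of a formula. -/
def size : LTL AP → ℕ
  | top => 1
  | atom _ => 1
  | neg f => size f + 1
  | or f g => size f + size g + 1
  | next f => size f + 1
  | untl f g => size f + size g + 1

end LTL

/-- Boolean combinations of atomic propositions. -/
inductive BoolForm (AP : Type) : Type
  | top : BoolForm AP
  | atom : AP → BoolForm AP
  | neg : BoolForm AP → BoolForm AP
  | or : BoolForm AP → BoolForm AP → BoolForm AP

def BoolForm.toLTL {AP : Type} : BoolForm AP → LTL AP
  | .top => .top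
  | .atom p => .atom p
  | .neg f => .neg f.toLTL
  | .or f g => .or f.toLTL g.toLTL

/-- A GR(1) formula `(GF ψ₁ ∧ … ∧ GF ψₘ) → (GF θ₁ ∧ … ∧ GF θₙ)`. -/
structure GR1 (AP : Type) : Type where
  assumptions : List (BoolForm AP)
  guarantees : List (BoolForm AP)

namespace GR1

variable {AP : Type}

/-- The LTL formula denoted by a GR(1) formula. -/
def toLTL (γ : GR1 AP) : LTL AP :=
  LTL.imp (LTL.conj (γ.assumptions.map fun f => f.toLTL.eventually.always))
    (LTL.conj (γ.guarantees.map fun f => f.toLTL.eventually.always))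

def size (γ : GR1 AP) : ℕ := γ.toLTL.size

end GR1

/-! ### Arenas, strategies, outcomes, games -/

/-- An arena with players `N`, actions `Ac`, states `St` and atomic propositions `AP`. The set
`act i ⊆ Ac` consists of the actions that the strategies of player `i` may use. -/
structure Arena (N Ac St AP : Type) : Type where
  init : St
  tr : St → (N → Ac) → St
  label : St → Set AP
  act : N → Set Ac
  act_nonempty : ∀ i, (act i).Nonempty

/-- A strategy of player `i`: a finite state machine that reads action profiles and outputs
actions of player `i`. -/
structure Strategy {N Ac St AP : Type} (A : Arena N Ac St AP) (i : N) : Type 1 where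
  Q : Type
  finite_Q : Finite Q
  q0 : Q
  δ : Q → (N → Ac) → Q
  τ : Q → Ac
  τ_mem : ∀ q, τ q ∈ A.act i

namespace Arena

variable {N Ac St AP : Type}

/-- Strategy profiles. -/
abbrev Profile (A : Arena N Ac St AP) : Type 1 := ∀ i : N, Strategy A i

/-- Partial strategy profiles `σ₋ⱼ`, with one strategy for each player other than `j`. -/
abbrev CoProfile (A : Arena N Ac St AP) (j : N) : Type 1 := ∀ i : N, i ≠ j → Strategy A i

open Classical in
/-- The profile `(σ₋ⱼ, σ'ⱼ)`. -/
noncomputable def combine {A : Arena N Ac St AP} {j : N} (σ : A.CoProfile j)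
    (σ' : Strategy A j) : A.Profile :=
  fun i => if h : i = j then h.symm ▸ σ' else σ i h

/-- The actions chosen by the strategies of `σ` in the internal states `q`. -/
def decision {A : Arena N Ac St AP} (σ : A.Profile) (q : ∀ i, (σ i).Q) : N → Ac :=
  fun i => (σ i).τ (q i)

/-- State of the arena and internal states of the strategies after `t` rounds from `s`. -/
def run {A : Arena N Ac St AP} (σ : A.Profile) (s : St) : ℕ → St × (∀ i, (σ i).Q)
  | 0 => (s, fun i => (σ i).q0)
  | t + 1 =>
    (A.tr (run σ s t).1 (decision σ (run σ s t).2),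
      fun i => (σ i).δ ((run σ s t).2 i) (decision σ (run σ s t).2))

/-- The outcome `π(σ, s)`. -/
def outcome {A : Arena N Ac St AP} (σ : A.Profile) (s : St) : ℕ → St × (N → Ac) :=
  fun t => ((run σ s t).1, decision σ (run σ s t).2)

/-- The sequence `λ(π)` of sets of atomic propositions along `π`. -/
def trace (A : Arena N Ac St AP) (π : ℕ → St × (N → Ac)) : ℕ → Set AP :=
  fun t => A.label (π t).1

end Arena

/-- A multi-player GR(1) game. -/
structure Game (N Ac St AP : Type) : Type where
  arena : Arena N Ac St AP
  goal : N → GR1 AP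

namespace Game

variable {N Ac St AP : Type}

/-- `σ₋ⱼ` is punishing for player `j` in state `s`. -/
def IsPunishing (G : Game N Ac St AP) (j : N) (s : St) (σ : G.arena.CoProfile j) : Prop :=
  ∀ σ' : Strategy G.arena j,
    ¬ LTL.Sat (G.arena.trace (Arena.outcome (Arena.combine σ σ') s)) (G.goal j).toLTL

/-- The punishing region of player `j`. -/
def Pun (G : Game N Ac St AP) (j : N) : Set St :=
  {s | ∃ σ : G.arena.CoProfile j, G.IsPunishing j s σ}

end Game

/-! ### Random access machines with a step count -/

/-- Programs of a random access machine that has registers `R 0, R 1, …` and arrays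
`M 0, M 1, …`, all holding natural numbers. Registers and arrays are named by constants of the
program, so that a program uses finitely many of them; the cells of an array are addressed
through registers. There is no multiplication: the length of the numbers increases by at most one
bit per step, and unit cost time is polynomially equivalent to the time of a Turing machine. -/
inductive Program : Type
  | skip : Program
  /-- `R d := c` -/
  | const (d c : ℕ) : Program
  /-- `R d := R x` -/
  | move (d x : ℕ) : Program
  /-- `R d := R x + R y` -/
  | add (d x y : ℕ) : Program
  /-- `R d := max (R x - R y) 0` -/
  | sub (d x y : ℕ) : Program
  /-- `R d := M k [R x]` -/
  | load (d k x : ℕ) : Program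
  /-- `M k [R x] := R y` -/
  | store (k x y : ℕ) : Program
  | seq (P Q : Program) : Program
  /-- `if R x < R y then P else Q` -/
  | ifLt (x y : ℕ) (P Q : Program) : Program
  /-- `while R x < R y do P` -/
  | whileLt (x y : ℕ) (P : Program) : Program

/-- Contents of the registers and of the arrays. -/
structure Store : Type where
  reg : ℕ → ℕ
  mem : ℕ → ℕ → ℕ

namespace Store

def setReg (σ : Store) (d v : ℕ) : Store :=
  { σ with reg := Function.update σ.reg d v }

def setMem (σ : Store) (k x v : ℕ) : Store :=
  { σ with mem := Function.update σ.mem k (Function.update (σ.mem k) x v) }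

end Store

/-- `Exec P σ t σ'`: started in `σ`, the program `P` halts after exactly `t` steps, in `σ'`.
Each elementary instruction and each evaluation of a test is one step. -/
inductive Exec : Program → Store → ℕ → Store → Prop
  | skip (σ : Store) : Exec .skip σ 1 σ
  | const (σ : Store) (d c : ℕ) : Exec (.const d c) σ 1 (σ.setReg d c)
  | move (σ : Store) (d x : ℕ) : Exec (.move d x) σ 1 (σ.setReg d (σ.reg x))
  | add (σ : Store) (d x y : ℕ) : Exec (.add d x y) σ 1 (σ.setReg d (σ.reg x + σ.reg y))
  | sub (σ : Store) (d x y : ℕ) : Exec (.sub d x y) σ 1 (σ.setReg d (σ.reg x - σ.reg y))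
  | load (σ : Store) (d k x : ℕ) : Exec (.load d k x) σ 1 (σ.setReg d (σ.mem k (σ.reg x)))
  | store (σ : Store) (k x y : ℕ) :
      Exec (.store k x y) σ 1 (σ.setMem k (σ.reg x) (σ.reg y))
  | seq {P Q : Program} {σ₁ σ₂ σ₃ : Store} {t₁ t₂ : ℕ} (hP : Exec P σ₁ t₁ σ₂)
      (hQ : Exec Q σ₂ t₂ σ₃) : Exec (.seq P Q) σ₁ (t₁ + t₂) σ₃
  | if_true {x y : ℕ} {P Q : Program} {σ σ' : Store} {t : ℕ} (h : σ.reg x < σ.reg y)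
      (hP : Exec P σ t σ') : Exec (.ifLt x y P Q) σ (t + 1) σ'
  | if_false {x y : ℕ} {P Q : Program} {σ σ' : Store} {t : ℕ} (h : ¬ σ.reg x < σ.reg y)
      (hQ : Exec Q σ t σ') : Exec (.ifLt x y P Q) σ (t + 1) σ'
  | while_true {x y : ℕ} {P : Program} {σ₁ σ₂ σ₃ : Store} {t₁ t₂ : ℕ}
      (h : σ₁.reg x < σ₁.reg y) (hP : Exec P σ₁ t₁ σ₂)
      (hW : Exec (.whileLt x y P) σ₂ t₂ σ₃) :
      Exec (.whileLt x y P) σ₁ (t₁ + t₂ + 1) σ₃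
  | while_false {x y : ℕ} {P : Program} {σ : Store} (h : ¬ σ.reg x < σ.reg y) :
      Exec (.whileLt x y P) σ 1 σ

/-! ### Games as inputs of a machine

Players, actions, states and atomic propositions are numbered from `0`. -/

/-- Postfix notation of a Boolean formula: `⊤`, `¬`, `∨` are written `0`, `1`, `2`, and the atomic
proposition number `p` is written `p + 3`. -/
def BoolForm.code {a : ℕ} : BoolForm (Fin a) → List ℕ
  | .top => [0]
  | .atom p => [(p : ℕ) + 3]
  | .neg f => f.code ++ [1]
  | .or f g => f.code ++ g.code ++ [2]

/-- The numbers of assumptions and of guarantees, followed by the assumptions and the guarantees,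
each preceded by its length. -/
def GR1.code {a : ℕ} (γ : GR1 (Fin a)) : List ℕ :=
  [γ.assumptions.length, γ.guarantees.length] ++
    (γ.assumptions ++ γ.guarantees).flatMap fun f => f.code.length :: f.code

/-- Array contents: a finite table, followed by zeros. -/
def table {r : ℕ} (f : Fin r → ℕ) : ℕ → ℕ :=
  fun x => if h : x < r then f ⟨x, h⟩ else 0

namespace Arena

variable {n k m a : ℕ}

/-- The size of an arena given by tables: numbers of players, actions and states, the sets of
actions of the players, the transition table, the labelling table. -/
def size (_ : Arena (Fin n) (Fin k) (Fin m) (Fin a)) : ℕ :=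
  n + k + m + n * k + m * k ^ n + m * a

open Classical in
/-- Entry `i * k + c` tells whether player `i` has action `c`. -/
noncomputable def actTable (A : Arena (Fin n) (Fin k) (Fin m) (Fin a)) : ℕ → ℕ :=
  table fun x : Fin (n * k) =>
    if (finProdFinEquiv.symm x).2 ∈ A.act (finProdFinEquiv.symm x).1 then 1 else 0

/-- Entry `s * k ^ n + ∑ i, c i * k ^ i` is the successor of `s` under the action profile `c`. -/
def trTable (A : Arena (Fin n) (Fin k) (Fin m) (Fin a)) : ℕ → ℕ :=
  table fun x : Fin (m * k ^ n) =>
    (A.tr (finProdFinEquiv.symm x).1 (finFunctionFinEquiv.symm (finProdFinEquiv.symm x).2) : ℕ)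

open Classical in
/-- Entry `s * a + p` tells whether `p` holds in `s`. -/
noncomputable def labelTable (A : Arena (Fin n) (Fin k) (Fin m) (Fin a)) : ℕ → ℕ :=
  table fun x : Fin (m * a) =>
    if (finProdFinEquiv.symm x).2 ∈ A.label (finProdFinEquiv.symm x).1 then 1 else 0

end Arena

namespace Game

variable {n k m a : ℕ}

/-- The goals of all players. Entry `i < n` is the position in this same list where the code of
the goal of player `i` begins; the codes of the goals follow, in the order of the players. -/
def goalList (G : Game (Fin n) (Fin k) (Fin m) (Fin a)) : List ℕ :=
  (List.ofFn fun i : Fin n => n + ∑ i' ∈ Finset.Iio i, (G.goal i').code.length) ++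
    (List.ofFn fun i : Fin n => (G.goal i).code).flatten

/-- The initial contents of a machine on the game `G` and the player `j`: registers `0`, …, `5`
hold the numbers of players, actions, states and atomic propositions, the player `j` and the
initial state; arrays `0`, …, `3` hold the available actions, the transition function, the
labelling and the goals; everything else is `0`. -/
noncomputable def input (G : Game (Fin n) (Fin k) (Fin m) (Fin a)) (j : Fin n) : Store where
  reg := fun r => [n, k, m, a, (j : ℕ), (G.arena.init : ℕ)].getD r 0
  mem := fun r =>
    if r = 0 then G.arena.actTable
    else if r = 1 then G.arena.trTable
    else if r = 2 then G.arena.labelTable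
    else if r = 3 then fun x => G.goalList.getD x 0
    else fun _ => 0

end Game

/-- Array `4` holds the characteristic vector of the set `S` of states. -/
def Outputs {m : ℕ} (σ : Store) (S : Set (Fin m)) : Prop :=
  ∀ s : Fin m, (s ∈ S → σ.mem 4 s = 1) ∧ (s ∉ S → σ.mem 4 s = 0)

end GRGame

namespace GRGame

open Set Filter

/-! ### Solving two-player GR(1) games by iteration -/

/-! ### Stabilisation of monotone iterations on a finite set. -/

section Iteration

variable {S : Type*}

/-! Strategies are deterministic finite transducers, and `σ₋ⱼ` is fixed before `σ'ⱼ`. A strategy of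
player `j` can carry a copy of the machines of the other players and so predict their next actions.
Hence nothing changes if the concurrent game is replaced by the turn-based game `Arena.turn`, in
which the coalition chooses first and `j` answers. GR(1) objectives are determined with finite
memory in that game, and a finite-memory strategy of the coalition can be run by each of its members
separately. So the punishing region is the complement of the winning region of `j`
(`Game.Pun_eq_compl_winRegion`).

With `cp` for the controllable predecessor of `j`, that winning region is νZ ⋂ᵣ μY ⋃ₗ νX of (θᵣ ∩ cp
Z) ∪ cp Y ∪ (ψₗᶜ ∩ cp X). Both strategies are read off the iterates. Inside the region, `j` pursues
the guarantees cyclically: either the current one is reached, or a rank taken from the iterates of Y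
falls, or the rank stays while one particular assumption fails (`exists_responder_strategy`).
Outside, the coalition pursues the assumptions cyclically, with a rank taken from the iterates of Z
that never rises; once it is constant, one particular guarantee fails forever
(`exists_chooser_strategy`).

For the running time, each fixed point over `m` states is reached after `m` rounds, and one
application of `cp` takes, for each state, a few passes over the `k ^ n` action profiles, a number
that the size of the transition table already accounts for. The program is written in a language
whose only loops are counted by registers that the command never changes. By structural induction
its compiled form runs in time polynomial in a common bound of these registers (`Cmd.exec_compile`),
and all of them are at most the size of the input plus 2. -/

theorem iterate_univ_isFixedPt [Finite S] {F : Set S → Set S} (hF : Monotone F) {N : ℕ}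
    (hN : Nat.card S ≤ N) : F (F^[N] univ) = F^[N] univ := by
  by_contra hne
  have hanti : ∀ i, F^[i + 1] univ ⊆ F^[i] univ := by
    intro i
    induction i with
    | zero => exact subset_univ _
    | succ i ih =>
      rw [Function.iterate_succ_apply', Function.iterate_succ_apply']
      rw [Function.iterate_succ_apply'] at ih
      exact hF ih
  have hstrict : ∀ i ≤ N, F^[i + 1] univ ≠ F^[i] univ := by
    intro i hi h
    have hfix : ∀ d, F^[i + d + 1] univ = F^[i + d] univ := by
      intro d
      induction d with
      | zero => exact h
      | succ d ih =>
        rw [← add_assoc, Function.iterate_succ_apply', ih, ← Function.iterate_succ_apply' F]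
        exact ih
    obtain ⟨d, rfl⟩ := Nat.exists_eq_add_of_le hi
    exact hne (by rw [← Function.iterate_succ_apply' F]; exact hfix d)
  -- Every strict step loses at least one element, so `N + 1` strict steps would need more than `N`
  -- elements.
  have hcard : ∀ i ≤ N + 1, (F^[i] univ).ncard + i ≤ Nat.card S := by
    intro i
    induction i with
    | zero => simp [Set.ncard_univ]
    | succ i ih =>
      intro hi
      have := ncard_lt_ncard ((hanti i).ssubset_of_ne (hstrict i (by omega))) (toFinite _)
      have := ih (by omega)
      omega
  have := hcard (N + 1) le_rfl
  omega

theorem iterate_empty_isFixedPt [Finite S] {F : Set S → Set S} (hF : Monotone F) {N : ℕ}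
    (hN : Nat.card S ≤ N) : F (F^[N] ∅) = F^[N] ∅ := by
  -- Complementation turns the ascending chain from `∅` into a descending chain from `univ`.
  let F' : Set S → Set S := fun X => (F Xᶜ)ᶜ
  have hF' : Monotone F' := fun X Y h => compl_subset_compl.2 (hF (compl_subset_compl.2 h))
  have hit : ∀ i, F'^[i] univ = (F^[i] ∅)ᶜ := by
    intro i
    induction i with
    | zero => simp
    | succ i ih => rw [Function.iterate_succ_apply', Function.iterate_succ_apply', ih]; simp [F']
  have := iterate_univ_isFixedPt hF' hN
  rw [hit] at this
  simpa [F'] using this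

end Iteration

/-! ### The triple fixed point of a GR(1) objective. -/

section Fixpoints

variable {S : Type*} (cp : Set S → Set S) (N : ℕ)

/-- The three ways to make progress: meet the guarantee θ and start afresh in Z, move closer to that
through Y, or linger in X as long as the assumption ψ fails. -/
def stepX (θ ψ Z Y X : Set S) : Set S := (θ ∩ cp Z) ∪ cp Y ∪ (ψᶜ ∩ cp X)

def fixX (θ ψ Z Y : Set S) : Set S := (stepX cp θ ψ Z Y)^[N] univ

def stepY {a : ℕ} (θ : Set S) (ψ : Fin a → Set S) (Z Y : Set S) : Set S :=
  ⋃ l, fixX cp N θ (ψ l) Z Y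

def fixY {a : ℕ} (θ : Set S) (ψ : Fin a → Set S) (Z : Set S) : Set S :=
  (stepY cp N θ ψ Z)^[N] ∅

def stepZ {a g : ℕ} (θ : Fin g → Set S) (ψ : Fin a → Set S) (Z : Set S) : Set S :=
  ⋂ r, fixY cp N (θ r) ψ Z

/-- The winning region of the player with controllable predecessor operator `cp` for the
objective `⋀ GF ψ → ⋀ GF θ`: the triple fixed point of Piterman, Pnueli and Sa'ar, computed with
`N` rounds for each of the three fixed points. -/
def fixZ {a g : ℕ} (θ : Fin g → Set S) (ψ : Fin a → Set S) : Set S :=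
  (stepZ cp N θ ψ)^[N] univ

variable {cp} (hcp : Monotone cp)
include hcp

theorem stepX_mono {θ ψ Z Z' Y Y' X X' : Set S} (hZ : Z ⊆ Z') (hY : Y ⊆ Y') (hX : X ⊆ X') :
    stepX cp θ ψ Z Y X ⊆ stepX cp θ ψ Z' Y' X' :=
  union_subset_union (union_subset_union (inter_subset_inter_right _ (hcp hZ)) (hcp hY))
    (inter_subset_inter_right _ (hcp hX))

theorem fixX_mono {θ ψ Z Z' Y Y' : Set S} (hZ : Z ⊆ Z') (hY : Y ⊆ Y') :
    fixX cp N θ ψ Z Y ⊆ fixX cp N θ ψ Z' Y' := by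
  unfold fixX
  induction N with
  | zero => exact subset_rfl
  | succ i ih =>
    rw [Function.iterate_succ_apply', Function.iterate_succ_apply']
    exact stepX_mono hcp hZ hY ih

theorem stepY_mono {a : ℕ} {θ : Set S} {ψ : Fin a → Set S} {Z Z' Y Y' : Set S} (hZ : Z ⊆ Z')
    (hY : Y ⊆ Y') : stepY cp N θ ψ Z Y ⊆ stepY cp N θ ψ Z' Y' :=
  iUnion_mono fun _ => fixX_mono N hcp hZ hY

theorem fixY_mono {a : ℕ} {θ : Set S} {ψ : Fin a → Set S} {Z Z' : Set S} (hZ : Z ⊆ Z') :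
    fixY cp N θ ψ Z ⊆ fixY cp N θ ψ Z' := by
  unfold fixY
  have : ∀ i, (stepY cp N θ ψ Z)^[i] ∅ ⊆ (stepY cp N θ ψ Z')^[i] ∅ := by
    intro i
    induction i with
    | zero => exact subset_rfl
    | succ i ih =>
      rw [Function.iterate_succ_apply', Function.iterate_succ_apply']
      exact stepY_mono N hcp hZ ih
  exact this N

theorem stepZ_mono {a g : ℕ} {θ : Fin g → Set S} {ψ : Fin a → Set S} :
    Monotone (stepZ cp N θ ψ) := fun _ _ h => iInter_mono fun _ => fixY_mono N hcp h

end Fixpoints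

/-! ### Ranks and cyclic counters along infinite runs. -/

section Runs

/-- Induction on the value at `T`: if the sequence is not constant from there on, some later value
is smaller. It is applied to ranks along a play. -/
theorem eventually_const_of_antitone {f : ℕ → ℕ} {T : ℕ} (h : ∀ t ≥ T, f (t + 1) ≤ f t) :
    ∃ T' ≥ T, ∀ t ≥ T', f t = f T' := by
  induction hv : f T using Nat.strong_induction_on generalizing T with
  | _ v ih =>
    by_cases hc : ∀ t ≥ T, f t = f T
    · exact ⟨T, le_rfl, hc⟩
    · push Not at hc
      obtain ⟨t, ht, hne⟩ := hc
      have hle : ∀ d, f (T + d) ≤ f T := by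
        intro d
        induction d with
        | zero => exact le_rfl
        | succ d ihd => exact (h (T + d) (by omega)).trans ihd
      obtain ⟨d, rfl⟩ := Nat.exists_eq_add_of_le ht
      have hlt : f (T + d) < v := hv ▸ lt_of_le_of_ne (hle d) hne
      obtain ⟨T', hT', hc'⟩ := ih _ hlt (T := T + d) (fun t ht => h t (by omega)) rfl
      exact ⟨T', by omega, hc'⟩

/-- A counter modulo `g + 1` that is increased infinitely often is increased infinitely often at
each of its values. -/
theorem frequently_mode_eq {g : ℕ} {mode : ℕ → Fin (g + 1)} {sw : ℕ → Prop}
    (hsw : ∀ t, sw t → mode (t + 1) = mode t + 1) (hns : ∀ t, ¬ sw t → mode (t + 1) = mode t)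
    (h : ∃ᶠ t in atTop, sw t) (r : Fin (g + 1)) : ∃ᶠ t in atTop, sw t ∧ mode t = r := by
  classical
  rw [frequently_atTop] at h ⊢
  have hnext : ∀ T, ∃ t ≥ T, sw t ∧ mode t = mode T := by
    intro T
    have hex : ∃ d, sw (T + d) := by
      obtain ⟨t, ht, hs⟩ := h T
      exact ⟨t - T, by rwa [Nat.add_sub_cancel' ht]⟩
    have hconst : ∀ d ≤ Nat.find hex, mode (T + d) = mode T := by
      intro d
      induction d with
      | zero => simp
      | succ d ih =>
        intro hd
        rw [← add_assoc, hns _ (Nat.find_min hex (by omega)), ih (by omega)]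
    exact ⟨_, Nat.le_add_right _ _, Nat.find_spec hex, hconst _ le_rfl⟩
  intro T
  -- Between two increments the counter is constant, so its values at successive increments run
  -- through all residues; `d` counts the increments that are skipped.
  have hall : ∀ d : ℕ, ∃ t ≥ T, sw t ∧ mode t = mode T + Fin.ofNat (g + 1) d := by
    intro d
    induction d with
    | zero => exact (hnext T).imp fun t h => ⟨h.1, h.2.1, by rw [h.2.2]; simp⟩
    | succ d ih =>
      obtain ⟨t, ht, hs, hm⟩ := ih
      obtain ⟨t', ht', hs', hm'⟩ := hnext (t + 1)
      exact ⟨t', by omega, hs', by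
        rw [hm', hsw t hs, hm, add_assoc]
        congr 1
        ext
        simp [Fin.val_add]⟩
  obtain ⟨t, ht, hs, hm⟩ := hall (r - mode T : Fin (g + 1)).val
  refine ⟨t, ht, hs, ?_⟩
  rw [hm, show Fin.ofNat (g + 1) (r - mode T).val = r - mode T from by ext; simp]
  abel

end Runs

/-! ### Finite-memory strategies from rank functions. -/

section Strategies

variable {S B C : Type*} (tr : S → B → C → S)

/-- The states from which the player who chooses in `C`, knowing the choice in `B`, can force the
successor to lie in `X`. -/
def cpre (X : Set S) : Set S := {s | ∀ b, ∃ c, tr s b c ∈ X}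

theorem cpre_mono : Monotone (cpre tr) := fun _ _ h _ hs b => (hs b).imp fun _ hc => h hc

variable {tr} {a g : ℕ} {θ : Fin (g + 1) → Set S} {ψ : Fin (a + 1) → Set S}

/-- The memory is the guarantee `r` being pursued, and the rank of a state is the least `ρ` with the
state in `Xs r ρ`. In a state of the first kind the play is kept in `Z`, where every guarantee has a
rank, and `r` advances. Otherwise the rank falls, or does not rise while ψ at `lab ρ` fails. If `r`
advances infinitely often, all guarantees recur. If not, the rank becomes constant and from then on
a single assumption fails at every step. -/
theorem exists_responder_strategy [Nonempty C] {Z : Set S} {Xs : Fin (g + 1) → ℕ → Set S}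
    {lab : ℕ → Fin (a + 1)} (hZ : ∀ r, ∀ s ∈ Z, ∃ ρ, s ∈ Xs r ρ)
    (hX : ∀ r ρ, ∀ s ∈ Xs r ρ, (s ∈ θ r ∧ s ∈ cpre tr Z) ∨
      s ∈ cpre tr (⋃ ρ' < ρ, Xs r ρ') ∨ (s ∉ ψ (lab ρ) ∧ s ∈ cpre tr (Xs r ρ))) :
    ∃ (f : S → Fin (g + 1) → B → C) (u : S → Fin (g + 1) → Fin (g + 1)),
      ∀ (s : ℕ → S) (b : ℕ → B) (mode : ℕ → Fin (g + 1)), s 0 ∈ Z →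
        (∀ t, s (t + 1) = tr (s t) (b t) (f (s t) (mode t) (b t))) →
        (∀ t, mode (t + 1) = u (s t) (mode t)) →
        (∀ l, ∃ᶠ t in atTop, s t ∈ ψ l) → ∀ r, ∃ᶠ t in atTop, s t ∈ θ r := by
  classical
  let rank : S → Fin (g + 1) → ℕ := fun s r => sInf {ρ | s ∈ Xs r ρ}
  have hrank : ∀ {s r}, (∃ ρ, s ∈ Xs r ρ) → s ∈ Xs r (rank s r) := fun h => Nat.sInf_mem h
  have hle : ∀ {s r ρ}, s ∈ Xs r ρ → rank s r ≤ ρ := fun h => Nat.sInf_le h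
  let good : S → Fin (g + 1) → Prop := fun s r => s ∈ θ r ∧ s ∈ cpre tr Z
  have hchoice : ∀ s r b, ∃ c, (∃ ρ, s ∈ Xs r ρ) →
      (good s r → tr s b c ∈ Z) ∧
      (¬ good s r → (∃ ρ, tr s b c ∈ Xs r ρ) ∧ (rank (tr s b c) r < rank s r ∨
        (s ∉ ψ (lab (rank s r)) ∧ rank (tr s b c) r ≤ rank s r))) := by
    intro s r b
    by_cases hs : ∃ ρ, s ∈ Xs r ρ
    · by_cases hg : good s r
      · obtain ⟨c, hc⟩ := hg.2 b
        exact ⟨c, fun _ => ⟨fun _ => hc, fun h => absurd hg h⟩⟩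
      · rcases hX r _ s (hrank hs) with h | h | ⟨h1, h2⟩
        · exact absurd h hg
        · obtain ⟨c, hc⟩ := h b
          simp only [mem_iUnion] at hc
          obtain ⟨ρ, hρ, hc⟩ := hc
          exact ⟨c, fun _ => ⟨fun h => absurd h hg, fun _ =>
            ⟨⟨ρ, hc⟩, Or.inl ((hle hc).trans_lt hρ)⟩⟩⟩
        · obtain ⟨c, hc⟩ := h2 b
          exact ⟨c, fun _ => ⟨fun h => absurd h hg, fun _ =>
            ⟨⟨_, hc⟩, Or.inr ⟨h1, hle hc⟩⟩⟩⟩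
    · exact ⟨Classical.arbitrary C, fun h => absurd h hs⟩
  choose f hf using hchoice
  refine ⟨f, fun s r => if good s r then r + 1 else r, ?_⟩
  intro s b mode h0 hstep hmode hψ r
  replace hmode : ∀ t, mode (t + 1) = if good (s t) (mode t) then mode t + 1 else mode t := hmode
  have hinv : ∀ t, ∃ ρ, s t ∈ Xs (mode t) ρ := by
    intro t
    induction t with
    | zero => exact hZ _ _ h0
    | succ t ih =>
      have h := hf (s t) (mode t) (b t) ih
      rw [hmode, hstep]
      by_cases hg : good (s t) (mode t)
      · rw [if_pos hg]; exact hZ _ _ (h.1 hg)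
      · rw [if_neg hg]; exact (h.2 hg).1
  by_cases hsw : ∃ᶠ t in atTop, good (s t) (mode t)
  · refine (frequently_mode_eq (mode := mode) (fun t ht => ?_) (fun t ht => ?_) hsw r).mono ?_
    · rw [hmode, if_pos ht]
    · rw [hmode, if_neg ht]
    · rintro t ⟨h1, h2⟩
      exact h2 ▸ h1.1
  · exfalso
    rw [not_frequently, eventually_atTop] at hsw
    obtain ⟨T, hT⟩ := hsw
    have hconst : ∀ t ≥ T, mode (t + 1) = mode t := fun t ht => by rw [hmode, if_neg (hT t ht)]
    have hdec : ∀ t ≥ T, rank (s (t + 1)) (mode (t + 1)) < rank (s t) (mode t) ∨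
        (s t ∉ ψ (lab (rank (s t) (mode t))) ∧
          rank (s (t + 1)) (mode (t + 1)) ≤ rank (s t) (mode t)) := by
      intro t ht
      rw [hconst t ht, hstep]
      exact ((hf (s t) (mode t) (b t) (hinv t)).2 (hT t ht)).2
    obtain ⟨T', hT', hc⟩ := eventually_const_of_antitone
      (f := fun t => rank (s t) (mode t)) (T := T) fun t ht => by
        rcases hdec t ht with h | h
        · exact h.le
        · exact h.2
    refine hψ (lab (rank (s T') (mode T'))) (eventually_atTop.2 ⟨T', fun t ht => ?_⟩)
    have h1 := hc t ht
    have h2 := hc (t + 1) (by omega)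
    rcases hdec t (by omega) with h | h
    · omega
    · rw [← h1]; exact h.1

/-- The dual argument has two measures: the rank `ρ`, which never rises, and the distance `t` to the
assumption `l` being pursued. When the rank has settled, the guarantee at `lab ρ` fails forever.
From then on the distance falls until `ψ l` is met and `l` advances, so all assumptions recur. -/
theorem exists_chooser_strategy [Nonempty B] {W : Set S} {Ws : ℕ → Set S}
    {Xc : ℕ → Fin (a + 1) → ℕ → Set S} {lab : ℕ → Fin (g + 1)}
    (hW : ∀ s ∈ W, ∃ ρ, s ∈ Ws ρ) (hWs : ∀ ρ l, ∀ s ∈ Ws ρ, ∃ t, s ∈ Xc ρ l t)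
    (hX : ∀ ρ l t, ∀ s ∈ Xc ρ l t,
      (s ∉ θ (lab ρ) ∨ ∃ b, ∀ c, tr s b c ∈ ⋃ ρ' < ρ, Ws ρ') ∧ (∃ b, ∀ c, tr s b c ∈ Ws ρ) ∧
      (s ∈ ψ l ∨ ∃ b, ∀ c, tr s b c ∈ ⋃ t' < t, Xc ρ l t')) :
    ∃ (f : S → Fin (a + 1) → B) (u : S → Fin (a + 1) → Fin (a + 1)),
      ∀ (s : ℕ → S) (c : ℕ → C) (mode : ℕ → Fin (a + 1)), s 0 ∈ W →
        (∀ t, s (t + 1) = tr (s t) (f (s t) (mode t)) (c t)) →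
        (∀ t, mode (t + 1) = u (s t) (mode t)) →
        (∀ l, ∃ᶠ t in atTop, s t ∈ ψ l) ∧ ∃ r, ¬ ∃ᶠ t in atTop, s t ∈ θ r := by
  classical
  let rank : S → Fin (a + 1) → ℕ := fun s l => sInf {ρ | ∃ t, s ∈ Xc ρ l t}
  let dist : S → Fin (a + 1) → ℕ := fun s l => sInf {t | s ∈ Xc (rank s l) l t}
  have hrank : ∀ {s l}, (∃ ρ t, s ∈ Xc ρ l t) → s ∈ Xc (rank s l) l (dist s l) :=
    fun {s l} h => Nat.sInf_mem (s := {t | s ∈ Xc (rank s l) l t})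
      (Nat.sInf_mem (s := {ρ | ∃ t, s ∈ Xc ρ l t}) h)
  have hrle : ∀ {s l ρ t}, s ∈ Xc ρ l t → rank s l ≤ ρ := fun h => Nat.sInf_le ⟨_, h⟩
  have hdle : ∀ {s l t}, s ∈ Xc (rank s l) l t → dist s l ≤ t := fun h => Nat.sInf_le h
  have hWle : ∀ {s l ρ}, s ∈ Ws ρ → (∃ ρ t, s ∈ Xc ρ l t) ∧ rank s l ≤ ρ := by
    intro s l ρ h
    obtain ⟨t, ht⟩ := hWs ρ l s h
    exact ⟨⟨ρ, t, ht⟩, hrle ht⟩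
  -- Lowering the rank takes precedence over everything else. It can happen only finitely often, and
  -- where it is impossible the guarantee of the current rank must fail.
  let drop : S → Fin (a + 1) → Prop := fun s l => ∃ b, ∀ c, tr s b c ∈ ⋃ ρ' < rank s l, Ws ρ'
  have hchoice : ∀ s l, ∃ b, (∃ ρ t, s ∈ Xc ρ l t) → ∀ c,
      (drop s l → (∀ l', ∃ ρ t, tr s b c ∈ Xc ρ l' t) ∧ ∀ l', rank (tr s b c) l' < rank s l) ∧
      (¬ drop s l → s ∉ θ (lab (rank s l)) ∧
        (s ∈ ψ l → (∃ ρ t, tr s b c ∈ Xc ρ (l + 1) t) ∧ rank (tr s b c) (l + 1) ≤ rank s l) ∧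
        (s ∉ ψ l → (∃ ρ t, tr s b c ∈ Xc ρ l t) ∧ rank (tr s b c) l ≤ rank s l ∧
          (rank (tr s b c) l = rank s l → dist (tr s b c) l < dist s l))) := by
    intro s l
    by_cases hs : ∃ ρ t, s ∈ Xc ρ l t
    · by_cases hd : drop s l
      · obtain ⟨b, hb⟩ := id hd
        refine ⟨b, fun _ c => ⟨fun _ => ?_, fun h => absurd hd h⟩⟩
        have := hb c
        simp only [mem_iUnion] at this
        obtain ⟨ρ, hρ, hc⟩ := this
        exact ⟨fun l' => (hWle hc).1, fun l' => (hWle hc).2.trans_lt hρ⟩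
      · obtain ⟨h1, ⟨b, hb⟩, h3⟩ := hX _ _ _ s (hrank hs)
        have h1 : s ∉ θ (lab (rank s l)) := h1.resolve_right hd
        by_cases hp : s ∈ ψ l
        · exact ⟨b, fun _ c => ⟨fun h => absurd h hd, fun _ =>
            ⟨h1, fun _ => hWle (hb c), fun h => absurd hp h⟩⟩⟩
        · obtain ⟨b, hb⟩ := h3.resolve_left hp
          refine ⟨b, fun _ c => ⟨fun h => absurd h hd, fun _ =>
            ⟨h1, fun h => absurd h hp, fun _ => ?_⟩⟩⟩
          have := hb c
          simp only [mem_iUnion] at this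
          obtain ⟨t, ht, hc⟩ := this
          refine ⟨⟨_, _, hc⟩, hrle hc, fun h => ?_⟩
          rw [← h] at hc
          exact (hdle hc).trans_lt ht
    · exact ⟨Classical.arbitrary B, fun h => absurd h hs⟩
  choose f hf using hchoice
  let sw : S → Fin (a + 1) → Prop := fun s l => ¬ drop s l ∧ s ∈ ψ l
  refine ⟨f, fun s l => if sw s l then l + 1 else l, ?_⟩
  intro s c mode h0 hstep hmode
  replace hmode : ∀ t, mode (t + 1) = if sw (s t) (mode t) then mode t + 1 else mode t := hmode
  have hinv : ∀ t, ∃ ρ t', s t ∈ Xc ρ (mode t) t' := by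
    intro t
    induction t with
    | zero => obtain ⟨ρ, hρ⟩ := hW _ h0; exact ⟨ρ, hWs ρ _ _ hρ⟩
    | succ t ih =>
      have h := hf (s t) (mode t) ih (c t)
      rw [hmode, hstep]
      by_cases hd : drop (s t) (mode t)
      · rw [if_neg (fun h => h.1 hd)]; exact (h.1 hd).1 _
      · by_cases hp : s t ∈ ψ (mode t)
        · rw [if_pos ⟨hd, hp⟩]; exact ((h.2 hd).2.1 hp).1
        · rw [if_neg (fun h => hp h.2)]; exact ((h.2 hd).2.2 hp).1
  have hmono : ∀ t, rank (s (t + 1)) (mode (t + 1)) ≤ rank (s t) (mode t) ∧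
      (drop (s t) (mode t) → rank (s (t + 1)) (mode (t + 1)) < rank (s t) (mode t)) := by
    intro t
    have h := hf (s t) (mode t) (hinv t) (c t)
    rw [hmode, hstep]
    by_cases hd : drop (s t) (mode t)
    · exact ⟨((h.1 hd).2 _).le, fun _ => (h.1 hd).2 _⟩
    · refine ⟨?_, fun h => absurd h hd⟩
      by_cases hp : s t ∈ ψ (mode t)
      · rw [if_pos ⟨hd, hp⟩]; exact ((h.2 hd).2.1 hp).2
      · rw [if_neg (fun h => hp h.2)]; exact ((h.2 hd).2.2 hp).2.1
  obtain ⟨T, -, hT⟩ := eventually_const_of_antitone (f := fun t => rank (s t) (mode t)) (T := 0)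
    fun t _ => (hmono t).1
  have hnd : ∀ t ≥ T, ¬ drop (s t) (mode t) := fun t ht hd => by
    have := (hmono t).2 hd
    rw [hT t ht, hT (t + 1) (by omega)] at this
    omega
  constructor
  · have hfreq : ∃ᶠ t in atTop, sw (s t) (mode t) := by
      intro hev
      obtain ⟨T', hT'⟩ := eventually_atTop.1 hev
      -- With the rank constant and the assumption never switched, the distance would fall forever.
      -- Distances are comparable only between states of equal rank, which is why the time `T` is
      -- needed.
      have hlt : ∀ t ≥ max T T', dist (s (t + 1)) (mode (t + 1)) < dist (s t) (mode t) := by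
        intro t ht
        have hns := hT' t (le_trans (le_max_right _ _) ht)
        have hd := hnd t (le_trans (le_max_left _ _) ht)
        have hp : s t ∉ ψ (mode t) := fun hp => hns ⟨hd, hp⟩
        have h := ((hf (s t) (mode t) (hinv t) (c t)).2 hd).2.2 hp
        have hm : mode (t + 1) = mode t := by rw [hmode, if_neg hns]
        have e1 := hT t (le_trans (le_max_left _ _) ht)
        have e2 := hT (t + 1) (by have := le_trans (le_max_left _ _) ht; omega)
        rw [hm] at e2 ⊢
        rw [hstep] at e2 ⊢
        exact h.2.2 (e2.trans e1.symm)
      obtain ⟨T'', h1, h2⟩ := eventually_const_of_antitone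
        (f := fun t => dist (s t) (mode t)) (T := max T T') fun t ht => (hlt t ht).le
      have := hlt T'' h1
      have := h2 (T'' + 1) (by omega)
      omega
    intro l
    refine (frequently_mode_eq (mode := mode) (fun t ht => ?_) (fun t ht => ?_) hfreq l).mono ?_
    · rw [hmode, if_pos ht]
    · rw [hmode, if_neg ht]
    · rintro t ⟨h1, h2⟩
      exact h2 ▸ h1.2
  · refine ⟨lab (rank (s T) (mode T)), fun h => h (eventually_atTop.2 ⟨T, fun t ht => ?_⟩)⟩
    have := ((hf (s t) (mode t) (hinv t) (c t)).2 (hnd t ht)).1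
    rwa [hT t ht] at this

end Strategies

/-! ### Winning strategies of both players from the fixed point. -/

section Determinacy

variable {S B C : Type*} {tr : S → B → C → S} {a g N : ℕ} {θ : Fin (g + 1) → Set S}
  {ψ : Fin (a + 1) → Set S}

/-- Pairs of a stage `i` and an index `l` are ordered lexicographically by the single number `i * (a
+ 1) + l`, which serves as rank. Membership in stage `i` then provides a rank below `i * (a + 1)`.
-/
theorem exists_lt_of_mem_iterate {S : Type*} {F : ℕ → Set S} {X : ℕ → Fin (a + 1) → Set S}
    (h0 : F 0 = ∅) (hF : ∀ i, F (i + 1) = ⋃ l, X i l) {i : ℕ} {s : S} (hs : s ∈ F i) :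
    s ∈ ⋃ ρ < i * (a + 1), X (ρ / (a + 1)) (Fin.ofNat (a + 1) ρ) := by
  cases i with
  | zero => rw [h0] at hs; exact absurd hs (notMem_empty s)
  | succ i =>
    rw [hF] at hs
    obtain ⟨l, hl⟩ := mem_iUnion.1 hs
    simp only [mem_iUnion]
    refine ⟨i * (a + 1) + l, ?_, ?_⟩
    · have := l.2; rw [add_mul]; omega
    · have h1 : (i * (a + 1) + l) / (a + 1) = i := by
        rw [mul_comm, Nat.mul_add_div (by omega), Nat.div_eq_of_lt l.2, add_zero]
      have h2 : Fin.ofNat (a + 1) (i * (a + 1) + l) = l := by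
        ext
        simp [Fin.ofNat, Nat.mod_eq_of_lt l.2]
      rwa [h1, h2]

/-- A rank encodes an iterate of Y together with an assumption, and the set of that rank is the
corresponding fixed point X. Unfolding X once yields the three alternatives; in the middle one,
lying in the iterate of Y gives a smaller rank. -/
theorem exists_responder_strategy_of_mem_fixZ [Finite S] [Nonempty C] (hN : Nat.card S ≤ N) :
    ∃ (f : S → Fin (g + 1) → B → C) (u : S → Fin (g + 1) → Fin (g + 1)),
      ∀ (s : ℕ → S) (b : ℕ → B) (mode : ℕ → Fin (g + 1)), s 0 ∈ fixZ (cpre tr) N θ ψ →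
        (∀ t, s (t + 1) = tr (s t) (b t) (f (s t) (mode t) (b t))) →
        (∀ t, mode (t + 1) = u (s t) (mode t)) →
        (∀ l, ∃ᶠ t in atTop, s t ∈ ψ l) → ∀ r, ∃ᶠ t in atTop, s t ∈ θ r := by
  have hcp := cpre_mono tr
  have hfix : stepZ (cpre tr) N θ ψ (fixZ (cpre tr) N θ ψ) = fixZ (cpre tr) N θ ψ :=
    iterate_univ_isFixedPt (stepZ_mono N hcp) hN
  set Z := fixZ (cpre tr) N θ ψ
  have hY : ∀ {r i s}, s ∈ (stepY (cpre tr) N (θ r) ψ Z)^[i] ∅ →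
      s ∈ ⋃ ρ < i * (a + 1), fixX (cpre tr) N (θ r) (ψ (Fin.ofNat (a + 1) ρ)) Z
        ((stepY (cpre tr) N (θ r) ψ Z)^[ρ / (a + 1)] ∅) := by
    intro r i s hs
    exact exists_lt_of_mem_iterate (F := fun i => (stepY (cpre tr) N (θ r) ψ Z)^[i] ∅)
      (X := fun i l => fixX (cpre tr) N (θ r) (ψ l) Z ((stepY (cpre tr) N (θ r) ψ Z)^[i] ∅)) rfl
      (fun i => Function.iterate_succ_apply' _ _ _) hs
  refine exists_responder_strategy (lab := Fin.ofNat (a + 1)) (Xs := fun r ρ =>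
    fixX (cpre tr) N (θ r) (ψ (Fin.ofNat (a + 1) ρ)) Z
        ((stepY (cpre tr) N (θ r) ψ Z)^[ρ / (a + 1)] ∅)) (fun r s hs => ?_) fun r ρ s hs => ?_
  · rw [← hfix] at hs
    have := hY (mem_iInter.1 hs r)
    simp only [mem_iUnion] at this
    obtain ⟨ρ, -, h⟩ := this
    exact ⟨ρ, h⟩
  · have hf := iterate_univ_isFixedPt (F := stepX (cpre tr) (θ r) (ψ (Fin.ofNat (a + 1) ρ)) Z
      ((stepY (cpre tr) N (θ r) ψ Z)^[ρ / (a + 1)] ∅))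
      (fun _ _ h => stepX_mono hcp subset_rfl subset_rfl h) hN
    change s ∈ (stepX _ _ _ _ _)^[N] univ at hs
    rw [← hf] at hs
    rcases hs with (h | h) | h
    · exact Or.inl h
    · refine Or.inr (Or.inl (hcp (fun x hx => ?_) h))
      have := hY hx
      simp only [mem_iUnion] at this ⊢
      obtain ⟨ρ', h1, h2⟩ := this
      exact ⟨ρ', lt_of_lt_of_le h1 (Nat.div_mul_le_self _ _), h2⟩
    · exact Or.inr (Or.inr h)

/-- A rank encodes an iterate of Z together with a guarantee. For each rank Y is taken at its fixed
point, so that every X computed from it lies inside Y; the stage at which a state outside Y leaves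
the iteration of X is then the distance to the assumption. -/
theorem exists_chooser_strategy_of_notMem_fixZ [Finite S] [Nonempty B] (hN : Nat.card S ≤ N) :
    ∃ (f : S → Fin (a + 1) → B) (u : S → Fin (a + 1) → Fin (a + 1)),
      ∀ (s : ℕ → S) (c : ℕ → C) (mode : ℕ → Fin (a + 1)), s 0 ∉ fixZ (cpre tr) N θ ψ →
        (∀ t, s (t + 1) = tr (s t) (f (s t) (mode t)) (c t)) →
        (∀ t, mode (t + 1) = u (s t) (mode t)) →
        (∀ l, ∃ᶠ t in atTop, s t ∈ ψ l) ∧ ∃ r, ¬ ∃ᶠ t in atTop, s t ∈ θ r := by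
  have hcp := cpre_mono tr
  let Zi : ℕ → Set S := fun i => (stepZ (cpre tr) N θ ψ)^[i] univ
  let Yf : ℕ → Set S := fun ρ => fixY (cpre tr) N (θ (Fin.ofNat (g + 1) ρ)) ψ (Zi (ρ / (g + 1)))
  let Xi : ℕ → Fin (a + 1) → ℕ → Set S := fun ρ l t =>
    (stepX (cpre tr) (θ (Fin.ofNat (g + 1) ρ)) (ψ l) (Zi (ρ / (g + 1))) (Yf ρ))^[t] univ
  have hYf : ∀ ρ l, Xi ρ l N ⊆ Yf ρ := by
    intro ρ l
    have := iterate_empty_isFixedPt (F := stepY (cpre tr) N (θ (Fin.ofNat (g + 1) ρ)) ψ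
      (Zi (ρ / (g + 1)))) (fun _ _ h => stepY_mono N hcp subset_rfl h) hN
    change stepY (cpre tr) N (θ (Fin.ofNat (g + 1) ρ)) ψ (Zi (ρ / (g + 1))) (Yf ρ) = Yf ρ at this
    rw [← this]
    exact subset_iUnion (fun l => fixX (cpre tr) N (θ (Fin.ofNat (g + 1) ρ)) (ψ l)
      (Zi (ρ / (g + 1))) (Yf ρ)) l
  have hZi : ∀ {i s}, s ∉ Zi i → s ∈ ⋃ ρ < i * (g + 1), (Yf ρ)ᶜ := by
    intro i s hs
    exact exists_lt_of_mem_iterate (F := fun i => (Zi i)ᶜ)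
      (X := fun i l => (fixY (cpre tr) N (θ l) ψ (Zi i))ᶜ) (by simp [Zi])
      (fun i => by simp only [Zi]; rw [Function.iterate_succ_apply', ← compl_iInter]; rfl) hs
  have hnot : ∀ {s : S} {X : Set S}, s ∉ cpre tr X → ∃ b, ∀ c, tr s b c ∉ X := by
    intro s X h
    simpa [cpre] using h
  refine exists_chooser_strategy (W := (fixZ (cpre tr) N θ ψ)ᶜ) (Ws := fun ρ => (Yf ρ)ᶜ)
    (Xc := fun ρ l t => (Xi ρ l t)ᶜ) (lab := Fin.ofNat (g + 1)) (fun s hs => ?_)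
    (fun ρ l s hs => ⟨N, fun h => hs (hYf ρ l h)⟩) fun ρ l t s hs => ?_
  · have := hZi hs
    simp only [mem_iUnion] at this
    obtain ⟨ρ, -, h⟩ := this
    exact ⟨ρ, h⟩
  · cases t with
    -- The iteration of X starts from all states, so no state has distance 0.
    | zero => exact absurd (mem_univ s) hs
    | succ t =>
      have hs' : s ∉ stepX (cpre tr) (θ (Fin.ofNat (g + 1) ρ)) (ψ l) (Zi (ρ / (g + 1))) (Yf ρ)
          (Xi ρ l t) := by
        rw [mem_compl_iff] at hs
        simpa only [Xi, Function.iterate_succ_apply'] using hs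
      simp only [stepX, mem_union, mem_inter_iff, mem_compl_iff, not_or, not_and] at hs'
      obtain ⟨⟨h1, h2⟩, h3⟩ := hs'
      refine ⟨?_, hnot h2, ?_⟩
      · by_cases h : s ∈ θ (Fin.ofNat (g + 1) ρ)
        · obtain ⟨b, hb⟩ := hnot (h1 h)
          refine Or.inr ⟨b, fun c => ?_⟩
          have := hZi (hb c)
          simp only [mem_iUnion] at this ⊢
          obtain ⟨ρ', h1, h2⟩ := this
          exact ⟨ρ', lt_of_lt_of_le h1 (Nat.div_mul_le_self _ _), h2⟩
        · exact Or.inl h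
      · by_cases h : s ∈ ψ l
        · exact Or.inl h
        · obtain ⟨b, hb⟩ := hnot (fun h' => h (by_contra fun h'' => h3 h'' h'))
          refine Or.inr ⟨b, fun c => ?_⟩
          simp only [mem_iUnion]
          exact ⟨t, Nat.lt_succ_self t, hb c⟩

end Determinacy

/-! ### Punishing regions as complements of winning regions -/

/-- Truth of a Boolean formula under the valuation `v`. -/
def BoolForm.Holds {AP : Type} (v : Set AP) : BoolForm AP → Prop
  | .top => True
  | .atom p => p ∈ v
  | .neg f => ¬ f.Holds v
  | .or f g => f.Holds v ∨ g.Holds v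

namespace LTL

variable {AP : Type} {α : ℕ → Set AP} {t : ℕ}

theorem satAt_boolForm (f : BoolForm AP) : SatAt α f.toLTL t ↔ f.Holds (α t) := by
  induction f with
  | top => rfl
  | atom p => rfl
  | neg f ih => exact not_congr ih
  | or f g ihf ihg => exact or_congr ihf ihg

theorem satAt_and {f g : LTL AP} : SatAt α (f.and g) t ↔ SatAt α f t ∧ SatAt α g t := by
  simp [LTL.and, SatAt, not_or]

theorem satAt_conj (l : List (LTL AP)) : SatAt α (conj l) t ↔ ∀ f ∈ l, SatAt α f t := by
  induction l with
  | nil => simp [conj, SatAt]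
  | cons f l ih =>
    rw [List.forall_mem_cons, ← ih]
    exact satAt_and

theorem satAt_always_eventually {f : LTL AP} :
    SatAt α f.eventually.always 0 ↔ ∃ᶠ t in atTop, SatAt α f t := by
  simp [always, eventually, SatAt, frequently_atTop]

end LTL

namespace GR1

variable {AP St : Type} (γ : GR1 AP) (lab : St → Set AP)

/-- The states that satisfy the assumption number `l`, where `⊤` is added in front. -/
def assumptionSet (l : Fin (γ.assumptions.length + 1)) : Set St :=
  {s | ((BoolForm.top :: γ.assumptions).getD l .top).Holds (lab s)}

/-- The states that satisfy the guarantee number `r`, where `⊤` is added at the end. -/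
def guaranteeSet (r : Fin (γ.guarantees.length + 1)) : Set St :=
  {s | (γ.guarantees.getD r .top).Holds (lab s)}

/-- A conjunct `GF ⊤` on either side changes nothing. It makes both index sets non-empty, as the
cyclic counters require, even if the goal has no assumptions or no guarantees. -/
theorem sat_toLTL (s : ℕ → St) : LTL.Sat (fun t => lab (s t)) γ.toLTL ↔
    ((∀ l, ∃ᶠ t in atTop, s t ∈ γ.assumptionSet lab l) →
      ∀ r, ∃ᶠ t in atTop, s t ∈ γ.guaranteeSet lab r) := by
  have h : LTL.Sat (fun t => lab (s t)) γ.toLTL ↔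
      ((∀ f ∈ γ.assumptions, ∃ᶠ t in atTop, f.Holds (lab (s t))) →
        ∀ f ∈ γ.guarantees, ∃ᶠ t in atTop, f.Holds (lab (s t))) := by
    unfold LTL.Sat toLTL LTL.imp
    rw [imp_iff_not_or]
    simp only [LTL.SatAt, LTL.satAt_conj, List.forall_mem_map, LTL.satAt_always_eventually,
      LTL.satAt_boolForm]
  rw [h]
  refine imp_congr ⟨fun h l => ?_, fun h f hf => ?_⟩ ⟨fun h r => ?_, fun h f hf => ?_⟩
  · obtain ⟨l, hl⟩ := l
    cases l with
    | zero => exact Frequently.of_forall fun t => trivial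
    | succ l =>
      have hl' : l < γ.assumptions.length := by omega
      simpa [assumptionSet, List.getElem?_eq_getElem hl'] using h _ (List.getElem_mem hl')
  · obtain ⟨l, hl, rfl⟩ := List.getElem_of_mem hf
    simpa [assumptionSet, List.getElem?_eq_getElem hl] using h ⟨l + 1, by omega⟩
  · obtain ⟨r, hr⟩ := r
    by_cases hr' : r < γ.guarantees.length
    · simpa [guaranteeSet, List.getElem?_eq_getElem hr'] using h _ (List.getElem_mem hr')
    · refine Frequently.of_forall fun t => ?_
      simp only [guaranteeSet, mem_ofPred_eq]
      rw [List.getD_eq_default _ _ (not_lt.1 hr')]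
      trivial
  · obtain ⟨r, hr, rfl⟩ := List.getElem_of_mem hf
    simpa [guaranteeSet, List.getElem?_eq_getElem hr] using h ⟨r, by omega⟩

end GR1

namespace Strategy

variable {N Ac St AP : Type} {A : Arena N Ac St AP} {i : N}

/-- The internal state of a strategy after it has read `x 0, …, x (t - 1)`. -/
def stateAt (S : Strategy A i) (x : ℕ → N → Ac) : ℕ → S.Q
  | 0 => S.q0
  | t + 1 => S.δ (S.stateAt x t) (x t)

def play (S : Strategy A i) (x : ℕ → N → Ac) (t : ℕ) : Ac := S.τ (S.stateAt x t)

theorem play_mem (S : Strategy A i) (x : ℕ → N → Ac) (t : ℕ) : S.play x t ∈ A.act i :=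
  S.τ_mem _

end Strategy

namespace Arena

variable {N Ac St AP : Type} {A : Arena N Ac St AP}

/-- Describing the internal state of a player through the sequence of action profiles it reads
separates the players. The equations for `combine` can then be used one player at a time, without
transport between types of internal states. -/
theorem run_snd (σ : A.Profile) (s : St) (t : ℕ) (i : N) :
    (run σ s t).2 i = (σ i).stateAt (fun t => (outcome σ s t).2) t := by
  induction t with
  | zero => rfl
  | succ t ih => simp only [Strategy.stateAt, ← ih]; rfl

theorem outcome_snd (σ : A.Profile) (s : St) (t : ℕ) (i : N) :
    (outcome σ s t).2 i = (σ i).play (fun t => (outcome σ s t).2) t := by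
  simp only [Strategy.play, ← run_snd]; rfl

theorem combine_self {j : N} (σ : A.CoProfile j) (σ' : Strategy A j) : combine σ σ' j = σ' := by
  simp [combine]

theorem combine_of_ne {j i : N} (σ : A.CoProfile j) (σ' : Strategy A j) (h : i ≠ j) :
    combine σ σ' i = σ i h := by
  simp [combine, h]

/-- Action profiles in which every player uses an available action. -/
abbrev Legal (A : Arena N Ac St AP) : Type := {x : N → Ac // ∀ i, x i ∈ A.act i}

instance : Nonempty A.Legal :=
  ⟨⟨fun i => (A.act_nonempty i).some, fun i => (A.act_nonempty i).some_mem⟩⟩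

variable [DecidableEq N]

/-- The turn-based game in which player `j` moves after the other players. -/
def turn (A : Arena N Ac St AP) (j : N) (s : St) (b : A.Legal) (c : A.act j) : St :=
  A.tr s (Function.update b.1 j c)

end Arena

namespace Game

open Arena

variable {N Ac St AP : Type} [DecidableEq N] (G : Game N Ac St AP) (j : N)

/-- The states in which player `j` wins the turn-based game. -/
def winRegion (K : ℕ) : Set St :=
  fixZ (cpre (G.arena.turn j)) K ((G.goal j).guaranteeSet G.arena.label)
    ((G.goal j).assumptionSet G.arena.label)

variable [Finite St] {K : ℕ} (hK : Nat.card St ≤ K)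
include hK

/-- Player `j` runs the machines of all opponents alongside the arena state and the memory of the
turn-based strategy. The product is again finite, and it reveals the choice of the opponents before
`j` has to output an action. -/
theorem notMem_Pun_of_mem_winRegion [Finite N] {s : St} (hs : s ∈ G.winRegion j K) : s ∉ G.Pun j := by
  classical
  rintro ⟨σ, hσ⟩
  let A := G.arena
  have : Nonempty (A.act j) := (A.act_nonempty j).to_subtype
  obtain ⟨f, u, hfu⟩ := exists_responder_strategy_of_mem_fixZ (tr := A.turn j)
    (θ := (G.goal j).guaranteeSet A.label) (ψ := (G.goal j).assumptionSet A.label) hK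
  let choice : (∀ i, ∀ h : i ≠ j, (σ i h).Q) → A.Legal := fun q =>
    ⟨fun i => if h : i = j then (A.act_nonempty i).some else (σ i h).τ (q i h), fun i => by
      by_cases h : i = j
      · simp only [h, dite_true]; exact (A.act_nonempty j).some_mem
      · simp only [h, dite_false]; exact (σ i h).τ_mem _⟩
  have hfin : ∀ i, ∀ h : i ≠ j, Finite (σ i h).Q := fun i h => (σ i h).finite_Q
  let σ' : Strategy A j :=
    { Q := (∀ i, ∀ h : i ≠ j, (σ i h).Q) × St × Fin ((G.goal j).guarantees.length + 1)
      finite_Q := inferInstance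
      q0 := (fun i h => (σ i h).q0, s, 0)
      δ := fun q x => (fun i h => (σ i h).δ (q.1 i h) x, A.tr q.2.1 x, u q.2.1 q.2.2)
      τ := fun q => f q.2.1 q.2.2 (choice q.1)
      τ_mem := fun q => (f q.2.1 q.2.2 (choice q.1)).2 }
  apply hσ σ'
  let π := outcome (combine σ σ') s
  let x : ℕ → N → Ac := fun t => (π t).2
  have hstate : ∀ t, (σ'.stateAt x t).1 = (fun i h => (σ i h).stateAt x t) ∧
      (σ'.stateAt x t).2.1 = (π t).1 := by
    intro t
    induction t with
    | zero => exact ⟨rfl, rfl⟩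
    | succ t ih =>
      refine ⟨?_, ?_⟩
      · change (fun i h => (σ i h).δ ((σ'.stateAt x t).1 i h) (x t)) = _
        rw [ih.1]; rfl
      · change A.tr (σ'.stateAt x t).2.1 (x t) = _
        rw [ih.2]; rfl
  refine ((G.goal j).sat_toLTL A.label fun t => (π t).1).2 ?_
  refine hfu (fun t => (π t).1) (fun t => choice (σ'.stateAt x t).1)
    (fun t => (σ'.stateAt x t).2.2) hs (fun t => ?_) (fun t => ?_)
  · change A.tr (π t).1 (x t) = A.tr (π t).1 _
    congr 1
    funext i
    have hx : x t i = (combine σ σ' i).play x t := outcome_snd _ _ _ _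
    by_cases h : i = j
    · subst h
      rw [Function.update_self, hx, combine_self, ← (hstate t).2]
      rfl
    · rw [Function.update_of_ne h, hx, combine_of_ne _ _ h]
      simp only [choice, h, dite_false, (hstate t).1]
      rfl
  · change u (σ'.stateAt x t).2.1 _ = _
    rw [(hstate t).2]

/-- All members of the coalition run the same machine, which tracks the arena state and the memory
of the chooser's strategy, and each outputs its own component of the joint choice. Since they read
the same profiles, they stay synchronised. -/
theorem mem_Pun_of_notMem_winRegion {s : St} (hs : s ∉ G.winRegion j K) : s ∈ G.Pun j := by
  classical
  let A := G.arena
  obtain ⟨f, u, hfu⟩ := exists_chooser_strategy_of_notMem_fixZ (tr := A.turn j)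
    (θ := (G.goal j).guaranteeSet A.label) (ψ := (G.goal j).assumptionSet A.label) hK
  let σ : A.CoProfile j := fun i _ =>
    { Q := St × Fin ((G.goal j).assumptions.length + 1)
      finite_Q := inferInstance
      q0 := (s, 0)
      δ := fun q x => (A.tr q.1 x, u q.1 q.2)
      τ := fun q => (f q.1 q.2).1 i
      τ_mem := fun q => (f q.1 q.2).2 i }
  refine ⟨σ, fun σ' hsat => ?_⟩
  let π := outcome (combine σ σ') s
  let x : ℕ → N → Ac := fun t => (π t).2
  let mode : ℕ → Fin ((G.goal j).assumptions.length + 1) :=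
    fun t => Nat.rec 0 (fun t l => u (π t).1 l) t
  have hstate : ∀ i h t, (σ i h).stateAt x t = ((π t).1, mode t) := by
    intro i h t
    induction t with
    | zero => rfl
    | succ t ih =>
      change (σ i h).δ ((σ i h).stateAt x t) (x t) = _
      rw [ih]; rfl
  have hx : ∀ t i, x t i = (combine σ σ' i).play x t := fun t i => outcome_snd _ _ _ _
  have hxj : ∀ t, x t j ∈ A.act j := fun t => by
    rw [hx, combine_self]; exact σ'.play_mem _ _
  obtain ⟨h1, r, h2⟩ := hfu (fun t => (π t).1) (fun t => ⟨x t j, hxj t⟩) mode hs (fun t => by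
    change A.tr (π t).1 (x t) = A.tr (π t).1 _
    congr 1
    funext i
    by_cases h : i = j
    · subst h; rw [Function.update_self]
    · rw [Function.update_of_ne h, hx, combine_of_ne _ _ h]
      simp only [Strategy.play, hstate]
      rfl) (fun t => rfl)
  exact h2 (((G.goal j).sat_toLTL A.label fun t => (π t).1).1 hsat h1 r)

theorem Pun_eq_compl_winRegion [Finite N] : G.Pun j = (G.winRegion j K)ᶜ := by
  ext s
  exact ⟨fun h h' => G.notMem_Pun_of_mem_winRegion j hK h' h,
    fun h => G.mem_Pun_of_notMem_winRegion j hK h⟩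

end Game

/-! ### A structured language of commands with bounded loops -/

namespace Store

variable (σ : Store)

@[simp] theorem reg_setReg (d v r : ℕ) :
    (σ.setReg d v).reg r = if r = d then v else σ.reg r := by
  simp [setReg, Function.update_apply]

@[simp] theorem mem_setReg (d v : ℕ) : (σ.setReg d v).mem = σ.mem := rfl

@[simp] theorem reg_setMem (k x v : ℕ) : (σ.setMem k x v).reg = σ.reg := rfl

@[simp] theorem mem_setMem (k x v k' x' : ℕ) :
    (σ.setMem k x v).mem k' x' = if k' = k ∧ x' = x then v else σ.mem k' x' := by
  by_cases h : k' = k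
  · subst h; by_cases h' : x' = x <;> simp [setMem, h']
  · simp [setMem, h]

theorem mem_setMem_of_ne {k k' : ℕ} (h : k' ≠ k) (x v : ℕ) :
    (σ.setMem k x v).mem k' = σ.mem k' := by
  simp [setMem, h]

theorem ext' {σ τ : Store} (h1 : ∀ r, σ.reg r = τ.reg r) (h2 : σ.mem = τ.mem) : σ = τ := by
  cases σ; cases τ
  simp only at h1 h2
  rw [funext h1, h2]

end Store

/-! ### Expressions and commands, and their compilation. -/

inductive Expr : Type
  | reg (r : ℕ) : Expr
  | lit (c : ℕ) : Expr
  | add (e f : Expr) : Expr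
  | sub (e f : Expr) : Expr
  | load (k : ℕ) (e : Expr) : Expr
  | lt (e f : Expr) : Expr

namespace Expr

@[simp] def val (σ : Store) : Expr → ℕ
  | reg r => σ.reg r
  | lit c => c
  | add e f => e.val σ + f.val σ
  | sub e f => e.val σ - f.val σ
  | load k e => σ.mem k (e.val σ)
  | lt e f => if e.val σ < f.val σ then 1 else 0

/-- Registers from `100` on are reserved for intermediate results. -/
def ok : Expr → Bool
  | reg r => r < 100
  | lit _ => true
  | add e f => e.ok && f.ok
  | sub e f => e.ok && f.ok
  | load _ e => e.ok
  | lt e f => e.ok && f.ok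

/-- Code that puts the value of the expression into register `d`, using registers from `d` on. -/
def compile : Expr → ℕ → Program
  | reg r, d => .move d r
  | lit c, d => .const d c
  | add e f, d => .seq (e.compile d) (.seq (f.compile (d + 1)) (.add d d (d + 1)))
  | sub e f, d => .seq (e.compile d) (.seq (f.compile (d + 1)) (.sub d d (d + 1)))
  | load k e, d => .seq (e.compile d) (.load d k d)
  | lt e f, d => .seq (e.compile d) (.seq (f.compile (d + 1))
      (.ifLt d (d + 1) (.const d 1) (.const d 0)))

def cost : Expr → ℕ
  | reg _ => 1
  | lit _ => 1
  | add e f => e.cost + f.cost + 1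
  | sub e f => e.cost + f.cost + 1
  | load _ e => e.cost + 1
  | lt e f => e.cost + f.cost + 2

end Expr

/-- Two stores that agree up to the registers reserved for intermediate results. -/
def Store.Sim (σ σ' : Store) : Prop := (∀ r < 100, σ'.reg r = σ.reg r) ∧ σ'.mem = σ.mem

namespace Expr

theorem val_congr {e : Expr} (he : e.ok) {σ σ' : Store} (h : σ.Sim σ') :
    e.val σ' = e.val σ := by
  induction e with
  | reg r => exact h.1 r (by simpa [ok] using he)
  | lit c => rfl
  | add e f ihe ihf | sub e f ihe ihf | lt e f ihe ihf =>
    simp only [ok, Bool.and_eq_true] at he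
    simp [ihe he.1, ihf he.2]
  | load k e ih => simp [ih he, h.2]

/-- Stack discipline: the second operand is computed in registers from `d + 1` on and leaves the
first result in `d` alone. Since expressions read only registers below 100, intermediate results do
not disturb the value of the second operand. -/
theorem exec_compile {e : Expr} (he : e.ok) {d : ℕ} (hd : 100 ≤ d) (σ : Store) :
    ∃ σ', Exec (e.compile d) σ e.cost σ' ∧ σ'.mem = σ.mem ∧ (∀ r < d, σ'.reg r = σ.reg r) ∧
      σ'.reg d = e.val σ := by
  have binary : ∀ {e f : Expr} {d : ℕ} {σ : Store}, 100 ≤ d → f.ok →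
      (∃ σ', Exec (e.compile d) σ e.cost σ' ∧ σ'.mem = σ.mem ∧ (∀ r < d, σ'.reg r = σ.reg r) ∧
        σ'.reg d = e.val σ) →
      (∀ σ, ∃ σ', Exec (f.compile (d + 1)) σ f.cost σ' ∧ σ'.mem = σ.mem ∧
        (∀ r < d + 1, σ'.reg r = σ.reg r) ∧ σ'.reg (d + 1) = f.val σ) →
      ∃ σ₁ σ', Exec (e.compile d) σ e.cost σ₁ ∧ Exec (f.compile (d + 1)) σ₁ f.cost σ' ∧
        σ'.mem = σ.mem ∧ (∀ r < d, σ'.reg r = σ.reg r) ∧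
        σ'.reg d = e.val σ ∧ σ'.reg (d + 1) = f.val σ := by
    intro e f d σ hd hf h1 h2
    obtain ⟨σ₁, x1, m1, r1, v1⟩ := h1
    obtain ⟨σ₂, x2, m2, r2, v2⟩ := h2 σ₁
    refine ⟨σ₁, σ₂, x1, x2, m2.trans m1, fun r hr => (r2 r (by omega)).trans (r1 r hr),
      (r2 d (by omega)).trans v1, v2.trans ?_⟩
    exact val_congr hf ⟨fun r hr => r1 r (by omega), m1⟩
  induction e generalizing d σ with
  | reg r => exact ⟨_, .move _ _ _, rfl, fun r hr => by simp; omega, by simp⟩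
  | lit c => exact ⟨_, .const _ _ _, rfl, fun r hr => by simp; omega, by simp⟩
  | load k e ih =>
    obtain ⟨σ₁, x1, m1, r1, v1⟩ := ih he hd σ
    exact ⟨_, .seq x1 (.load _ _ _ _), m1, fun r hr => by
      rw [Store.reg_setReg, if_neg (by omega), r1 r hr], by simp [m1, v1]⟩
  | add e f ihe ihf =>
    simp only [ok, Bool.and_eq_true] at he
    obtain ⟨σ₁, σ₂, x1, x2, m, r, v1, v2⟩ :=
      binary hd he.2 (ihe he.1 hd σ) (ihf he.2 (d := d + 1) (by omega))
    have hx := Exec.seq x1 (.seq x2 (.add σ₂ d d (d + 1)))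
    rw [← add_assoc] at hx
    exact ⟨_, hx, m, fun s hs => by rw [Store.reg_setReg, if_neg (by omega), r s hs],
      by simp [v1, v2]⟩
  | sub e f ihe ihf =>
    simp only [ok, Bool.and_eq_true] at he
    obtain ⟨σ₁, σ₂, x1, x2, m, r, v1, v2⟩ :=
      binary hd he.2 (ihe he.1 hd σ) (ihf he.2 (d := d + 1) (by omega))
    have hx := Exec.seq x1 (.seq x2 (.sub σ₂ d d (d + 1)))
    rw [← add_assoc] at hx
    exact ⟨_, hx, m, fun s hs => by rw [Store.reg_setReg, if_neg (by omega), r s hs],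
      by simp [v1, v2]⟩
  | lt e f ihe ihf =>
    simp only [ok, Bool.and_eq_true] at he
    obtain ⟨σ₁, σ₂, x1, x2, m, r, v1, v2⟩ :=
      binary hd he.2 (ihe he.1 hd σ) (ihf he.2 (d := d + 1) (by omega))
    by_cases h : e.val σ < f.val σ
    · have hx := Exec.seq x1 (.seq x2 (.if_true (x := d) (y := d + 1) (P := .const d 1) (Q := .const d 0)
        (by rwa [v1, v2]) (.const σ₂ d 1)))
      rw [← add_assoc] at hx
      exact ⟨_, hx, m, fun s hs => by rw [Store.reg_setReg, if_neg (by omega), r s hs],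
        by simp [h]⟩
    · have hx := Exec.seq x1 (.seq x2 (.if_false (x := d) (y := d + 1) (P := .const d 1) (Q := .const d 0)
        (by rwa [v1, v2]) (.const σ₂ d 0)))
      rw [← add_assoc] at hx
      exact ⟨_, hx, m, fun s hs => by rw [Store.reg_setReg, if_neg (by omega), r s hs],
        by simp [h]⟩

end Expr

inductive Cmd : Type
  | skip : Cmd
  | assign (d : ℕ) (e : Expr) : Cmd
  | store (k : ℕ) (e f : Expr) : Cmd
  | seq (P Q : Cmd) : Cmd
  /-- `if e > 0 then P else Q` -/
  | ite (e : Expr) (P Q : Cmd) : Cmd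
  /-- `for R i := 0 to R n - 1 do P` -/
  | loop (i n : ℕ) (P : Cmd) : Cmd

namespace Cmd

-- The number of rounds of a loop is fixed on entry, whereas the compiled loop tests its bound again
-- in every round. The two agree when the body changes neither the counter nor the bound.
@[simp] def eval : Cmd → Store → Store
  | skip, σ => σ
  | assign d e, σ => σ.setReg d (e.val σ)
  | store k e f, σ => σ.setMem k (e.val σ) (f.val σ)
  | seq P Q, σ => Q.eval (P.eval σ)
  | ite e P Q, σ => if 0 < e.val σ then P.eval σ else Q.eval σ
  | loop i n P, σ => Nat.rec (σ.setReg i 0) (fun x τ => (P.eval τ).setReg i (x + 1)) (σ.reg n)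

/-- The registers that a command may change. -/
def wr : Cmd → List ℕ
  | skip => []
  | assign d _ => [d]
  | store _ _ _ => []
  | seq P Q => P.wr ++ Q.wr
  | ite _ P Q => P.wr ++ Q.wr
  | loop i _ P => i :: P.wr

/-- The arrays that a command may change. -/
def wm : Cmd → List ℕ
  | skip => []
  | assign _ _ => []
  | store k _ _ => [k]
  | seq P Q => P.wm ++ Q.wm
  | ite _ P Q => P.wm ++ Q.wm
  | loop _ _ P => P.wm

/-- The registers that bound the loops of a command. -/
def bounds : Cmd → List ℕ
  | skip => []
  | assign _ _ => []
  | store _ _ _ => []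
  | seq P Q => P.bounds ++ Q.bounds
  | ite _ P Q => P.bounds ++ Q.bounds
  | loop _ n P => n :: P.bounds

def ok : Cmd → Bool
  | skip => true
  | assign d e => d < 100 && e.ok
  | store _ e f => e.ok && f.ok
  | seq P Q => P.ok && Q.ok
  | ite e P Q => e.ok && P.ok && Q.ok
  | loop i n P => i < 100 && n < 100 && i ∉ P.wr && P.ok

def compile : Cmd → Program
  | skip => .skip
  | assign d e => .seq (e.compile 100) (.move d 100)
  | store k e f => .seq (e.compile 100) (.seq (f.compile 101) (.store k 100 101))
  | seq P Q => .seq P.compile Q.compile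
  | ite e P Q => .seq (e.compile 101) (.seq (.const 100 0) (.ifLt 100 101 P.compile Q.compile))
  | loop i n P => .seq (.const i 0)
      (.whileLt i n (.seq P.compile (.seq (.const 100 1) (.add i i 100))))

open Polynomial in
/-- A bound of the running time in terms of a bound of the numbers of rounds of the loops. -/
noncomputable def cost : Cmd → ℕ[X]
  | skip => 1
  | assign _ e => C (e.cost + 1)
  | store _ e f => C (e.cost + f.cost + 1)
  | seq P Q => P.cost + Q.cost
  | ite e P Q => C (e.cost + 2) + P.cost + Q.cost
  | loop _ _ P => X * (P.cost + 3) + 2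

theorem eval_reg_of_notMem {c : Cmd} {r : ℕ} (h : r ∉ c.wr) (σ : Store) :
    (c.eval σ).reg r = σ.reg r := by
  induction c generalizing σ with
  | skip => rfl
  | assign d e => simpa [wr] using fun h' => absurd h' (by simpa [wr] using h)
  | store k e f => rfl
  | seq P Q ihP ihQ =>
    simp only [wr, List.mem_append, not_or] at h
    rw [eval, ihQ h.2, ihP h.1]
  | ite e P Q ihP ihQ =>
    simp only [wr, List.mem_append, not_or] at h
    rw [eval]
    split_ifs
    · exact ihP h.1 σ
    · exact ihQ h.2 σ
  | loop i n P ih =>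
    simp only [wr, List.mem_cons, not_or] at h
    rw [eval]
    induction σ.reg n with
    | zero => simp [h.1]
    | succ x ihx => simp only [Store.reg_setReg, if_neg h.1, ih h.2]; exact ihx

theorem eval_mem_of_notMem {c : Cmd} {k : ℕ} (h : k ∉ c.wm) (σ : Store) :
    (c.eval σ).mem k = σ.mem k := by
  induction c generalizing σ with
  | skip => rfl
  | assign d e => rfl
  | store k' e f => exact Store.mem_setMem_of_ne _ (by simpa [wm] using h) _ _
  | seq P Q ihP ihQ =>
    simp only [wm, List.mem_append, not_or] at h
    rw [eval, ihQ h.2, ihP h.1]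
  | ite e P Q ihP ihQ =>
    simp only [wm, List.mem_append, not_or] at h
    rw [eval]
    split_ifs
    · exact ihP h.1 σ
    · exact ihQ h.2 σ
  | loop i n P ih =>
    simp only [wm] at h
    rw [eval]
    induction σ.reg n with
    | zero => rfl
    | succ x ihx => simp only [Store.mem_setReg, ih h]; exact ihx

/-- The invariant rule for loops. -/
theorem eval_loop {i n : ℕ} {P : Cmd} {σ : Store} (I : ℕ → Store → Prop)
    (h0 : I 0 (σ.setReg i 0))
    (hs : ∀ x < σ.reg n, ∀ τ : Store, (∀ r, r ∉ i :: P.wr → τ.reg r = σ.reg r) →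
      (∀ k, k ∉ P.wm → τ.mem k = σ.mem k) → τ.reg i = x → I x τ →
      I (x + 1) ((P.eval τ).setReg i (x + 1))) :
    I (σ.reg n) ((loop i n P).eval σ) := by
  have key : ∀ N ≤ σ.reg n, ∀ τ, τ = (Nat.rec (σ.setReg i 0)
      (fun x τ => (P.eval τ).setReg i (x + 1)) N : Store) →
      (∀ r, r ∉ i :: P.wr → τ.reg r = σ.reg r) ∧ (∀ k, k ∉ P.wm → τ.mem k = σ.mem k) ∧
      τ.reg i = N ∧ I N τ := by
    intro N
    induction N with
    | zero =>
      rintro - τ rfl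
      refine ⟨fun r hr => ?_, fun k _ => rfl, by simp, h0⟩
      simp only [List.mem_cons, not_or] at hr
      simp [hr.1]
    | succ N ih =>
      rintro hN τ rfl
      obtain ⟨h1, h2, h3, h4⟩ := ih (by omega) _ rfl
      refine ⟨fun r hr => ?_, fun k hk => ?_, by simp, hs N (by omega) _ h1 h2 h3 h4⟩
      · have hr' := hr
        simp only [List.mem_cons, not_or] at hr'
        rw [Store.reg_setReg, if_neg hr'.1, eval_reg_of_notMem hr'.2, h1 r hr]
      · rw [Store.mem_setReg, eval_mem_of_notMem hk, h2 k hk]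
  exact (key _ le_rfl _ rfl).2.2.2

/-- No bound of a loop is written anywhere in `c`, so all bounds keep their initial values
throughout, even in nested loops. This is why one number `B`, checked in the initial store only,
controls the total time. -/
theorem exec_compile {c : Cmd} (hok : c.ok) (hb : ∀ n ∈ c.bounds, n ∉ c.wr) {B : ℕ}
    {σ σ' : Store} (hB : ∀ n ∈ c.bounds, σ.reg n ≤ B) (hσ : σ.Sim σ') :
    ∃ t ρ, Exec c.compile σ' t ρ ∧ t ≤ c.cost.eval B ∧ (c.eval σ).Sim ρ := by
  induction c generalizing σ σ' with
  | skip => exact ⟨1, σ', .skip _, by simp [cost], hσ⟩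
  | assign d e =>
    simp only [ok, Bool.and_eq_true, decide_eq_true_eq] at hok
    obtain ⟨σ₁, x1, m1, r1, v1⟩ := Expr.exec_compile hok.2 (le_refl 100) σ'
    refine ⟨_, _, .seq x1 (.move _ _ _), by simp [cost], fun r hr => ?_, m1.trans hσ.2⟩
    simp only [Store.reg_setReg, v1, Expr.val_congr hok.2 hσ, eval, r1 r hr, hσ.1 r hr]
  | store k e f =>
    simp only [ok, Bool.and_eq_true] at hok
    obtain ⟨σ₁, x1, m1, r1, v1⟩ := Expr.exec_compile hok.1 (le_refl 100) σ'
    obtain ⟨σ₂, x2, m2, r2, v2⟩ := Expr.exec_compile hok.2 (show 100 ≤ 101 by omega) σ₁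
    have hσ₁ : σ.Sim σ₁ := ⟨fun r hr => (r1 r hr).trans (hσ.1 r hr), m1.trans hσ.2⟩
    refine ⟨_, _, .seq x1 (.seq x2 (.store _ _ _ _)), by simp [cost]; omega, fun r hr => ?_, ?_⟩
    · exact (r2 r (by omega)).trans (hσ₁.1 r hr)
    · rw [r2 100 (by omega), v1, v2, Expr.val_congr hok.1 hσ, Expr.val_congr hok.2 hσ₁]
      simp only [Store.setMem, eval, m2, hσ₁.2]
  | seq P Q ihP ihQ =>
    simp only [ok, Bool.and_eq_true] at hok
    simp only [bounds, wr, List.mem_append, not_or] at hb hB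
    obtain ⟨t1, ρ1, x1, c1, s1⟩ := ihP hok.1 (fun n hn => (hb n (.inl hn)).1)
      (fun n hn => hB n (.inl hn)) hσ
    obtain ⟨t2, ρ2, x2, c2, s2⟩ := ihQ hok.2 (fun n hn => (hb n (.inr hn)).2)
      (fun n hn => by rw [eval_reg_of_notMem (hb n (.inr hn)).1]; exact hB n (.inr hn)) s1
    exact ⟨_, _, .seq x1 x2, by simp only [cost, Polynomial.eval_add]; omega, s2⟩
  | ite e P Q ihP ihQ =>
    simp only [ok, Bool.and_eq_true] at hok
    simp only [bounds, wr, List.mem_append, not_or] at hb hB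
    obtain ⟨σ₁, x1, m1, r1, v1⟩ := Expr.exec_compile hok.1.1 (show 100 ≤ 101 by omega) σ'
    rw [Expr.val_congr hok.1.1 hσ] at v1
    have hσ₁ : σ.Sim (σ₁.setReg 100 0) := ⟨fun r hr => by
      rw [Store.reg_setReg, if_neg (by omega), r1 r (by omega), hσ.1 r hr], m1.trans hσ.2⟩
    by_cases h : 0 < e.val σ
    · obtain ⟨t2, ρ2, x2, c2, s2⟩ := ihP hok.1.2 (fun n hn => (hb n (.inl hn)).1)
        (fun n hn => hB n (.inl hn)) hσ₁
      refine ⟨_, _, .seq x1 (.seq (.const _ _ _) (.if_true (by simpa [v1] using h) x2)), ?_, ?_⟩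
      · simp only [cost, Polynomial.eval_add, Polynomial.eval_C]; omega
      · rwa [eval, if_pos h]
    · obtain ⟨t2, ρ2, x2, c2, s2⟩ := ihQ hok.2 (fun n hn => (hb n (.inr hn)).2)
        (fun n hn => hB n (.inr hn)) hσ₁
      refine ⟨_, _, .seq x1 (.seq (.const _ _ _) (.if_false (by simpa [v1] using h) x2)), ?_, ?_⟩
      · simp only [cost, Polynomial.eval_add, Polynomial.eval_C]; omega
      · rwa [eval, if_neg h]
  | loop i n P ih =>
    simp only [ok, Bool.and_eq_true, decide_eq_true_eq] at hok
    obtain ⟨⟨⟨hi, hn⟩, hiP⟩, hP⟩ := hok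
    simp only [bounds, wr, List.mem_cons, not_or] at hb hB
    let st : ℕ → Store := fun N =>
      Nat.rec (σ.setReg i 0) (fun x τ => (P.eval τ).setReg i (x + 1)) N
    have hst : ∀ N, (∀ r, r ∉ i :: P.wr → (st N).reg r = σ.reg r) ∧ (st N).reg i = N := by
      intro N
      induction N with
      | zero => exact ⟨fun r hr => by simp_all [st], by simp [st]⟩
      | succ N ihN =>
        refine ⟨fun r hr => ?_, by simp [st]⟩
        have hr' := hr
        simp only [List.mem_cons, not_or] at hr'
        change ((P.eval (st N)).setReg i (N + 1)).reg r = _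
        rw [Store.reg_setReg, if_neg hr'.1, eval_reg_of_notMem hr'.2, ihN.1 r hr]
    have hbd : ∀ n' ∈ n :: P.bounds, ∀ N, (st N).reg n' = σ.reg n' := fun n' hn' N =>
      (hst N).1 n' (by simpa [not_or] using hb n' (by simpa using hn'))
    -- `d` is the number of remaining rounds. Besides the body, a round pays 3 steps for the test
    -- and the increment; the final 1 is the failing test.
    have hwhile : ∀ d N ρ, N + d = σ.reg n → (st N).Sim ρ →
        ∃ t ρ', Exec (.whileLt i n (.seq P.compile (.seq (.const 100 1) (.add i i 100)))) ρ t ρ' ∧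
          t ≤ d * (P.cost.eval B + 3) + 1 ∧ (st (σ.reg n)).Sim ρ' := by
      intro d
      induction d with
      | zero =>
        intro N ρ hN hρ
        refine ⟨1, ρ, .while_false ?_, by omega, by rwa [← hN]⟩
        rw [hρ.1 i hi, hρ.1 n hn, (hst N).2, hbd n (by simp)]
        omega
      | succ d ihd =>
        intro N ρ hN hρ
        obtain ⟨t1, ρ1, x1, c1, s1⟩ := ih (σ := st N) hP (fun n' hn' => (hb n' (.inr hn')).2)
          (fun n' hn' => by rw [hbd n' (by simp [hn'])]; exact hB n' (.inr hn')) hρ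
        have s2 : (st (N + 1)).Sim ((ρ1.setReg 100 1).setReg i
            ((ρ1.setReg 100 1).reg i + (ρ1.setReg 100 1).reg 100)) := by
          refine ⟨fun r hr => ?_, s1.2⟩
          change _ = ((P.eval (st N)).setReg i (N + 1)).reg r
          have : ρ1.reg i = N := by
            rw [s1.1 i hi, eval_reg_of_notMem hiP, (hst N).2]
          simp only [Store.reg_setReg]
          rw [if_neg (by omega : ¬ i = 100), if_neg (by omega : ¬ r = 100), this, s1.1 r hr]
          simp
        obtain ⟨t2, ρ2, x2, c2, s3⟩ := ihd (N + 1) _ (by omega) s2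
        refine ⟨_, _, .while_true ?_ (.seq x1 (.seq (.const _ _ _) (.add _ _ _ _))) x2, ?_, s3⟩
        · rw [hρ.1 i hi, hρ.1 n hn, (hst N).2, hbd n (by simp)]
          omega
        · rw [add_mul]; omega
    obtain ⟨t, ρ', x, ct, s⟩ := hwhile (σ.reg n) 0 (σ'.setReg i 0) (by omega)
      ⟨fun r hr => by simp [st, hσ.1 r hr], hσ.2⟩
    refine ⟨_, _, .seq (.const _ _ _) x, ?_, s⟩
    have := Nat.mul_le_mul_right (P.cost.eval B + 3) (hB n (.inl rfl))
    simp only [cost, Polynomial.eval_add, Polynomial.eval_mul, Polynomial.eval_X,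
      Polynomial.eval_ofNat]
    omega

/-- `R d := R x * R y`, where `R x ≤ R n`; register `i` is used as a counter. -/
def mul (d i x y n : ℕ) : Cmd :=
  seq (assign d (.lit 0))
    (loop i n (ite (.lt (.reg i) (.reg x)) (assign d (.add (.reg d) (.reg y))) skip))

/-- After `N` rounds the product register holds `min N (R x) * R y`. Counting up to `R n` instead of
`R x` allows `R x` to be a working register, since loop bounds must never be written. -/
theorem eval_mul {d i x y n : ℕ} (h1 : d ≠ i) (h2 : d ≠ x) (h3 : d ≠ y) (h4 : d ≠ n) (h5 : i ≠ x)
    (h6 : i ≠ y) {σ : Store} (h : σ.reg x ≤ σ.reg n) :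
    (mul d i x y n).eval σ = (σ.setReg d (σ.reg x * σ.reg y)).setReg i (σ.reg n) := by
  have key : ∀ N, (Nat.rec ((σ.setReg d 0).setReg i 0) (fun N τ =>
      ((ite (.lt (.reg i) (.reg x)) (assign d (.add (.reg d) (.reg y))) skip).eval τ).setReg i
        (N + 1)) N : Store) =
      (σ.setReg d (min N (σ.reg x) * σ.reg y)).setReg i N := by
    intro N
    induction N with
    | zero => simp
    | succ N ih =>
      simp only [ih]
      by_cases hN : N < σ.reg x
      · refine Store.ext' (fun r => ?_) (by simp [hN, h5.symm, h2.symm])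
        have e1 : min N (σ.reg x) = N := by omega
        have e2 : min (N + 1) (σ.reg x) = N + 1 := by omega
        simp only [eval, Expr.val, Store.reg_setReg, e1, e2]
        simp only [if_neg h5.symm, if_neg h2.symm, hN, if_neg h6.symm, if_neg h3.symm, if_neg h1,
          if_true, Nat.one_pos, Store.reg_setReg, add_mul, one_mul]
        split_ifs <;> rfl
      · have e1 : min N (σ.reg x) = σ.reg x := by omega
        have e2 : min (N + 1) (σ.reg x) = σ.reg x := by omega
        refine Store.ext' (fun r => ?_) (by simp [hN, h5.symm, h2.symm])
        simp only [eval, Expr.val, Store.reg_setReg, e1, e2]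
        simp only [if_neg h5.symm, if_neg h2.symm, hN, if_true, if_false, lt_irrefl,
          Store.reg_setReg]
        split_ifs <;> rfl
  have := key (σ.reg n)
  rw [min_eq_right h] at this
  rw [← this]
  simp [mul, h4.symm]

end Cmd

/-! ### Reading the input tables -/

open Classical in
noncomputable def ind (p : Prop) : ℕ := if p then 1 else 0

@[simp] theorem ind_pos {p : Prop} : 0 < ind p ↔ p := by
  by_cases h : p <;> simp [ind, h]

theorem ind_of {p : Prop} (h : p) : ind p = 1 := by simp [ind, h]

theorem ind_of_not {p : Prop} (h : ¬ p) : ind p = 0 := by simp [ind, h]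

theorem one_sub_ind (p : Prop) : 1 - ind p = ind ¬p := by
  by_cases h : p <;> simp [ind, h]

theorem ind_congr {p q : Prop} (h : p ↔ q) : ind p = ind q := by rw [propext h]

theorem getD_flatten_ofFn {n : ℕ} (f : Fin n → List ℕ) (j : Fin n) {x : ℕ}
    (hx : x < (f j).length) :
    (List.ofFn f).flatten.getD (∑ i ∈ Finset.Iio j, (f i).length + x) 0 = (f j).getD x 0 := by
  have hsum : ∀ {n : ℕ} (g : Fin n → ℕ) (j : Fin n),
      ∑ i ∈ Finset.Iio j, g i = ∑ i, if i < j then g i else 0 := by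
    intro n g j
    rw [← Finset.sum_filter]
    congr 1
    ext
    simp
  rw [hsum]
  induction n with
  | zero => exact j.elim0
  | succ n ih =>
    rw [List.ofFn_succ, List.flatten_cons, Fin.sum_univ_succ]
    refine Fin.cases (fun hx => ?_) (fun j hx => ?_) j hx
    · simp only [Fin.not_lt_zero, if_false, Finset.sum_const_zero, zero_add]
      rw [List.getD_append _ _ _ _ hx]
    · rw [if_pos (Fin.succ_pos j), add_assoc, List.getD_append_right _ _ _ _ (by omega),
        Nat.add_sub_cancel_left]
      simpa using ih (fun i => f i.succ) j hx

/-! ### The layout of the code of a goal. -/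

section Goals

variable {a : ℕ}

/-- The segment of the code of a goal that describes the formula `f`. -/
def BoolForm.entry (f : BoolForm (Fin a)) : List ℕ := f.code.length :: f.code

/-- The position of the formula number `x` behind the two counters of the code of a goal. -/
def entryPos (fs : List (BoolForm (Fin a))) (x : ℕ) : ℕ :=
  ((fs.take x).flatMap BoolForm.entry).length

theorem entryPos_succ {fs : List (BoolForm (Fin a))} {x : ℕ} (hx : x < fs.length) :
    entryPos fs (x + 1) = entryPos fs x + 1 + fs[x].code.length := by
  rw [entryPos, entryPos, List.take_succ_eq_append_getElem hx, List.flatMap_append,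
    List.length_append]
  simp [BoolForm.entry]
  omega

theorem getD_flatMap_entry {fs : List (BoolForm (Fin a))} {x y : ℕ} (hx : x < fs.length)
    (hy : y < fs[x].entry.length) :
    (fs.flatMap BoolForm.entry).getD (entryPos fs x + y) 0 = fs[x].entry.getD y 0 ∧
      entryPos fs x + y < (fs.flatMap BoolForm.entry).length := by
  have h : fs.flatMap BoolForm.entry = (fs.take x).flatMap BoolForm.entry ++
      (fs[x].entry ++ (fs.drop (x + 1)).flatMap BoolForm.entry) := by
    rw [← List.flatMap_cons, ← List.drop_eq_getElem_cons hx, ← List.flatMap_append,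
      List.take_append_drop]
  constructor
  · rw [h, entryPos, List.getD_append_right _ _ _ _ (by omega), Nat.add_sub_cancel_left,
      List.getD_append _ _ _ _ hy]
  · rw [h, entryPos]
    simp only [List.length_append]
    omega

def GR1.formulas {AP : Type} (γ : GR1 AP) : List (BoolForm AP) := γ.assumptions ++ γ.guarantees

theorem GR1.code_eq (γ : GR1 (Fin a)) :
    γ.code = γ.assumptions.length :: γ.guarantees.length ::
      γ.formulas.flatMap BoolForm.entry := rfl

theorem BoolForm.length_code (f : BoolForm (Fin a)) : f.code.length = f.toLTL.size := by
  induction f with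
  | top => rfl
  | atom p => rfl
  | neg f ih => simp [code, toLTL, LTL.size, ih]
  | or f g ihf ihg => simp [code, toLTL, LTL.size, ihf, ihg]; omega

/-- Each conjunct of the goal contributes the symbols of its Boolean formula and those of its
temporal operators. This bounds in terms of the size of the goal all registers that depend on it and
limit loops. -/
theorem GR1.sum_length_code_add_length_le (γ : GR1 (Fin a)) :
    (γ.formulas.map fun f => f.code.length).sum + γ.formulas.length ≤ γ.size := by
  have h : ∀ l : List (BoolForm (Fin a)), (l.map fun f => f.code.length).sum + l.length ≤
      (LTL.conj (l.map fun f => f.toLTL.eventually.always)).size := by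
    intro l
    induction l with
    | nil => simp
    | cons f l ih =>
      simp only [LTL.conj, List.map_cons, List.foldr_cons, List.sum_cons, List.length_cons] at ih ⊢
      simp only [LTL.and, LTL.always, LTL.eventually, LTL.size, BoolForm.length_code] at ih ⊢
      omega
  have h1 := h γ.assumptions
  have h2 := h γ.guarantees
  simp only [GR1.size, GR1.toLTL, LTL.imp, LTL.size, GR1.formulas, List.map_append,
    List.sum_append, List.length_append]
  omega

end Goals

/-! ### Entries of the input arrays. -/

section Tables

variable {n k m a : ℕ} (G : Game (Fin n) (Fin k) (Fin m) (Fin a)) (j : Fin n)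

/-- The position of the code of the goal of player `j` in the list of goals. -/
def Game.goalPos : ℕ := n + ∑ i ∈ Finset.Iio j, (G.goal i).code.length

theorem goalList_getD_self : G.goalList.getD j 0 = G.goalPos j := by
  rw [Game.goalList, List.getD_append _ _ _ _ (by simp), List.getD_eq_getElem _ _ (by simp)]
  simp [Game.goalPos]

theorem goalList_getD_goalPos {x : ℕ} (hx : x < (G.goal j).code.length) :
    G.goalList.getD (G.goalPos j + x) 0 = (G.goal j).code.getD x 0 := by
  rw [Game.goalList, Game.goalPos, List.getD_append_right _ _ _ _ (by simp; omega)]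
  rw [← getD_flatten_ofFn (fun i => (G.goal i).code) j hx]
  congr 1
  simp only [List.length_ofFn]
  omega

theorem goalList_getD_formula {x y : ℕ} (hx : x < (G.goal j).formulas.length)
    (hy : y < (G.goal j).formulas[x].entry.length) :
    G.goalList.getD (G.goalPos j + 2 + (entryPos (G.goal j).formulas x + y)) 0 =
      (G.goal j).formulas[x].entry.getD y 0 := by
  obtain ⟨h1, h2⟩ := getD_flatMap_entry hx hy
  rw [add_assoc, goalList_getD_goalPos, GR1.code_eq, Nat.add_comm 2]
  · exact h1
  · rw [GR1.code_eq]
    simp only [List.length_cons]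
    omega

variable {r s : ℕ}

theorem table_finProd (f : Fin r → Fin s → ℕ) (x : Fin r) (y : Fin s) :
    table (fun z : Fin (r * s) => f (finProdFinEquiv.symm z).1 (finProdFinEquiv.symm z).2)
      (x * s + y) = f x y := by
  have h : (x : ℕ) * s + y = (finProdFinEquiv (x, y) : Fin (r * s)) := by
    simp [finProdFinEquiv, mul_comm, add_comm]
  rw [h, table, dif_pos (Fin.is_lt _)]
  simp only [Fin.eta, Equiv.symm_apply_apply]

theorem actTable_apply (A : Arena (Fin n) (Fin k) (Fin m) (Fin a)) (i : Fin n) (c : Fin k) :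
    A.actTable (i * k + c) = ind (c ∈ A.act i) :=
  table_finProd (fun i c => ind (c ∈ A.act i)) i c

theorem trTable_apply (A : Arena (Fin n) (Fin k) (Fin m) (Fin a)) (s : Fin m)
    (x : Fin (k ^ n)) :
    A.trTable (s * k ^ n + x) = A.tr s (finFunctionFinEquiv.symm x) :=
  table_finProd (fun s x => (A.tr s (finFunctionFinEquiv.symm x) : ℕ)) s x

theorem labelTable_apply (A : Arena (Fin n) (Fin k) (Fin m) (Fin a)) (s : Fin m) (p : Fin a) :
    A.labelTable (s * a + p) = ind (p ∈ A.label s) :=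
  table_finProd (fun s p => ind (p ∈ A.label s)) s p

/-- Cells outside the table hold 0, so every cell, in range or not, is a truth value. The evaluator
can thus be analysed without knowing that the symbols it reads are valid propositions. -/
theorem labelTable_eq_ind (A : Arena (Fin n) (Fin k) (Fin m) (Fin a)) (x : ℕ) :
    A.labelTable x = ind (0 < A.labelTable x) := by
  unfold Arena.labelTable table
  split_ifs
  · exact (ind_congr ind_pos).symm
  · simp [ind]

end Tables

/-! ### Evaluation of postfix notation with a stack -/

/-- The effect of one symbol on a stack of truth values, where `v p` is the truth value of the
proposition number `p`. -/
def stackStep (v : ℕ → Prop) : List Prop → ℕ → List Prop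
  | st, 0 => True :: st
  | [], 1 => []
  | p :: st, 1 => (¬ p) :: st
  | [], 2 => []
  | [_], 2 => []
  | p :: q :: st, 2 => (q ∨ p) :: st
  | st, y + 3 => v y :: st

/-- The statement is for an arbitrary initial stack because an operand of `∨` is evaluated on top of
earlier results. -/
theorem foldl_stackStep_code {a : ℕ} {v : ℕ → Prop} {V : Set (Fin a)}
    (hv : ∀ p : Fin a, v p ↔ p ∈ V) (f : BoolForm (Fin a)) (st : List Prop) :
    f.code.foldl (stackStep v) st = f.Holds V :: st := by
  induction f generalizing st with
  | top => simp [BoolForm.code, stackStep, BoolForm.Holds]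
  | atom p => simp [BoolForm.code, stackStep, BoolForm.Holds, hv p]
  | neg f ih => simp [BoolForm.code, stackStep, BoolForm.Holds, ih]
  | or f g ihf ihg => simp [BoolForm.code, stackStep, BoolForm.Holds, ihf, ihg]

/-- The array `M` holds the stack `st`, whose top is the last cell in use. -/
def StackRep (M : ℕ → ℕ) : List Prop → Prop
  | [] => True
  | p :: st => M st.length = ind p ∧ StackRep M st

theorem StackRep.congr {M M' : ℕ → ℕ} {st : List Prop} (h : StackRep M st)
    (hM : ∀ x < st.length, M' x = M x) : StackRep M' st := by
  induction st with
  | nil => trivial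
  | cons p st ih =>
    exact ⟨(hM _ (by simp)).trans h.1, ih h.2 fun x hx => hM x (by simp; omega)⟩

/-! ### The program -/

namespace Cmd

open GRGame.Expr

infixr:67 " ;; " => Cmd.seq

/-- `(R q, R x) := (R x / R y, R x % R y)`, where the quotient is at most `R n`. -/
def divMod (q i x y n : ℕ) : Cmd :=
  assign q (lit 0) ;; loop i n (ite (lt (reg x) (reg y)) skip
    (assign x (sub (reg x) (reg y)) ;; assign q (add (reg q) (lit 1))))

/-- Repeated subtraction preserves both the quotient still due plus `R q` and the remainder. After
`t` rounds either all of them subtracted or `R x` is already below `R y`; as `R n` is at least the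
quotient, the latter holds at the end. -/
theorem eval_divMod {q i x y n : ℕ} (h1 : q ≠ i) (h2 : q ≠ x) (h3 : q ≠ y) (h4 : q ≠ n)
    (h5 : i ≠ x) (h6 : i ≠ y) (h7 : x ≠ y) {σ : Store} (hy : 0 < σ.reg y)
    (h : σ.reg x / σ.reg y ≤ σ.reg n) :
    ((divMod q i x y n).eval σ).reg q = σ.reg x / σ.reg y ∧
      ((divMod q i x y n).eval σ).reg x = σ.reg x % σ.reg y := by
  let τ := (assign q (lit 0)).eval σ
  have key := eval_loop (i := i) (n := n) (P := ite (lt (reg x) (reg y)) skip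
    (assign x (sub (reg x) (reg y)) ;; assign q (add (reg q) (lit 1)))) (σ := τ)
    (fun t τ' => τ'.reg q + τ'.reg x / σ.reg y = σ.reg x / σ.reg y ∧
      τ'.reg x % σ.reg y = σ.reg x % σ.reg y ∧
      (τ'.reg q = t ∨ τ'.reg x < σ.reg y)) (by simp [τ, h1, h2.symm, h5.symm]) (by
      intro t _ τ' hr _ hi ⟨e1, e2, e3⟩
      have hy' : τ'.reg y = σ.reg y := by
        rw [hr y (by simp [wr, h3.symm, h6.symm, h7.symm])]; simp [τ, h3.symm]
      by_cases hlt : τ'.reg x < σ.reg y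
      · simp [hlt, hy', h1, h5.symm, e1, e2]
      · have hle := not_lt.1 hlt
        simp only [eval, val, hy', hlt, if_false, lt_irrefl, Store.reg_setReg, if_true, if_neg h1,
          if_neg h2, if_neg h2.symm, if_neg h5.symm]
        refine ⟨?_, ?_, ?_⟩
        · rw [← e1, Nat.div_eq_sub_div hy hle (a := τ'.reg x)]; omega
        · rw [← e2, Nat.mod_eq_sub_mod hle]
        · left; have := e3.resolve_right hlt; omega)
  change ((divMod q i x y n).eval σ).reg q + ((divMod q i x y n).eval σ).reg x / _ = _ ∧
    ((divMod q i x y n).eval σ).reg x % _ = _ ∧ (((divMod q i x y n).eval σ).reg q = _ ∨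
      ((divMod q i x y n).eval σ).reg x < _) at key
  obtain ⟨e1, e2, e3⟩ := key
  have hn : τ.reg n = σ.reg n := by simp [τ, h4.symm]
  have hlt : ((divMod q i x y n).eval σ).reg x < σ.reg y := by
    rcases e3 with e3 | e3
    · by_contra hle
      have := Nat.div_pos (not_lt.1 hle) hy
      omega
    · exact e3
  constructor
  · rw [← e1, Nat.div_eq_of_lt (b := σ.reg y) hlt, add_zero]
  · rw [← e2]; exact (Nat.mod_eq_of_lt hlt).symm

/-- Reads the numbers of assumptions and guarantees and computes the number of action
profiles. -/
def readHeader : Cmd :=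
  assign 12 (load 3 (reg 4)) ;;
  assign 8 (add (load 3 (reg 12)) (lit 1)) ;;
  assign 9 (add (load 3 (add (reg 12) (lit 1))) (lit 1)) ;;
  assign 10 (sub (add (reg 8) (reg 9)) (lit 2)) ;;
  assign 13 (add (reg 8) (reg 9)) ;;
  assign 12 (add (reg 12) (lit 2)) ;;
  assign 7 (lit 1) ;;
  loop 20 0 (mul 21 22 1 7 1 ;; assign 7 (reg 21))

/-- Adds up the lengths of the formulas of the goal. -/
def readLength : Cmd :=
  assign 11 (lit 0) ;;
  assign 23 (reg 12) ;;
  loop 20 10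
    (assign 11 (add (reg 11) (load 3 (reg 23))) ;;
     assign 23 (add (add (reg 23) (load 3 (reg 23))) (lit 1)))

/-- Applies one symbol to the stack. -/
def stackSymbol : Cmd :=
  ite (lt (reg 28) (lit 1))
    (store 6 (reg 25) (lit 1) ;; assign 25 (add (reg 25) (lit 1)))
  (ite (lt (reg 28) (lit 2))
    (store 6 (sub (reg 25) (lit 1)) (sub (lit 1) (load 6 (sub (reg 25) (lit 1)))))
  (ite (lt (reg 28) (lit 3))
    (assign 25 (sub (reg 25) (lit 1)) ;;
     store 6 (sub (reg 25) (lit 1))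
       (lt (lit 0) (add (load 6 (sub (reg 25) (lit 1))) (load 6 (reg 25)))))
    (store 6 (reg 25) (load 2 (add (reg 26) (sub (reg 28) (lit 3)))) ;;
     assign 25 (add (reg 25) (lit 1)))))

/-- Evaluates the formula whose code begins at position `R 23` and has length `R 24` in the
state `R 21`. -/
def evalFormula : Cmd :=
  assign 25 (lit 0) ;;
  mul 26 27 21 3 2 ;;
  loop 22 11
    (ite (lt (reg 22) (reg 24))
      (assign 28 (load 3 (add (reg 23) (reg 22))) ;; stackSymbol) skip)

/-- Computes the row number `R 30` of the table of negated truth values. -/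
def truthRow : Cmd :=
  loop 21 2
    (evalFormula ;;
     mul 29 27 30 2 13 ;;
     store 5 (add (reg 29) (reg 21)) (sub (lit 1) (load 6 (lit 0))))

/-- Formula number `x` goes to row `x + 1`, and row 0 stands for `⊤`. Because truth values are
stored negated, the initial zeros of the array already describe `⊤`, both in row 0 and behind the
last formula. -/
def truthTable : Cmd :=
  assign 23 (reg 12) ;;
  loop 20 10
    (assign 24 (load 3 (reg 23)) ;;
     assign 23 (add (reg 23) (lit 1)) ;;
     assign 30 (add (reg 20) (lit 1)) ;;
     truthRow ;;
     assign 23 (add (reg 23) (reg 24)))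

/-- Determines which action profiles are legal, and which differ only in the action of
player `j`. -/
def profileTables : Cmd :=
  loop 20 7
    (assign 21 (reg 20) ;;
     assign 23 (lit 1) ;;
     assign 24 (lit 1) ;;
     assign 25 (lit 0) ;;
     loop 22 0
       (divMod 26 27 21 1 7 ;;
        mul 28 29 22 1 0 ;;
        ite (load 0 (add (reg 28) (reg 21))) skip (assign 24 (lit 0)) ;;
        mul 28 29 21 23 1 ;;
        ite (add (lt (reg 22) (reg 4)) (lt (reg 4) (reg 22)))
          (assign 25 (add (reg 25) (reg 28))) skip ;;
        mul 28 29 1 23 1 ;;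
        assign 23 (reg 28) ;;
        assign 21 (reg 26)) ;;
     store 7 (reg 20) (reg 24) ;;
     store 8 (reg 20) (reg 25))

/-- `M d [s] := e` for all states `s`. -/
def map (d : ℕ) (e : Expr) : Cmd := loop 20 2 (store d (reg 20) e)

def clearMarks : Cmd := loop 23 7 (store 9 (reg 23) (lit 0))

/-- Marks the choices of the other players against which player `j` can move into the set in
array `src`. -/
def markGroups (src : ℕ) : Cmd :=
  loop 23 7 (ite (load 7 (reg 23))
    (ite (load src (load 1 (add (reg 21) (reg 23)))) (store 9 (load 8 (reg 23)) (lit 1)) skip)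
    skip)

/-- Second half of the alternation in `cpre`: marking deals with "some answer of `j`", and this pass
with "every legal choice of the others". Both passes are linear in the number of profiles. -/
def checkGroups : Cmd :=
  assign 24 (lit 1) ;;
  loop 23 7 (ite (load 7 (reg 23))
    (ite (load 9 (load 8 (reg 23))) skip (assign 24 (lit 0))) skip)

/-- Computes the controllable predecessors of the set in array `src`. -/
def pre (dst src : ℕ) : Cmd :=
  loop 20 2
    (mul 21 22 20 7 2 ;; clearMarks ;; markGroups src ;; checkGroups ;;
     store dst (reg 20) (reg 24))

/-- One round of the innermost fixed point, for the guarantee `R 40` and the assumption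
`R 41`. -/
def roundX : Cmd :=
  pre 10 13 ;; pre 11 14 ;; pre 12 15 ;;
  mul 21 22 41 2 8 ;;
  assign 23 (add (reg 8) (reg 40)) ;;
  mul 24 22 23 2 13 ;;
  map 15 (lt (lit 0) (add
    (add (lt (load 5 (add (reg 24) (reg 20))) (load 10 (reg 20))) (load 11 (reg 20)))
    (lt (lit 1) (add (load 5 (add (reg 21) (reg 20))) (load 12 (reg 20))))))

/-- Arrays `13`, `14`, `15` hold the approximations of Z, Y, X. Register `2`, the number of states,
is a sufficient number of rounds. -/
def iterX : Cmd := map 15 (lit 1) ;; loop 44 2 roundX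

/-- The union over the assumptions is collected in array `16`, since Y in array `14` must stay
unchanged until the round is over. Array `17` plays the same role for Z. -/
def roundY : Cmd :=
  map 16 (lit 0) ;;
  loop 41 8 (iterX ;; map 16 (lt (lit 0) (add (load 15 (reg 20)) (load 16 (reg 20))))) ;;
  map 14 (load 16 (reg 20))

def iterY : Cmd := map 14 (lit 0) ;; loop 43 2 roundY

def roundZ : Cmd :=
  map 17 (lit 1) ;;
  loop 40 9 (iterY ;; map 17 (lt (lit 1) (add (load 14 (reg 20)) (load 17 (reg 20))))) ;;
  map 13 (load 17 (reg 20))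

def iterZ : Cmd := map 13 (lit 1) ;; loop 42 2 roundZ

def solve : Cmd :=
  truthTable ;; profileTables ;; iterZ ;; map 4 (sub (lit 1) (load 13 (reg 20)))

end Cmd

/-! ### Correctness of the passes over states and action profiles. -/

namespace Cmd

open GRGame.Expr Set

variable {n k m a : ℕ}

/-- Array `d` holds the characteristic vector of `X`. -/
def Holds (σ : Store) (d : ℕ) (X : Set (Fin m)) : Prop := ∀ s : Fin m, σ.mem d s = ind (s ∈ X)

theorem Holds.congr {σ τ : Store} {d : ℕ} {X : Set (Fin m)} (h : Holds σ d X)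
    (hd : τ.mem d = σ.mem d) : Holds τ d X := fun s => by rw [hd, h s]

/-- While cell `s` is computed, that cell of array `d` still has its old content. Hence `e` may read
it, which the accumulation of unions and intersections requires. -/
theorem holds_map {d : ℕ} {e : Expr} {σ : Store} (X : Set (Fin m)) (hm : σ.reg 2 = m)
    (he : ∀ (s : Fin m) (τ : Store), (∀ r ≠ 20, τ.reg r = σ.reg r) →
      (∀ k ≠ d, τ.mem k = σ.mem k) → τ.mem d s = σ.mem d s → τ.reg 20 = s →
      e.val τ = ind (s ∈ X)) : Holds ((map d e).eval σ) d X := by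
  have key := eval_loop (i := 20) (n := 2) (P := store d (reg 20) e) (σ := σ)
    (fun x τ => ∀ s : Fin m, τ.mem d s = if (s : ℕ) < x then ind (s ∈ X) else σ.mem d s)
    (fun s => by simp) (by
      intro x hx τ hr hk hi h s
      rw [hm] at hx
      have hx' := he ⟨x, hx⟩ τ (fun r h20 => hr r (by simpa [wr] using h20))
        (fun k hd => hk k (by simpa [wm] using hd)) (by rw [h]; simp) hi
      simp only [eval, val, Store.mem_setReg, Store.mem_setMem, hi, true_and, h, hx']
      by_cases hs : (s : ℕ) = x
      · subst hs; simp
      · by_cases hs' : (s : ℕ) < x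
        · rw [if_neg hs, if_pos hs', if_pos (by omega)]
        · rw [if_neg hs, if_neg hs', if_neg (by omega)])
  intro s
  have := key s
  rwa [hm, if_pos s.2] at this

end Cmd

/-- The action profile with number `x`. -/
def profile {n k : ℕ} (x : Fin (k ^ n)) : Fin n → Fin k := finFunctionFinEquiv.symm x

namespace Cmd

open GRGame.Expr Set

variable {n k m a : ℕ} {G : Game (Fin n) (Fin k) (Fin m) (Fin a)} {j : Fin n}

def LegalNum (G : Game (Fin n) (Fin k) (Fin m) (Fin a)) (x : Fin (k ^ n)) : Prop :=
  ∀ i, profile x i ∈ G.arena.act i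

/-- An answer of `j` amounts to a legal profile that agrees with the given one at all other players.
The predecessor can therefore be computed from profile numbers alone, once it is known which of them
agree off `j`. -/
theorem mem_cpre_turn {s : Fin m} {X : Set (Fin m)} :
    s ∈ cpre (G.arena.turn j) X ↔ ∀ x, LegalNum G x → ∃ y, LegalNum G y ∧
      (∀ i, i ≠ j → profile y i = profile x i) ∧ G.arena.tr s (profile y) ∈ X := by
  constructor
  · intro h x hx
    obtain ⟨c, hc⟩ := h ⟨profile x, hx⟩
    refine ⟨finFunctionFinEquiv (Function.update (profile x) j c), fun i => ?_, fun i hi => ?_, ?_⟩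
    · by_cases hi : i = j
      · subst hi; simp [profile]
      · simpa [profile, hi] using hx i
    · simp [profile, hi]
    · simpa [profile, Arena.turn] using hc
  · rintro h ⟨b, hb⟩
    obtain ⟨y, hy, h1, h2⟩ := h (finFunctionFinEquiv b) (fun i => by simpa [profile] using hb i)
    refine ⟨⟨profile y j, hy j⟩, ?_⟩
    rw [Arena.turn]
    convert h2
    funext i
    by_cases hi : i = j
    · subst hi; simp
    · simpa [hi, profile] using (h1 i hi).symm

/-- The formula whose negated truth values are in row `x` of the table: the assumptions and the
guarantees, with `⊤` in front and at the end. -/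
def rowFormula (G : Game (Fin n) (Fin k) (Fin m) (Fin a)) (j : Fin n) (x : ℕ) :
    BoolForm (Fin a) :=
  (BoolForm.top :: (G.goal j).formulas).getD x .top

/-- The registers and arrays that the fixed point computation only reads have their intended
contents. -/
structure Ready (G : Game (Fin n) (Fin k) (Fin m) (Fin a)) (j : Fin n) (σ : Store) : Prop where
  states : σ.reg 2 = m
  profiles : σ.reg 7 = k ^ n
  assumptions : σ.reg 8 = (G.goal j).assumptions.length + 1
  guarantees : σ.reg 9 = (G.goal j).guarantees.length + 1
  rows : σ.reg 13 = (G.goal j).assumptions.length + (G.goal j).guarantees.length + 2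
  tr : ∀ (s : Fin m) (x : Fin (k ^ n)), σ.mem 1 (s * k ^ n + x) = G.arena.tr s (profile x)
  truth : ∀ (x : ℕ) (s : Fin m),
    σ.mem 5 (x * m + s) = ind ¬ (rowFormula G j x).Holds (G.arena.label s)
  legal : ∀ x : Fin (k ^ n), σ.mem 7 x = ind (LegalNum G x)
  group_lt : ∀ x : Fin (k ^ n), σ.mem 8 x < k ^ n
  group_eq : ∀ x y : Fin (k ^ n), σ.mem 8 x = σ.mem 8 y ↔
    ∀ i, i ≠ j → profile x i = profile y i

theorem Ready.congr {σ τ : Store} (h : Ready G j σ)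
    (hr : ∀ r ∈ [2, 7, 8, 9, 13], τ.reg r = σ.reg r) (hk : ∀ k ∈ [1, 5, 7, 8], τ.mem k = σ.mem k) :
    Ready G j τ := by
  simp only [List.mem_cons, List.not_mem_nil, or_false, forall_eq_or_imp, forall_eq] at hr hk
  obtain ⟨r2, r7, r8, r9, r13⟩ := hr
  obtain ⟨k1, k5, k7, k8⟩ := hk
  constructor
  · rw [r2, h.states]
  · rw [r7, h.profiles]
  · rw [r8, h.assumptions]
  · rw [r9, h.guarantees]
  · rw [r13, h.rows]
  · rw [k1]; exact h.tr
  · rw [k5]; exact h.truth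
  · rw [k7]; exact h.legal
  · rw [k8]; exact h.group_lt
  · rw [k8]; exact h.group_eq

theorem Ready.eval {σ : Store} (h : Ready G j σ) {c : Cmd} (hr : ∀ r ∈ [2, 7, 8, 9, 13], r ∉ c.wr)
    (hk : ∀ k ∈ [1, 5, 7, 8], k ∉ c.wm) : Ready G j (c.eval σ) :=
  h.congr (fun r h => eval_reg_of_notMem (hr r h) σ) fun k h => eval_mem_of_notMem (hk k h) σ

theorem clearMarks_mem {σ : Store} {y : ℕ} (hy : y < σ.reg 7) :
    (clearMarks.eval σ).mem 9 y = 0 := by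
  refine eval_loop (i := 23) (n := 7) (P := store 9 (reg 23) (lit 0)) (σ := σ)
    (fun x τ => ∀ y < x, τ.mem 9 y = 0) (fun y hy => absurd hy (Nat.not_lt_zero y)) ?_ y hy
  intro x hx τ hr hk hi h y hy
  simp only [eval, val, Store.mem_setReg, Store.mem_setMem, hi, true_and]
  split_ifs with hyx
  · rfl
  · exact h y (by omega)

theorem markGroups_mem {σ : Store} (hσ : Ready G j σ) {src : ℕ} (hsrc : src ≠ 9)
    {X : Set (Fin m)} (hX : Holds σ src X) {s : Fin m} (hs : σ.reg 21 = s * k ^ n)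
    (h0 : ∀ y < k ^ n, σ.mem 9 y = 0) {y : ℕ} (hy : y < k ^ n) :
    ((markGroups src).eval σ).mem 9 y = ind (∃ x : Fin (k ^ n), LegalNum G x ∧
      σ.mem 8 x = y ∧ G.arena.tr s (profile x) ∈ X) := by
  classical
  have key := eval_loop (i := 23) (n := 7) (P := ite (load 7 (reg 23))
    (ite (load src (load 1 (add (reg 21) (reg 23)))) (store 9 (load 8 (reg 23)) (lit 1)) skip)
    skip) (σ := σ)
    (fun N τ => ∀ y < k ^ n, τ.mem 9 y = ind (∃ x : Fin (k ^ n), (x : ℕ) < N ∧ LegalNum G x ∧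
      σ.mem 8 x = y ∧ G.arena.tr s (profile x) ∈ X))
    (fun y hy => by rw [ind_of_not (by simp)]; exact h0 y hy) (by
      intro N hN τ hr hk hi h y hy
      rw [hσ.profiles] at hN
      have hτ : Ready G j τ := hσ.congr (fun r h => hr r (by revert r; simp [wr]))
        fun q h => hk q (by revert q; simp [wm])
      have h21 : τ.reg 21 = s * k ^ n := (hr 21 (by simp [wr])).trans hs
      have e1 := hτ.tr s ⟨N, hN⟩
      have e2 := hτ.legal ⟨N, hN⟩
      have e3 := (hX.congr (hk src (by simpa [wm] using hsrc))) (G.arena.tr s (profile ⟨N, hN⟩))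
      have e4 : τ.mem 8 = σ.mem 8 := hk 8 (by simp [wm])
      simp only at e1 e2
      simp only [eval, val, hi, h21, e1, e2, e3, e4, ind_pos, Store.mem_setReg]
      have hsplit : (∃ x : Fin (k ^ n), (x : ℕ) < N + 1 ∧ LegalNum G x ∧
          σ.mem 8 x = y ∧ G.arena.tr s (profile x) ∈ X) ↔
          (∃ x : Fin (k ^ n), (x : ℕ) < N ∧ LegalNum G x ∧
            σ.mem 8 x = y ∧ G.arena.tr s (profile x) ∈ X) ∨
          (LegalNum G ⟨N, hN⟩ ∧ σ.mem 8 N = y ∧ G.arena.tr s (profile ⟨N, hN⟩) ∈ X) := by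
        constructor
        · rintro ⟨x, hx, h⟩
          rcases Nat.lt_succ_iff_lt_or_eq.1 hx with hx | hx
          · exact .inl ⟨x, hx, h⟩
          · obtain rfl : x = ⟨N, hN⟩ := Fin.ext hx
            exact .inr h
        · rintro (⟨x, hx, h⟩ | h)
          · exact ⟨x, by omega, h⟩
          · exact ⟨⟨N, hN⟩, Nat.lt_succ_self N, h⟩
      rw [ind_congr hsplit]
      split_ifs with h1 h2
      · rw [Store.mem_setMem]
        by_cases hy' : y = σ.mem 8 N
        · rw [if_pos ⟨rfl, hy'⟩, ind_of (.inr ⟨h1, hy'.symm, h2⟩)]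
        · rw [if_neg (fun h => hy' h.2), h y hy]
          exact ind_congr (or_iff_left fun h => hy' h.2.1.symm).symm
      · rw [h y hy]
        exact ind_congr (or_iff_left fun h => h2 h.2.2).symm
      · rw [h y hy]
        exact ind_congr (or_iff_left fun h => h1 h.1).symm)
  have := key y hy
  rw [hσ.profiles] at this
  refine this.trans (ind_congr ⟨fun ⟨x, _, h⟩ => ⟨x, h⟩, fun ⟨x, h⟩ => ⟨x, x.2, h⟩⟩)

theorem checkGroups_reg {σ : Store} (hσ : Ready G j σ) :
    (checkGroups.eval σ).reg 24 =
      ind (∀ x : Fin (k ^ n), LegalNum G x → 0 < σ.mem 9 (σ.mem 8 x)) := by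
  classical
  let τ₀ := (assign 24 (lit 1)).eval σ
  have key := eval_loop (i := 23) (n := 7) (P := ite (load 7 (reg 23))
    (ite (load 9 (load 8 (reg 23))) skip (assign 24 (lit 0))) skip) (σ := τ₀)
    (fun N τ => τ.reg 24 =
      ind (∀ x : Fin (k ^ n), (x : ℕ) < N → LegalNum G x → 0 < σ.mem 9 (σ.mem 8 x)))
    (by rw [ind_of (by simp)]; rfl) (by
      intro N hN τ hr hk hi h
      replace hN : N < k ^ n := hσ.profiles ▸ hN
      have e2 := hσ.legal ⟨N, hN⟩
      have e4 : τ.mem = σ.mem := funext fun q => hk q (by simp [wm])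
      simp only at e2
      simp only [eval, val, hi, e2, e4, ind_pos]
      have hsplit : (∀ x : Fin (k ^ n), (x : ℕ) < N + 1 → LegalNum G x →
            0 < σ.mem 9 (σ.mem 8 x)) ↔
          (∀ x : Fin (k ^ n), (x : ℕ) < N → LegalNum G x → 0 < σ.mem 9 (σ.mem 8 x)) ∧
          (LegalNum G ⟨N, hN⟩ → 0 < σ.mem 9 (σ.mem 8 N)) := by
        constructor
        · exact fun h => ⟨fun x hx => h x (by omega), h ⟨N, hN⟩ (Nat.lt_succ_self N)⟩
        · rintro ⟨h1, h2⟩ x hx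
          rcases Nat.lt_succ_iff_lt_or_eq.1 hx with hx | hx
          · exact h1 x hx
          · obtain rfl : x = ⟨N, hN⟩ := Fin.ext hx
            exact h2
      rw [ind_congr hsplit]
      rw [Store.reg_setReg, if_neg (by decide)]
      split_ifs with h1 h2
      · exact h.trans (ind_congr (and_iff_left fun _ => h2).symm)
      · simp only [Store.reg_setReg, if_true]
        exact (ind_of_not fun h => h2 (h.2 h1)).symm
      · exact h.trans (ind_congr (and_iff_left fun h => absurd h h1).symm))
  refine Eq.trans key (ind_congr ?_)
  change (∀ x : Fin (k ^ n), (x : ℕ) < σ.reg 7 → _) ↔ _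
  rw [hσ.profiles]
  exact forall_congr' fun x => ⟨fun h => h x.2, fun h _ => h⟩

end Cmd
-- Controllable predecessors and the nested fixed points.
namespace Cmd

open GRGame.Expr Set

variable {n k m a : ℕ} {G : Game (Fin n) (Fin k) (Fin m) (Fin a)} {j : Fin n} {σ : Store}

theorem holds_pre (hσ : Ready G j σ) {dst src : ℕ} (hdst : dst ∉ [1, 5, 7, 8, 9]) (hsrc : src ≠ 9)
    (hne : dst ≠ src) {X : Set (Fin m)} (hX : Holds σ src X) :
    Holds ((pre dst src).eval σ) dst (cpre (G.arena.turn j) X) := by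
  have key := eval_loop (i := 20) (n := 2) (P := mul 21 22 20 7 2 ;; clearMarks ;;
      markGroups src ;; checkGroups ;; store dst (reg 20) (reg 24)) (σ := σ)
    (fun x τ => ∀ s : Fin m, (s : ℕ) < x →
      τ.mem dst s = ind (s ∈ cpre (G.arena.turn j) X)) (fun s hs => absurd hs (Nat.not_lt_zero _)) (by
      intro x hx τ hr hk hi h s hs
      rw [hσ.states] at hx
      simp only [List.mem_cons, List.not_mem_nil, or_false, not_or] at hdst
      have hτ : Ready G j τ := hσ.congr
        (fun r h => hr r (by revert r; simp [wr, mul, clearMarks, markGroups, checkGroups]))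
        fun q h => hk q (by revert q; simp [wm, mul, clearMarks, markGroups, checkGroups]; grind)
      let τ₁ := (mul 21 22 20 7 2).eval τ
      let τ₂ := clearMarks.eval τ₁
      let τ₃ := (markGroups src).eval τ₂
      let τ₄ := checkGroups.eval τ₃
      have h₁ : Ready G j τ₁ := hτ.eval (by decide) (by decide)
      have h₂ : Ready G j τ₂ := h₁.eval (by decide) (by decide)
      have h₃ : Ready G j τ₃ := h₂.eval (by simp [wr, markGroups]) (by simp [wm, markGroups])
      have hX₂ : Holds τ₂ src X := hX.congr (by
        rw [eval_mem_of_notMem (by simpa [clearMarks, wm] using hsrc),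
          eval_mem_of_notMem (by simp [mul, wm]),
          hk src (by simp [wm, mul, clearMarks, markGroups, checkGroups, hsrc, hne.symm])])
      have e21 : τ₂.reg 21 = x * k ^ n := by
        rw [eval_reg_of_notMem (by decide)]
        simp only [τ₁]
        rw [eval_mul (by decide) (by decide) (by decide) (by decide) (by decide) (by decide)
          (by rw [hi, hτ.states]; omega)]
        simp [hi, hτ.profiles]
      have e9 := fun {y} hy => markGroups_mem h₂ hsrc hX₂ (s := ⟨x, hx⟩) e21
        (fun y hy => clearMarks_mem (by rwa [h₁.profiles])) (y := y) hy
      have e24 := checkGroups_reg h₃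
      have e20 : τ₄.reg 20 = x := by
        rw [eval_reg_of_notMem (by decide), eval_reg_of_notMem (by simp [wr, markGroups]),
          eval_reg_of_notMem (by decide), eval_reg_of_notMem (by decide), hi]
      have e8 : τ₃.mem 8 = τ₂.mem 8 := eval_mem_of_notMem (by simp [wm, markGroups]) _
      have edst : τ₄.mem dst = τ.mem dst := by
        rw [eval_mem_of_notMem (by simp [checkGroups, wm]),
          eval_mem_of_notMem (by simp [markGroups, wm, hdst]),
          eval_mem_of_notMem (by simp [clearMarks, wm, hdst]),
          eval_mem_of_notMem (by simp [mul, wm])]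
      change (τ₄.setMem dst (τ₄.reg 20) (τ₄.reg 24)).mem dst s = _
      rw [Store.mem_setMem, e20, edst]
      by_cases hsx : (s : ℕ) = x
      · subst hsx
        rw [if_pos ⟨rfl, rfl⟩, e24]
        -- Equal group numbers mean equal actions off `j`, so a mark at the group of `y` witnesses
        -- exactly an answer of `j` to `y`.
        refine ind_congr (Iff.trans (forall_congr' fun y => imp_congr_right fun hy => ?_)
          mem_cpre_turn.symm)
        rw [e8, e9 (h₂.group_lt y), ind_pos]
        exact exists_congr fun z => and_congr_right fun _ => and_congr_left fun _ =>
          h₂.group_eq z y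
      · rw [if_neg fun h => hsx h.2]
        exact h s (by omega))
  rw [hσ.states] at key
  exact fun s => key s s.2

abbrev thetaSet (G : Game (Fin n) (Fin k) (Fin m) (Fin a)) (j : Fin n) :=
  (G.goal j).guaranteeSet G.arena.label

abbrev psiSet (G : Game (Fin n) (Fin k) (Fin m) (Fin a)) (j : Fin n) :=
  (G.goal j).assumptionSet G.arena.label

theorem rowFormula_assumption (l : Fin ((G.goal j).assumptions.length + 1)) (s : Fin m) :
    (rowFormula G j l).Holds (G.arena.label s) ↔ s ∈ psiSet G j l := by
  rw [rowFormula, psiSet, GR1.assumptionSet, mem_ofPred_eq, GR1.formulas, ← List.cons_append,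
    List.getD_append _ _ _ _ l.2]

theorem rowFormula_guarantee (r : Fin ((G.goal j).guarantees.length + 1)) (s : Fin m) :
    (rowFormula G j ((G.goal j).assumptions.length + 1 + r)).Holds (G.arena.label s) ↔
      s ∈ thetaSet G j r := by
  rw [rowFormula, thetaSet, GR1.guaranteeSet, mem_ofPred_eq, GR1.formulas, ← List.cons_append,
    List.getD_append_right _ _ _ _ (by simp), List.length_cons, Nat.add_sub_cancel_left]

/-- With negated truth values in array `5`, θ ∩ cp Z is the comparison "negated θ below cp Z", and
ψᶜ ∩ cp X says that two bits add up to more than 1. The guarantees start at the row after the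
assumptions and the leading `⊤`. -/
theorem holds_roundX (hσ : Ready G j σ) {r : Fin ((G.goal j).guarantees.length + 1)}
    {l : Fin ((G.goal j).assumptions.length + 1)} (hr : σ.reg 40 = r) (hl : σ.reg 41 = l)
    {Z Y X : Set (Fin m)} (hZ : Holds σ 13 Z) (hY : Holds σ 14 Y) (hX : Holds σ 15 X) :
    Holds (roundX.eval σ) 15
      (stepX (cpre (G.arena.turn j)) (thetaSet G j r) (psiSet G j l) Z Y X) := by
  let σ₁ := (pre 10 13).eval σ
  let σ₂ := (pre 11 14).eval σ₁
  let σ₃ := (pre 12 15).eval σ₂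
  let σ₄ := (mul 21 22 41 2 8).eval σ₃
  let σ₅ := (assign 23 (add (reg 8) (reg 40))).eval σ₄
  let σ₆ := (mul 24 22 23 2 13).eval σ₅
  have h₁ : Ready G j σ₁ := hσ.eval (by decide) (by decide)
  have h₂ : Ready G j σ₂ := h₁.eval (by decide) (by decide)
  have h₃ : Ready G j σ₃ := h₂.eval (by decide) (by decide)
  have h₄ : Ready G j σ₄ := h₃.eval (by decide) (by decide)
  have h₅ : Ready G j σ₅ := h₄.eval (by decide) (by decide)
  have h₆ : Ready G j σ₆ := h₅.eval (by decide) (by decide)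
  have hCZ : Holds σ₆ 10 (cpre (G.arena.turn j) Z) :=
    (holds_pre hσ (by decide) (by decide) (by decide) hZ).congr (by
      iterate 5 rw [eval_mem_of_notMem (by decide)])
  have hCY : Holds σ₆ 11 (cpre (G.arena.turn j) Y) :=
    (holds_pre h₁ (by decide) (by decide) (by decide)
      (hY.congr (eval_mem_of_notMem (by decide) _))).congr (by
      iterate 4 rw [eval_mem_of_notMem (by decide)])
  have hCX : Holds σ₆ 12 (cpre (G.arena.turn j) X) :=
    (holds_pre h₂ (by decide) (by decide) (by decide)
      (hX.congr (by iterate 2 rw [eval_mem_of_notMem (by decide)]))).congr (by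
      iterate 3 rw [eval_mem_of_notMem (by decide)])
  have e41 : σ₃.reg 41 = l := by iterate 3 rw [eval_reg_of_notMem (by decide)]
                                 exact hl
  have e40 : σ₄.reg 40 = r := by iterate 4 rw [eval_reg_of_notMem (by decide)]
                                 exact hr
  have e21 : σ₆.reg 21 = l * m := by
    rw [eval_reg_of_notMem (by decide), eval_reg_of_notMem (by decide)]
    simp only [σ₄]
    rw [eval_mul (by decide) (by decide) (by decide) (by decide) (by decide) (by decide)
      (by rw [e41, h₃.assumptions]; omega)]
    simp [e41, h₃.states]
  have e23 : σ₅.reg 23 = (G.goal j).assumptions.length + 1 + r := by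
    simp [σ₅, h₄.assumptions, e40]
  have e24 : σ₆.reg 24 = ((G.goal j).assumptions.length + 1 + r) * m := by
    simp only [σ₆]
    rw [eval_mul (by decide) (by decide) (by decide) (by decide) (by decide) (by decide)
      (by rw [e23, h₅.rows]; omega)]
    simp [e23, h₅.states]
  refine holds_map (σ := σ₆) _ h₆.states fun s τ hr hk hd hi => ?_
  have t5 : τ.mem 5 = σ₆.mem 5 := hk 5 (by decide)
  have tθ := h₆.truth ((G.goal j).assumptions.length + 1 + r) s
  have tψ := h₆.truth l s
  rw [rowFormula_guarantee] at tθ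
  rw [rowFormula_assumption] at tψ
  simp only [val, hi, hr 24 (by decide), hr 21 (by decide), e24, e21, t5, tθ, tψ,
    hk 10 (by decide), hk 11 (by decide), hk 12 (by decide), hCZ s, hCY s, hCX s]
  simp only [stepX, mem_union, mem_inter_iff, mem_compl_iff]
  by_cases b1 : s ∈ thetaSet G j r <;> by_cases b2 : s ∈ cpre (G.arena.turn j) Z <;>
    by_cases b3 : s ∈ cpre (G.arena.turn j) Y <;> by_cases b4 : s ∈ psiSet G j l <;>
    by_cases b5 : s ∈ cpre (G.arena.turn j) X <;> simp [ind, b1, b2, b3, b4, b5]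

theorem holds_iterX (hσ : Ready G j σ) {r : Fin ((G.goal j).guarantees.length + 1)}
    {l : Fin ((G.goal j).assumptions.length + 1)} (hr : σ.reg 40 = r) (hl : σ.reg 41 = l)
    {Z Y : Set (Fin m)} (hZ : Holds σ 13 Z) (hY : Holds σ 14 Y) :
    Holds (iterX.eval σ) 15
      (fixX (cpre (G.arena.turn j)) m (thetaSet G j r) (psiSet G j l) Z Y) := by
  let σ₁ := (map 15 (lit 1)).eval σ
  have h₁ : Ready G j σ₁ := hσ.eval (by decide) (by decide)
  have hX : Holds σ₁ 15 (univ : Set (Fin m)) :=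
    holds_map _ hσ.states fun s τ _ _ _ _ => by simp [ind]
  have key := eval_loop (i := 44) (n := 2) (P := roundX) (σ := σ₁) (fun N τ =>
    Holds τ 15 ((stepX (cpre (G.arena.turn j)) (thetaSet G j r) (psiSet G j l) Z Y)^[N] univ)) hX (by
      intro N _ τ tr tk _ h
      rw [Function.iterate_succ_apply']
      refine holds_roundX (h₁.congr (fun r h => tr r (by revert r; decide))
        (fun q h => tk q (by revert q; decide))) ?_ ?_ ?_ ?_ h
      · rw [tr 40 (by decide), eval_reg_of_notMem (by decide), hr]
      · rw [tr 41 (by decide), eval_reg_of_notMem (by decide), hl]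
      · exact hZ.congr (by rw [tk 13 (by decide), eval_mem_of_notMem (by decide)])
      · exact hY.congr (by rw [tk 14 (by decide), eval_mem_of_notMem (by decide)]))
  rw [h₁.states] at key
  exact key

theorem holds_roundY (hσ : Ready G j σ) {r : Fin ((G.goal j).guarantees.length + 1)}
    (hr : σ.reg 40 = r) {Z Y : Set (Fin m)} (hZ : Holds σ 13 Z) (hY : Holds σ 14 Y) :
    Holds (roundY.eval σ) 14
      (stepY (cpre (G.arena.turn j)) m (thetaSet G j r) (psiSet G j) Z Y) := by
  let σ₁ := (map 16 (lit 0)).eval σ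
  have h₁ : Ready G j σ₁ := hσ.eval (by decide) (by decide)
  have hE : Holds σ₁ 16 (∅ : Set (Fin m)) :=
    holds_map _ hσ.states fun s τ _ _ _ _ => by simp [ind]
  let F := fun l => fixX (cpre (G.arena.turn j)) m (thetaSet G j r) (psiSet G j l) Z Y
  have key := eval_loop (i := 41) (n := 8)
    (P := iterX ;; map 16 (lt (lit 0) (add (load 15 (reg 20)) (load 16 (reg 20))))) (σ := σ₁)
    (fun N τ => Holds τ 16 {s | ∃ l : Fin ((G.goal j).assumptions.length + 1), (l : ℕ) < N ∧
      s ∈ F l}) (fun s => (hE s).trans (ind_congr (by simp))) (by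
      intro N hN τ tr tk hi h
      rw [h₁.assumptions] at hN
      have hτ : Ready G j τ := h₁.congr (fun r h => tr r (by revert r; decide))
        (fun q h => tk q (by revert q; decide))
      have hF : Holds (iterX.eval τ) 15 (F ⟨N, hN⟩) := holds_iterX hτ
        (by rw [tr 40 (by decide), eval_reg_of_notMem (by decide), hr]) hi
        (hZ.congr (by rw [tk 13 (by decide), eval_mem_of_notMem (by decide)]))
        (hY.congr (by rw [tk 14 (by decide), eval_mem_of_notMem (by decide)]))
      refine holds_map (σ := iterX.eval τ) _
        (by rw [eval_reg_of_notMem (by decide), hτ.states]) fun s ρ hr hk hd hi => ?_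
      have e16 : (iterX.eval τ).mem 16 = τ.mem 16 := eval_mem_of_notMem (by decide) _
      simp only [val, hi, hd, e16, h s, hk 15 (by decide), hF s]
      have hsplit : s ∈ {s | ∃ l : Fin ((G.goal j).assumptions.length + 1), (l : ℕ) < N + 1 ∧
          s ∈ F l} ↔ s ∈ F ⟨N, hN⟩ ∨
          s ∈ {s | ∃ l : Fin ((G.goal j).assumptions.length + 1), (l : ℕ) < N ∧ s ∈ F l} := by
        constructor
        · rintro ⟨l, hl, h⟩
          rcases Nat.lt_succ_iff_lt_or_eq.1 hl with hl | hl
          · exact .inr ⟨l, hl, h⟩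
          · obtain rfl : l = ⟨N, hN⟩ := Fin.ext hl
            exact .inl h
        · rintro (h | ⟨l, hl, h⟩)
          · exact ⟨⟨N, hN⟩, Nat.lt_succ_self N, h⟩
          · exact ⟨l, by omega, h⟩
      rw [ind_congr hsplit]
      by_cases b1 : s ∈ F ⟨N, hN⟩ <;>
        by_cases b2 : s ∈ {s | ∃ l : Fin ((G.goal j).assumptions.length + 1), (l : ℕ) < N ∧
          s ∈ F l} <;> simp only [ind, b1, b2] <;> simp)
  rw [h₁.assumptions] at key
  refine holds_map (σ := (loop 41 8 (iterX ;; map 16 (lt (lit 0) (add (load 15 (reg 20))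
    (load 16 (reg 20)))))).eval σ₁) _ ?_ fun s τ _ hk _ hi => ?_
  · rw [eval_reg_of_notMem (by decide), h₁.states]
  · simp only [val, hi, hk 16 (by decide)]
    refine (key s).trans (ind_congr ?_)
    rw [stepY, mem_iUnion]
    exact exists_congr fun l => and_iff_right l.2

theorem holds_iterY (hσ : Ready G j σ) {r : Fin ((G.goal j).guarantees.length + 1)}
    (hr : σ.reg 40 = r) {Z : Set (Fin m)} (hZ : Holds σ 13 Z) :
    Holds (iterY.eval σ) 14 (fixY (cpre (G.arena.turn j)) m (thetaSet G j r) (psiSet G j) Z) := by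
  let σ₁ := (map 14 (lit 0)).eval σ
  have h₁ : Ready G j σ₁ := hσ.eval (by decide) (by decide)
  have hE : Holds σ₁ 14 (∅ : Set (Fin m)) :=
    holds_map _ hσ.states fun s τ _ _ _ _ => by simp [ind]
  have key := eval_loop (i := 43) (n := 2) (P := roundY) (σ := σ₁) (fun N τ =>
    Holds τ 14 ((stepY (cpre (G.arena.turn j)) m (thetaSet G j r) (psiSet G j) Z)^[N] ∅)) hE (by
      intro N _ τ tr tk _ h
      rw [Function.iterate_succ_apply']
      refine holds_roundY (h₁.congr (fun r h => tr r (by revert r; decide))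
        (fun q h => tk q (by revert q; decide))) ?_ ?_ h
      · rw [tr 40 (by decide), eval_reg_of_notMem (by decide), hr]
      · exact hZ.congr (by rw [tk 13 (by decide), eval_mem_of_notMem (by decide)]))
  rw [h₁.states] at key
  exact key

theorem holds_roundZ (hσ : Ready G j σ) {Z : Set (Fin m)} (hZ : Holds σ 13 Z) :
    Holds (roundZ.eval σ) 13
      (stepZ (cpre (G.arena.turn j)) m (thetaSet G j) (psiSet G j) Z) := by
  let σ₁ := (map 17 (lit 1)).eval σ
  have h₁ : Ready G j σ₁ := hσ.eval (by decide) (by decide)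
  have hE : Holds σ₁ 17 (univ : Set (Fin m)) :=
    holds_map _ hσ.states fun s τ _ _ _ _ => by simp [ind]
  let F := fun r => fixY (cpre (G.arena.turn j)) m (thetaSet G j r) (psiSet G j) Z
  have key := eval_loop (i := 40) (n := 9)
    (P := iterY ;; map 17 (lt (lit 1) (add (load 14 (reg 20)) (load 17 (reg 20))))) (σ := σ₁)
    (fun N τ => Holds τ 17 {s | ∀ r : Fin ((G.goal j).guarantees.length + 1), (r : ℕ) < N →
      s ∈ F r}) (fun s => (hE s).trans (ind_congr (by simp))) (by
      intro N hN τ tr tk hi h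
      rw [h₁.guarantees] at hN
      have hτ : Ready G j τ := h₁.congr (fun r h => tr r (by revert r; decide))
        (fun q h => tk q (by revert q; decide))
      have hF : Holds (iterY.eval τ) 14 (F ⟨N, hN⟩) := holds_iterY hτ hi
        (hZ.congr (by rw [tk 13 (by decide), eval_mem_of_notMem (by decide)]))
      refine holds_map (σ := iterY.eval τ) _
        (by rw [eval_reg_of_notMem (by decide), hτ.states]) fun s ρ hr hk hd hi => ?_
      have e17 : (iterY.eval τ).mem 17 = τ.mem 17 := eval_mem_of_notMem (by decide) _
      simp only [val, hi, hd, e17, h s, hk 14 (by decide), hF s]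
      have hsplit : s ∈ {s | ∀ r : Fin ((G.goal j).guarantees.length + 1), (r : ℕ) < N + 1 →
          s ∈ F r} ↔ s ∈ F ⟨N, hN⟩ ∧
          s ∈ {s | ∀ r : Fin ((G.goal j).guarantees.length + 1), (r : ℕ) < N → s ∈ F r} := by
        constructor
        · exact fun h => ⟨h ⟨N, hN⟩ (Nat.lt_succ_self N), fun r hr => h r (by omega)⟩
        · rintro ⟨h1, h2⟩ r hr
          rcases Nat.lt_succ_iff_lt_or_eq.1 hr with hr | hr
          · exact h2 r hr
          · obtain rfl : r = ⟨N, hN⟩ := Fin.ext hr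
            exact h1
      rw [ind_congr hsplit]
      by_cases b1 : s ∈ F ⟨N, hN⟩ <;>
        by_cases b2 : s ∈ {s | ∀ r : Fin ((G.goal j).guarantees.length + 1), (r : ℕ) < N →
          s ∈ F r} <;> simp only [ind, b1, b2] <;> simp)
  rw [h₁.guarantees] at key
  refine holds_map (σ := (loop 40 9 (iterY ;; map 17 (lt (lit 1) (add (load 14 (reg 20))
    (load 17 (reg 20)))))).eval σ₁) _ ?_ fun s τ _ hk _ hi => ?_
  · rw [eval_reg_of_notMem (by decide), h₁.states]
  · simp only [val, hi, hk 17 (by decide)]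
    refine (key s).trans (ind_congr ?_)
    rw [stepZ, mem_iInter]
    exact forall_congr' fun r => ⟨fun h => h r.2, fun h _ => h⟩

theorem holds_iterZ (hσ : Ready G j σ) : Holds (iterZ.eval σ) 13 (G.winRegion j m) := by
  let σ₁ := (map 13 (lit 1)).eval σ
  have h₁ : Ready G j σ₁ := hσ.eval (by decide) (by decide)
  have hE : Holds σ₁ 13 (univ : Set (Fin m)) :=
    holds_map _ hσ.states fun s τ _ _ _ _ => by simp [ind]
  have key := eval_loop (i := 42) (n := 2) (P := roundZ) (σ := σ₁) (fun N τ =>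
    Holds τ 13 ((stepZ (cpre (G.arena.turn j)) m (thetaSet G j) (psiSet G j))^[N] univ)) hE (by
      intro N _ τ tr tk _ h
      rw [Function.iterate_succ_apply']
      exact holds_roundZ (h₁.congr (fun r h => tr r (by revert r; decide))
        (fun q h => tk q (by revert q; decide))) h)
  rw [h₁.states] at key
  exact key

/-! ### The table of truth values. -/

theorem eval_mul_reg {d i x y n : ℕ} (h1 : d ≠ i) (h2 : d ≠ x) (h3 : d ≠ y) (h4 : d ≠ n)
    (h5 : i ≠ x) (h6 : i ≠ y) {σ : Store} (h : σ.reg x ≤ σ.reg n) :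
    ((mul d i x y n).eval σ).reg d = σ.reg x * σ.reg y := by
  rw [eval_mul h1 h2 h3 h4 h5 h6 h]
  simp [h1]

/-- Register `25` and array `6` hold the stack `st`. -/
def StackHolds (σ : Store) (st : List Prop) : Prop :=
  σ.reg 25 = st.length ∧ StackRep (σ.mem 6) st

/-- Underfull stacks are covered as well: `stackStep` is defined on them so that truncated
subtraction in register `25` still gives the length. No well-formedness of the code enters here. -/
theorem stackHolds_stackSymbol {st : List Prop} (h : StackHolds σ st) {v : ℕ → Prop}
    (hv : ∀ y, σ.mem 2 (σ.reg 26 + y) = ind (v y)) :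
    StackHolds (stackSymbol.eval σ) (stackStep v st (σ.reg 28)) := by
  obtain ⟨hlen, hrep⟩ := h
  rcases hy : σ.reg 28 with _ | _ | _ | y
  · refine ⟨by simp [stackSymbol, hy, stackStep, hlen], ?_⟩
    simp only [stackStep, stackSymbol, eval, val, hy]
    exact ⟨by simp [hlen, ind], hrep.congr fun x hx => by simp [hlen]; omega⟩
  · rcases st with _ | ⟨p, st⟩
    · exact ⟨by simp [stackSymbol, hy, stackStep, hlen], trivial⟩
    · refine ⟨by simp [stackSymbol, hy, stackStep, hlen], ?_⟩
      simp only [List.length_cons] at hlen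
      simp only [stackStep, stackSymbol, eval, val, hy]
      exact ⟨by simp [hlen, hrep.1, one_sub_ind],
        hrep.2.congr fun x hx => by simp [hlen]; omega⟩
  · rcases st with _ | ⟨p, _ | ⟨q, st⟩⟩
    · exact ⟨by simp [stackSymbol, hy, stackStep, hlen], trivial⟩
    · exact ⟨by simp [stackSymbol, hy, stackStep, hlen], trivial⟩
    · refine ⟨by simp [stackSymbol, hy, stackStep, hlen], ?_⟩
      simp only [List.length_cons] at hlen
      obtain ⟨hp, hq, hst⟩ := hrep
      simp only [List.length_cons] at hp
      simp only [stackStep, stackSymbol, eval, val, hy]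
      refine ⟨?_, hst.congr fun x hx => by simp [hlen]; omega⟩
      simp only [Store.reg_setReg, Store.mem_setReg, hlen]
      simp only [Nat.reduceAdd, Nat.reduceLT, if_true, if_false, Nat.lt_irrefl,
        Nat.add_sub_cancel, Store.mem_setMem, true_and, hp, hq,
        Store.mem_setReg]
      by_cases b1 : p <;> by_cases b2 : q <;> simp [ind, b1, b2]
  · have h3 : ¬ y + 1 + 1 + 1 < 3 := by omega
    refine ⟨by simp [stackSymbol, hy, stackStep, hlen, h3], ?_⟩
    simp only [stackStep, stackSymbol, eval, val, hy]
    exact ⟨by simp [hlen, hv, h3], hrep.congr fun x hx => by simp [hlen, h3]; omega⟩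

/-- The length of the current formula lies in a working register and cannot bound a loop. The loop
therefore runs up to `R 11`, which dominates the lengths of all formulas, and idles after the last
symbol. -/
theorem evalFormula_mem (hm : σ.reg 2 = m) (ha : σ.reg 3 = a) {s : Fin m} (hs : σ.reg 21 = s)
    (hlab : σ.mem 2 = G.arena.labelTable) {f : BoolForm (Fin a)} (hlen : σ.reg 24 = f.code.length)
    (hL : f.code.length ≤ σ.reg 11)
    (hcode : ∀ q < f.code.length, σ.mem 3 (σ.reg 23 + q) = f.code.getD q 0) :
    (evalFormula.eval σ).mem 6 0 = ind (f.Holds (G.arena.label s)) := by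
  let v : ℕ → Prop := fun y => 0 < G.arena.labelTable (s * a + y)
  let σ₁ := (assign 25 (lit 0)).eval σ
  let σ₂ := (mul 26 27 21 3 2).eval σ₁
  have e26 : σ₂.reg 26 = s * a := by
    simp only [σ₂]
    rw [eval_mul_reg (by decide) (by decide) (by decide) (by decide) (by decide) (by decide)
      (by simp [σ₁, hs, hm]), eval_reg_of_notMem (by decide), eval_reg_of_notMem (by decide), hs, ha]
  have hreg : ∀ r, r ∉ [25, 26, 27] → σ₂.reg r = σ.reg r := by
    intro r hr
    rw [eval_reg_of_notMem (by revert hr; simp [mul, wr]; tauto),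
      eval_reg_of_notMem (by revert hr; simp [wr]; tauto)]
  have hmem : σ₂.mem = σ.mem := by
    funext q
    rw [eval_mem_of_notMem (by simp [mul, wm]), eval_mem_of_notMem (by simp [wm])]
  have key := eval_loop (i := 22) (n := 11) (P := ite (lt (reg 22) (reg 24))
      (assign 28 (load 3 (add (reg 23) (reg 22))) ;; stackSymbol) skip) (σ := σ₂)
    (fun q τ => StackHolds τ ((f.code.take q).foldl (stackStep v) []))
    ⟨by change σ₂.reg 25 = 0; rw [eval_reg_of_notMem (by decide)]; rfl, trivial⟩ (by
      intro q _ τ tr tk hi h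
      have e24 : τ.reg 24 = f.code.length := by
        rw [tr 24 (by decide), hreg 24 (by decide), hlen]
      by_cases hq : q < f.code.length
      · have hstep : (f.code.take (q + 1)).foldl (stackStep v) [] =
            stackStep v ((f.code.take q).foldl (stackStep v) []) (f.code.getD q 0) := by
          rw [List.take_succ_eq_append_getElem hq, List.foldl_append,
            List.getD_eq_getElem _ _ hq]
          rfl
        rw [hstep]
        let τ₁ := (assign 28 (load 3 (add (reg 23) (reg 22)))).eval τ
        have h28 : τ₁.reg 28 = f.code.getD q 0 := by
          simp [τ₁, tr 23 (by decide), hreg 23 (by decide), tk 3 (by decide), hi, hmem,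
            hcode q hq]
        have := stackHolds_stackSymbol (σ := τ₁) (st := (f.code.take q).foldl (stackStep v) [])
          ⟨by rw [eval_reg_of_notMem (by decide)]; exact h.1, h.2⟩ (v := v) (fun y => by
            rw [eval_reg_of_notMem (by decide), tr 26 (by decide), e26,
              eval_mem_of_notMem (by decide), tk 2 (by decide), hmem, hlab]
            exact labelTable_eq_ind _ _)
        rw [h28] at this
        have hev : (ite (lt (reg 22) (reg 24))
            (assign 28 (load 3 (add (reg 23) (reg 22))) ;; stackSymbol) skip).eval τ =
            stackSymbol.eval τ₁ := by
          rw [eval, if_pos (by simp [hi, e24, hq])]; rfl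
        rw [hev]
        exact ⟨by rw [Store.reg_setReg, if_neg (by decide)]; exact this.1, this.2⟩
      · rw [List.take_of_length_le (by omega)]
        rw [List.take_of_length_le (by omega)] at h
        have hev : (ite (lt (reg 22) (reg 24))
            (assign 28 (load 3 (add (reg 23) (reg 22))) ;; stackSymbol) skip).eval τ = τ := by
          rw [eval, if_neg (by simp [hi, e24]; omega)]; rfl
        rw [hev]
        exact ⟨by rw [Store.reg_setReg, if_neg (by decide)]; exact h.1, h.2⟩)
  rw [hreg 11 (by decide), List.take_of_length_le hL,
    foldl_stackStep_code (V := G.arena.label s) (fun p => by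
      simp only [v]; rw [labelTable_apply, ind_pos])] at key
  exact key.2.1

theorem truthRow_mem (hm : σ.reg 2 = m) (ha : σ.reg 3 = a)
    (hlab : σ.mem 2 = G.arena.labelTable) {f : BoolForm (Fin a)} (hlen : σ.reg 24 = f.code.length)
    (hL : f.code.length ≤ σ.reg 11)
    (hcode : ∀ q < f.code.length, σ.mem 3 (σ.reg 23 + q) = f.code.getD q 0)
    (hrow : σ.reg 30 ≤ σ.reg 13) (y : ℕ) (s : Fin m) :
    (truthRow.eval σ).mem 5 (y * m + s) =
      if y = σ.reg 30 then ind ¬ f.Holds (G.arena.label s) else σ.mem 5 (y * m + s) := by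
  have key := eval_loop (i := 21) (n := 2) (P := evalFormula ;; mul 29 27 30 2 13 ;;
      store 5 (add (reg 29) (reg 21)) (sub (lit 1) (load 6 (lit 0)))) (σ := σ)
    (fun N τ => ∀ (y : ℕ) (s : Fin m), τ.mem 5 (y * m + s) =
      if y = σ.reg 30 ∧ (s : ℕ) < N then ind ¬ f.Holds (G.arena.label s)
      else σ.mem 5 (y * m + s)) (fun y s => by simp) (by
      intro N hN τ tr tk hi h y s
      rw [hm] at hN
      let τ₁ := evalFormula.eval τ
      let τ₂ := (mul 29 27 30 2 13).eval τ₁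
      have e6 : τ₂.mem 6 0 = ind (f.Holds (G.arena.label ⟨N, hN⟩)) := by
        rw [eval_mem_of_notMem (by decide)]
        exact evalFormula_mem (by rw [tr 2 (by decide), hm]) (by rw [tr 3 (by decide), ha]) hi
          (by rw [tk 2 (by decide), hlab]) (by rw [tr 24 (by decide), hlen])
          (by rwa [tr 11 (by decide)])
          (by rw [tk 3 (by decide), tr 23 (by decide)]; exact hcode)
      have e29 : τ₂.reg 29 = σ.reg 30 * m := by
        have h30 : τ₁.reg 30 = σ.reg 30 := by
          rw [eval_reg_of_notMem (by decide), tr 30 (by decide)]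
        have h13 : τ₁.reg 13 = σ.reg 13 := by
          rw [eval_reg_of_notMem (by decide), tr 13 (by decide)]
        simp only [τ₂]
        rw [eval_mul_reg (by decide) (by decide) (by decide) (by decide) (by decide) (by decide)
          (by rwa [h30, h13]), h30, eval_reg_of_notMem (by decide), tr 2 (by decide), hm]
      have e21 : τ₂.reg 21 = N := by
        rw [eval_reg_of_notMem (by decide), eval_reg_of_notMem (by decide), hi]
      have e5 : τ₂.mem 5 = τ.mem 5 := by
        rw [eval_mem_of_notMem (by decide), eval_mem_of_notMem (by decide)]
      change (τ₂.setMem 5 (τ₂.reg 29 + τ₂.reg 21) (1 - τ₂.mem 6 0)).mem 5 _ = _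
      rw [Store.mem_setMem, e29, e21, e6, e5, one_sub_ind]
      by_cases heq : y * m + s = σ.reg 30 * m + N
      -- Row and column are the quotient and the remainder modulo `m`, so the address determines
      -- both.
      · obtain ⟨h1, h2⟩ : y = σ.reg 30 ∧ (s : ℕ) = N := by
          have h1 := congrArg (· / m) heq
          have h2 := congrArg (· % m) heq
          have hm0 : 0 < m := by omega
          simp only [mul_comm _ m, Nat.mul_add_div hm0, Nat.div_eq_of_lt s.2,
            Nat.div_eq_of_lt hN, add_zero, Nat.mul_add_mod, Nat.mod_eq_of_lt s.2,
            Nat.mod_eq_of_lt hN] at h1 h2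
          exact ⟨h1, h2⟩
        rw [if_pos ⟨rfl, heq⟩, if_pos ⟨h1, by omega⟩]
        obtain rfl : s = ⟨N, hN⟩ := Fin.ext h2
        rfl
      · rw [if_neg (fun h => heq h.2), h]
        have : (y = σ.reg 30 ∧ (s : ℕ) < N) ↔ (y = σ.reg 30 ∧ (s : ℕ) < N + 1) := by
          refine and_congr_right fun hy => ⟨fun h => by omega, fun h => ?_⟩
          rcases Nat.lt_succ_iff_lt_or_eq.1 h with h | h
          · exact h
          · exact absurd (by rw [hy, h]) heq
        rw [if_congr this rfl rfl])
  have := key y s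
  rw [hm] at this
  exact this.trans (if_congr (and_iff_left s.2) rfl rfl)

/-- The input arrays are intact and the registers of the header are set. -/
structure Loaded (G : Game (Fin n) (Fin k) (Fin m) (Fin a)) (j : Fin n) (σ : Store) : Prop where
  players : σ.reg 0 = n
  actions : σ.reg 1 = k
  states : σ.reg 2 = m
  atoms : σ.reg 3 = a
  player : σ.reg 4 = j
  profiles : σ.reg 7 = k ^ n
  assumptions : σ.reg 8 = (G.goal j).assumptions.length + 1
  guarantees : σ.reg 9 = (G.goal j).guarantees.length + 1
  formulas : σ.reg 10 = (G.goal j).formulas.length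
  base : σ.reg 12 = G.goalPos j + 2
  rows : σ.reg 13 = (G.goal j).assumptions.length + (G.goal j).guarantees.length + 2
  act : σ.mem 0 = G.arena.actTable
  tr : σ.mem 1 = G.arena.trTable
  label : σ.mem 2 = G.arena.labelTable
  goals : σ.mem 3 = fun x => G.goalList.getD x 0

theorem Loaded.congr {τ : Store} (h : Loaded G j σ)
    (hr : ∀ r ∈ [0, 1, 2, 3, 4, 7, 8, 9, 10, 12, 13], τ.reg r = σ.reg r)
    (hk : ∀ k ∈ [0, 1, 2, 3], τ.mem k = σ.mem k) : Loaded G j τ := by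
  constructor
  · rw [hr 0 (by decide), h.players]
  · rw [hr 1 (by decide), h.actions]
  · rw [hr 2 (by decide), h.states]
  · rw [hr 3 (by decide), h.atoms]
  · rw [hr 4 (by decide), h.player]
  · rw [hr 7 (by decide), h.profiles]
  · rw [hr 8 (by decide), h.assumptions]
  · rw [hr 9 (by decide), h.guarantees]
  · rw [hr 10 (by decide), h.formulas]
  · rw [hr 12 (by decide), h.base]
  · rw [hr 13 (by decide), h.rows]
  · rw [hk 0 (by decide), h.act]
  · rw [hk 1 (by decide), h.tr]
  · rw [hk 2 (by decide), h.label]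
  · rw [hk 3 (by decide), h.goals]

theorem Loaded.eval (h : Loaded G j σ) {c : Cmd}
    (hr : ∀ r ∈ [0, 1, 2, 3, 4, 7, 8, 9, 10, 12, 13], r ∉ c.wr) (hk : ∀ k ∈ [0, 1, 2, 3], k ∉ c.wm) :
    Loaded G j (c.eval σ) :=
  h.congr (fun r h => eval_reg_of_notMem (hr r h) σ) fun k h => eval_mem_of_notMem (hk k h) σ

theorem entry_eq (hg : σ.mem 3 = fun x => G.goalList.getD x 0) {x : ℕ}
    (hx : x < (G.goal j).formulas.length) :
    σ.mem 3 (G.goalPos j + 2 + entryPos (G.goal j).formulas x) =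
        (G.goal j).formulas[x].code.length ∧
      ∀ q < (G.goal j).formulas[x].code.length,
        σ.mem 3 (G.goalPos j + 2 + entryPos (G.goal j).formulas x + 1 + q) =
          (G.goal j).formulas[x].code.getD q 0 := by
  rw [hg]
  constructor
  · exact goalList_getD_formula G j hx (y := 0) (by simp [BoolForm.entry])
  · intro q hq
    have := goalList_getD_formula G j hx (y := q + 1) (by simp [BoolForm.entry, hq])
    simp only [BoolForm.entry, List.getD_cons_succ] at this
    rw [← this]
    congr 1
    omega

/-- The invariant says that the rows up to `N` are final and all later ones still zero. The final
statement thus holds for every `y`: beyond the last formula, `rowFormula` defaults to `⊤`, whose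
negation has value 0. -/
theorem truthTable_mem (h : Loaded G j σ) (h0 : σ.mem 5 = fun _ => 0)
    (hL : ∀ f ∈ (G.goal j).formulas, f.code.length ≤ σ.reg 11) (y : ℕ) (s : Fin m) :
    (truthTable.eval σ).mem 5 (y * m + s) =
      ind ¬ (rowFormula G j y).Holds (G.arena.label s) := by
  let σ₁ := (assign 23 (reg 12)).eval σ
  have htop : ind (¬ (BoolForm.top : BoolForm (Fin a)).Holds (G.arena.label s)) = 0 :=
    ind_of_not (by simp [BoolForm.Holds])
  have key := eval_loop (i := 20) (n := 10) (P := assign 24 (load 3 (reg 23)) ;;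
     assign 23 (add (reg 23) (lit 1)) ;;
     assign 30 (add (reg 20) (lit 1)) ;;
     truthRow ;;
     assign 23 (add (reg 23) (reg 24))) (σ := σ₁)
    (fun N τ => τ.reg 23 = G.goalPos j + 2 + entryPos (G.goal j).formulas N ∧
      ∀ (y : ℕ) (s : Fin m), τ.mem 5 (y * m + s) =
        if y ≤ N then ind ¬ (rowFormula G j y).Holds (G.arena.label s) else 0)
    ⟨by simp [σ₁, h.base, entryPos], fun y s => by
      simp only [σ₁, eval, Store.mem_setReg, h0]
      split_ifs with hy
      · obtain rfl : y = 0 := by omega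
        exact (ind_of_not (by simp [rowFormula, BoolForm.Holds])).symm
      · rfl⟩ (by
      intro N hN τ tr tk hi ⟨h23, h5⟩
      replace hN : N < (G.goal j).formulas.length := by
        rw [← h.formulas]; exact hN
      obtain ⟨c1, c2⟩ := entry_eq (σ := τ) (j := j) (by rw [tk 3 (by decide)]; exact h.goals) hN
      let τ₁ := (assign 24 (load 3 (reg 23)) ;; assign 23 (add (reg 23) (lit 1)) ;;
        assign 30 (add (reg 20) (lit 1))).eval τ
      have m₁ : τ₁.mem = τ.mem := rfl
      have r₁ : ∀ r, r ∉ [23, 24, 30] → τ₁.reg r = τ.reg r := fun r hr =>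
        eval_reg_of_notMem (by revert hr; simp [wr]; tauto) _
      have e23 : τ₁.reg 23 = G.goalPos j + 2 + entryPos (G.goal j).formulas N + 1 := by
        simp [τ₁, h23]
      have e24 : τ₁.reg 24 = (G.goal j).formulas[N].code.length := by
        simp [τ₁, h23, c1]
      have e30 : τ₁.reg 30 = N + 1 := by simp [τ₁, hi]
      have hrow := truthRow_mem (G := G) (σ := τ₁) (f := (G.goal j).formulas[N])
        (by rw [r₁ 2 (by decide), tr 2 (by decide)]; exact h.states)
        (by rw [r₁ 3 (by decide), tr 3 (by decide)]; exact h.atoms)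
        (by rw [m₁, tk 2 (by decide)]; exact h.label) e24
        (by rw [r₁ 11 (by decide), tr 11 (by decide)]; exact hL _ (List.getElem_mem hN))
        (by rw [m₁, e23]; exact c2)
        (by
          rw [r₁ 13 (by decide), tr 13 (by decide), e30, show σ₁.reg 13 = _ from h.rows]
          rw [GR1.formulas, List.length_append] at hN
          omega)
      constructor
      · change (((truthRow.eval τ₁).setReg 23 ((truthRow.eval τ₁).reg 23 +
          (truthRow.eval τ₁).reg 24)).setReg 20 (N + 1)).reg 23 = _
        rw [Store.reg_setReg, if_neg (by decide), Store.reg_setReg, if_pos rfl,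
          eval_reg_of_notMem (c := truthRow) (r := 23) (by decide),
          eval_reg_of_notMem (c := truthRow) (r := 24) (by decide), e23, e24,
          entryPos_succ hN]
        omega
      · intro y s
        change (truthRow.eval τ₁).mem 5 _ = _
        rw [hrow, e30, m₁, h5]
        by_cases hy : y = N + 1
        · subst hy
          rw [if_pos rfl, if_pos le_rfl, rowFormula, List.getD_cons_succ,
            List.getD_eq_getElem _ _ hN]
        · rw [if_neg hy]
          by_cases hy' : y ≤ N
          · rw [if_pos hy', if_pos (by omega)]
          · rw [if_neg hy', if_neg (by omega)])
  have := key.2 y s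
  refine Eq.trans this ?_
  rw [show σ₁.reg 10 = _ from h.formulas]
  split_ifs with hy
  · rfl
  · rw [rowFormula, List.getD_eq_default _ _ (by simp; omega), htop]

/-! ### Legality and grouping of action profiles. -/

theorem profile_val (x : Fin (k ^ n)) (i : Fin n) : (profile x i : ℕ) = x / k ^ (i : ℕ) % k := rfl

theorem actions_pos (G : Game (Fin n) (Fin k) (Fin m) (Fin a)) (j : Fin n) : 0 < k :=
  (Nat.zero_le _).trans_lt (G.arena.act_nonempty j).some.2

/-- The number of a profile after the action of player `j` has been replaced by the first one. -/
def groupNum (k n : ℕ) (j : Fin n) (x : ℕ) : ℕ :=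
  ∑ i ∈ Finset.range n, if i = j then 0 else x / k ^ i % k * k ^ i

theorem groupNum_eq (hk : 0 < k) (j : Fin n) (x : Fin (k ^ n)) :
    groupNum k n j x = (finFunctionFinEquiv (Function.update (profile x) j ⟨0, hk⟩) : ℕ) := by
  rw [finFunctionFinEquiv_apply, groupNum, Finset.sum_range]
  refine Finset.sum_congr rfl fun i _ => ?_
  by_cases hi : i = j
  · subst hi; simp
  · rw [if_neg fun h => hi (Fin.ext h), Function.update_of_ne hi, profile_val]

/-- Resetting the action of `j` selects one representative from each class of profiles that agree
off `j`. The group number is itself a profile number, so marks need only `k ^ n` cells. -/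
theorem groupNum_inj (hk : 0 < k) (j : Fin n) (x y : Fin (k ^ n)) :
    groupNum k n j x = groupNum k n j y ↔ ∀ i, i ≠ j → profile x i = profile y i := by
  rw [groupNum_eq hk, groupNum_eq hk, Fin.val_inj, EmbeddingLike.apply_eq_iff_eq]
  constructor
  · intro h i hi
    simpa [hi] using congrFun h i
  · intro h
    funext i
    by_cases hi : i = j
    · subst hi; simp
    · simp [hi, h i hi]

/-- The number of a profile is read digit by digit in base `k`. Before digit `i`, registers `21` and
`23` hold `x / k ^ i` and `k ^ i`, while `24` and `25` hold the legality and the group number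
restricted to the players below `i`. -/
theorem profileTables_mem (h : Loaded G j σ) (x : Fin (k ^ n)) :
    (profileTables.eval σ).mem 7 x = ind (LegalNum G x) ∧
      (profileTables.eval σ).mem 8 x = groupNum k n j x := by
  have hk0 := actions_pos G j
  let digits : Cmd := loop 22 0
       (divMod 26 27 21 1 7 ;;
        mul 28 29 22 1 0 ;;
        ite (load 0 (add (reg 28) (reg 21))) skip (assign 24 (lit 0)) ;;
        mul 28 29 21 23 1 ;;
        ite (add (lt (reg 22) (reg 4)) (lt (reg 4) (reg 22)))
          (assign 25 (add (reg 25) (reg 28))) skip ;;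
        mul 28 29 1 23 1 ;;
        assign 23 (reg 28) ;;
        assign 21 (reg 26))
  let start : Cmd := assign 21 (reg 20) ;; assign 23 (lit 1) ;; assign 24 (lit 1) ;;
    assign 25 (lit 0)
  have hdigits : ∀ (x : Fin (k ^ n)) (τ : Store), τ.reg 0 = n → τ.reg 1 = k → τ.reg 4 = j →
      τ.reg 7 = k ^ n → τ.mem 0 = G.arena.actTable → τ.reg 20 = x →
      (digits.eval (start.eval τ)).reg 24 = ind (LegalNum G x) ∧
        (digits.eval (start.eval τ)).reg 25 = groupNum k n j x := by
    intro x τ r0 r1 r4 r7 k0 r20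
    have key := eval_loop (i := 22) (n := 0) (P :=
       divMod 26 27 21 1 7 ;;
        mul 28 29 22 1 0 ;;
        ite (load 0 (add (reg 28) (reg 21))) skip (assign 24 (lit 0)) ;;
        mul 28 29 21 23 1 ;;
        ite (add (lt (reg 22) (reg 4)) (lt (reg 4) (reg 22)))
          (assign 25 (add (reg 25) (reg 28))) skip ;;
        mul 28 29 1 23 1 ;;
        assign 23 (reg 28) ;;
        assign 21 (reg 26)) (σ := start.eval τ)
      (fun i ρ => ρ.reg 21 = x / k ^ i ∧ ρ.reg 23 = k ^ i ∧
        ρ.reg 24 = ind (∀ i' : Fin n, (i' : ℕ) < i → profile x i' ∈ G.arena.act i') ∧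
        ρ.reg 25 = ∑ i' ∈ Finset.range i, if i' = j then 0 else x / k ^ i' % k * k ^ i')
      (by simp [start, r20, ind]) (by
        intro i hi ρ tr tk hρi ⟨e21, e23, e24, e25⟩
        have hs : ∀ r ∉ [21, 23, 24, 25], (start.eval τ).reg r = τ.reg r := fun r hr =>
          eval_reg_of_notMem (by revert hr; simp [start, wr]) _
        have s0 : ρ.reg 0 = n := by rw [tr 0 (by decide), hs 0 (by decide), r0]
        have s1 : ρ.reg 1 = k := by rw [tr 1 (by decide), hs 1 (by decide), r1]
        have s4 : ρ.reg 4 = j := by rw [tr 4 (by decide), hs 4 (by decide), r4]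
        have s7 : ρ.reg 7 = k ^ n := by rw [tr 7 (by decide), hs 7 (by decide), r7]
        have t0 : ρ.mem 0 = G.arena.actTable := by rw [tk 0 (by decide)]; exact k0
        replace hi : i < n := by rw [hs 0 (by decide), r0] at hi; exact hi
        let ρ₁ := (divMod 26 27 21 1 7).eval ρ
        have hdm := eval_divMod (q := 26) (i := 27) (x := 21) (y := 1) (n := 7) (by decide)
          (by decide) (by decide) (by decide) (by decide) (by decide) (by decide) (σ := ρ)
          (by rw [s1]; exact hk0) (by
            rw [e21, s1, s7]
            -- All quotients are at most `x < k ^ n`, so the `R 7` rounds of the division suffice.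
            exact (Nat.div_le_self _ _).trans ((Nat.div_le_self _ _).trans x.2.le))
        rw [e21, s1, Nat.div_div_eq_div_mul, ← pow_succ] at hdm
        obtain ⟨d26, d21⟩ := hdm
        have f₁ : ∀ r ∉ [26, 27, 21], ρ₁.reg r = ρ.reg r := fun r hr =>
          eval_reg_of_notMem (by revert hr; simp [divMod, wr]; tauto) _
        let ρ₂ := (mul 28 29 22 1 0).eval ρ₁
        have f₂ : ∀ r ∉ [28, 29], ρ₂.reg r = ρ₁.reg r := fun r hr =>
          eval_reg_of_notMem (by revert hr; simp [mul, wr]; tauto) _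
        have g28 : ρ₂.reg 28 = i * k := by
          simp only [ρ₂]
          rw [eval_mul_reg (by decide) (by decide) (by decide) (by decide) (by decide) (by decide)
            (by rw [f₁ 22 (by decide), f₁ 0 (by decide), hρi, s0]; omega), f₁ 22 (by decide),
            f₁ 1 (by decide), hρi, s1]
        have m₂ : ρ₂.mem 0 = G.arena.actTable := by
          rw [eval_mem_of_notMem (by decide), eval_mem_of_notMem (by decide), t0]
        let ρ₃ := (ite (load 0 (add (reg 28) (reg 21))) skip (assign 24 (lit 0))).eval ρ₂
        have f₃ : ∀ r ≠ 24, ρ₃.reg r = ρ₂.reg r := fun r hr =>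
          eval_reg_of_notMem (by simpa [wr] using hr) _
        have h24 : ρ₃.reg 24 =
            ind (∀ i' : Fin n, (i' : ℕ) < i + 1 → profile x i' ∈ G.arena.act i') := by
          have hact := actTable_apply G.arena ⟨i, hi⟩ (profile x ⟨i, hi⟩)
          rw [profile_val] at hact
          have hcond : val ρ₂ (load 0 (add (reg 28) (reg 21))) =
              ind (profile x ⟨i, hi⟩ ∈ G.arena.act ⟨i, hi⟩) := by
            simp only [val, g28, m₂, f₂ 21 (by decide)]
            rw [show ρ₁.reg 21 = _ from d21]
            exact hact
          have hsplit : (∀ i' : Fin n, (i' : ℕ) < i + 1 → profile x i' ∈ G.arena.act i') ↔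
              (∀ i' : Fin n, (i' : ℕ) < i → profile x i' ∈ G.arena.act i') ∧
              profile x ⟨i, hi⟩ ∈ G.arena.act ⟨i, hi⟩ := by
            constructor
            · exact fun h => ⟨fun i' hi' => h i' (by omega), h ⟨i, hi⟩ (Nat.lt_succ_self i)⟩
            · rintro ⟨h1, h2⟩ i' hi'
              rcases Nat.lt_succ_iff_lt_or_eq.1 hi' with h | h
              · exact h1 i' h
              · obtain rfl : i' = ⟨i, hi⟩ := Fin.ext h
                exact h2
          rw [ind_congr hsplit]
          simp only [ρ₃]
          rw [eval, hcond]
          by_cases hc : profile x ⟨i, hi⟩ ∈ G.arena.act ⟨i, hi⟩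
          · rw [if_pos (by simpa using hc)]
            change ρ₂.reg 24 = _
            rw [f₂ 24 (by decide), f₁ 24 (by decide), e24]
            exact ind_congr (and_iff_left hc).symm
          · rw [if_neg (by simpa using hc), ind_of_not fun h => hc h.2]
            rfl
        let ρ₄ := (mul 28 29 21 23 1).eval ρ₃
        have f₄ : ∀ r ∉ [28, 29], ρ₄.reg r = ρ₃.reg r := fun r hr =>
          eval_reg_of_notMem (by revert hr; simp [mul, wr]; tauto) _
        have p21 : ρ₃.reg 21 = x / k ^ i % k := by
          rw [f₃ 21 (by decide), f₂ 21 (by decide)]; exact d21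
        have p23 : ρ₃.reg 23 = k ^ i := by
          rw [f₃ 23 (by decide), f₂ 23 (by decide), f₁ 23 (by decide), e23]
        have p1 : ρ₃.reg 1 = k := by
          rw [f₃ 1 (by decide), f₂ 1 (by decide), f₁ 1 (by decide), s1]
        have g28' : ρ₄.reg 28 = x / k ^ i % k * k ^ i := by
          simp only [ρ₄]
          rw [eval_mul_reg (by decide) (by decide) (by decide) (by decide) (by decide) (by decide)
            (by rw [p21, p1]; exact (Nat.mod_lt _ hk0).le), p21, p23]
        let ρ₅ := (ite (add (lt (reg 22) (reg 4)) (lt (reg 4) (reg 22)))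
          (assign 25 (add (reg 25) (reg 28))) skip).eval ρ₄
        have f₅ : ∀ r ≠ 25, ρ₅.reg r = ρ₄.reg r := fun r hr =>
          eval_reg_of_notMem (by simpa [wr] using hr) _
        have h25 : ρ₅.reg 25 =
            ∑ i' ∈ Finset.range (i + 1), if i' = j then 0 else x / k ^ i' % k * k ^ i' := by
          have q22 : ρ₄.reg 22 = i := by
            rw [f₄ 22 (by decide), f₃ 22 (by decide), f₂ 22 (by decide), f₁ 22 (by decide), hρi]
          have q4 : ρ₄.reg 4 = j := by
            rw [f₄ 4 (by decide), f₃ 4 (by decide), f₂ 4 (by decide), f₁ 4 (by decide), s4]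
          have q25 : ρ₄.reg 25 = ρ.reg 25 := by
            rw [f₄ 25 (by decide), f₃ 25 (by decide), f₂ 25 (by decide), f₁ 25 (by decide)]
          rw [Finset.sum_range_succ, ← e25, ← q25, ← g28']
          simp only [ρ₅]
          rw [eval]
          simp only [val, q22, q4]
          by_cases hij : i = (j : ℕ)
          · rw [if_neg (by simp [hij]), if_pos hij]; rfl
          · rw [if_pos (by rcases Nat.lt_or_gt_of_ne hij with h | h <;> simp [h]), if_neg hij]
            simp
        let ρ₆ := (mul 28 29 1 23 1).eval ρ₅
        have f₆ : ∀ r ∉ [28, 29], ρ₆.reg r = ρ₅.reg r := fun r hr =>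
          eval_reg_of_notMem (by revert hr; simp [mul, wr]; tauto) _
        have g28'' : ρ₆.reg 28 = k * k ^ i := by
          simp only [ρ₆]
          rw [eval_mul_reg (by decide) (by decide) (by decide) (by decide) (by decide) (by decide)
            le_rfl, f₅ 1 (by decide), f₅ 23 (by decide), f₄ 1 (by decide), f₄ 23 (by decide),
            p1, p23]
        change (((ρ₆.setReg 23 (ρ₆.reg 28)).setReg 21
          ((ρ₆.setReg 23 (ρ₆.reg 28)).reg 26)).setReg 22 (i + 1)).reg 21 = _ ∧
          (((ρ₆.setReg 23 (ρ₆.reg 28)).setReg 21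
          ((ρ₆.setReg 23 (ρ₆.reg 28)).reg 26)).setReg 22 (i + 1)).reg 23 = _ ∧
          (((ρ₆.setReg 23 (ρ₆.reg 28)).setReg 21
          ((ρ₆.setReg 23 (ρ₆.reg 28)).reg 26)).setReg 22 (i + 1)).reg 24 = _ ∧
          (((ρ₆.setReg 23 (ρ₆.reg 28)).setReg 21
          ((ρ₆.setReg 23 (ρ₆.reg 28)).reg 26)).setReg 22 (i + 1)).reg 25 = _
        simp only [Store.reg_setReg, Nat.reduceEqDiff, if_true, if_false]
        refine ⟨?_, ?_, ?_, ?_⟩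
        · rw [f₆ 26 (by decide), f₅ 26 (by decide), f₄ 26 (by decide), f₃ 26 (by decide),
            f₂ 26 (by decide)]
          exact d26
        · rw [g28'', pow_succ, mul_comm]
        · rw [f₆ 24 (by decide), f₅ 24 (by decide), f₄ 24 (by decide), h24]
        · rw [f₆ 25 (by decide), h25])
    have hn : (start.eval τ).reg 0 = n := by
      rw [eval_reg_of_notMem (by decide), r0]
    rw [hn] at key
    obtain ⟨-, -, e24, e25⟩ := key
    exact ⟨e24.trans (ind_congr ⟨fun h i => h i i.2, fun h i _ => h i⟩), e25⟩
  have key := eval_loop (i := 20) (n := 7) (P := assign 21 (reg 20) ;; assign 23 (lit 1) ;;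
     assign 24 (lit 1) ;; assign 25 (lit 0) ;; digits ;; store 7 (reg 20) (reg 24) ;;
     store 8 (reg 20) (reg 25)) (σ := σ)
    (fun N τ => ∀ x : Fin (k ^ n), (x : ℕ) < N →
      τ.mem 7 x = ind (LegalNum G x) ∧ τ.mem 8 x = groupNum k n j x)
    (fun x hx => absurd hx (Nat.not_lt_zero _)) (by
      intro N hN τ tr tk hi hI x hx
      rw [h.profiles] at hN
      obtain ⟨e24, e25⟩ := hdigits ⟨N, hN⟩ τ (by rw [tr 0 (by decide), h.players])
        (by rw [tr 1 (by decide), h.actions]) (by rw [tr 4 (by decide), h.player])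
        (by rw [tr 7 (by decide), h.profiles]) (by rw [tk 0 (by decide), h.act]) hi
      let ρ := digits.eval (start.eval τ)
      have e20 : ρ.reg 20 = N := by
        rw [eval_reg_of_notMem (by decide), eval_reg_of_notMem (by decide), hi]
      have e7 : ρ.mem 7 = τ.mem 7 := by
        rw [eval_mem_of_notMem (by decide), eval_mem_of_notMem (by decide)]
      have e8 : ρ.mem 8 = τ.mem 8 := by
        rw [eval_mem_of_notMem (by decide), eval_mem_of_notMem (by decide)]
      change ((ρ.setMem 7 (ρ.reg 20) (ρ.reg 24)).setMem 8 (ρ.reg 20) (ρ.reg 25)).mem 7 x = _ ∧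
        ((ρ.setMem 7 (ρ.reg 20) (ρ.reg 24)).setMem 8 (ρ.reg 20) (ρ.reg 25)).mem 8 x = _
      simp only [Store.mem_setMem, Nat.reduceEqDiff, false_and, if_false, true_and, e20, e7, e8]
      rw [show ρ.reg 24 = _ from e24, show ρ.reg 25 = _ from e25]
      by_cases hxN : (x : ℕ) = N
      · subst hxN; simp
      · rw [if_neg hxN, if_neg hxN]
        exact hI x (by omega))
  rw [h.profiles] at key
  exact key x x.2

theorem ready_tables (h : Loaded G j σ) (h0 : σ.mem 5 = fun _ => 0)
    (hL : ∀ f ∈ (G.goal j).formulas, f.code.length ≤ σ.reg 11) :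
    Ready G j ((truthTable ;; profileTables).eval σ) := by
  have hk0 := actions_pos G j
  have hr' : ∀ r ∈ [2, 7, 8, 9, 13],
      ((truthTable ;; profileTables).eval σ).reg r = σ.reg r :=
    fun r hr => eval_reg_of_notMem (by revert r; decide) _
  have hpt := profileTables_mem (h.eval (c := truthTable) (by decide) (by decide))
  have e : ∀ x : Fin (k ^ n), ((truthTable ;; profileTables).eval σ).mem 8 x =
      groupNum k n j x := fun x => (hpt x).2
  constructor
  · rw [hr' 2 (by decide), h.states]
  · rw [hr' 7 (by decide), h.profiles]
  · rw [hr' 8 (by decide), h.assumptions]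
  · rw [hr' 9 (by decide), h.guarantees]
  · rw [hr' 13 (by decide), h.rows]
  · intro s x
    rw [eval_mem_of_notMem (by decide), h.tr, trTable_apply]
    rfl
  · intro y s
    rw [eval, eval_mem_of_notMem (by decide), truthTable_mem h h0 hL]
  · exact fun x => (hpt x).1
  · intro x
    rw [e x, groupNum_eq hk0]
    exact Fin.is_lt _
  · intro x y
    rw [e x, e y, groupNum_inj hk0]

end Cmd

/-! ### The header of the input and the complete computation. -/

namespace Cmd

open GRGame.Expr Set

variable {n k m a : ℕ} (G : Game (Fin n) (Fin k) (Fin m) (Fin a)) (j : Fin n)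

theorem loaded_readHeader : Loaded G j (readHeader.eval (G.input j)) := by
  let σ := G.input j
  have g0 : σ.mem 3 j = G.goalPos j := goalList_getD_self G j
  have g1 : σ.mem 3 (G.goalPos j) = (G.goal j).assumptions.length :=
    goalList_getD_goalPos G j (x := 0) (by simp [GR1.code])
  have g2 : σ.mem 3 (G.goalPos j + 1) = (G.goal j).guarantees.length :=
    goalList_getD_goalPos G j (x := 1) (by simp [GR1.code])
  have r4 : σ.reg 4 = j := rfl
  let σ₁ := (assign 12 (load 3 (reg 4)) ;;
    assign 8 (add (load 3 (reg 12)) (lit 1)) ;;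
    assign 9 (add (load 3 (add (reg 12) (lit 1))) (lit 1)) ;;
    assign 10 (sub (add (reg 8) (reg 9)) (lit 2)) ;;
    assign 13 (add (reg 8) (reg 9)) ;;
    assign 12 (add (reg 12) (lit 2)) ;;
    assign 7 (lit 1)).eval σ
  have h₁ : ∀ r ∉ [7, 8, 9, 10, 12, 13], σ₁.reg r = σ.reg r := fun r hr =>
    eval_reg_of_notMem (by revert hr; simp [wr]; tauto) _
  have key := eval_loop (i := 20) (n := 0) (P := mul 21 22 1 7 1 ;; assign 7 (reg 21)) (σ := σ₁)
    (fun N τ => τ.reg 7 = k ^ N) (by simp [σ₁]) (by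
      intro N _ τ tr _ _ h
      have e1 : τ.reg 1 = k := by rw [tr 1 (by decide), h₁ 1 (by decide)]; rfl
      change (((mul 21 22 1 7 1).eval τ).setReg 7 (((mul 21 22 1 7 1).eval τ).reg 21)
        |>.setReg 20 (N + 1)).reg 7 = _
      rw [Store.reg_setReg, if_neg (by decide), Store.reg_setReg, if_pos rfl,
        eval_mul_reg (by decide) (by decide) (by decide) (by decide) (by decide) (by decide) le_rfl,
        e1, h, pow_succ, mul_comm])
  have hfin : ∀ r ∉ [7, 20, 21, 22], (readHeader.eval σ).reg r = σ₁.reg r := fun r hr =>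
    eval_reg_of_notMem (c := loop 20 0 (mul 21 22 1 7 1 ;; assign 7 (reg 21)))
      (by revert hr; simp [wr, mul]; tauto) _
  have e8 : σ₁.reg 8 = (G.goal j).assumptions.length + 1 := by simp [σ₁, r4, g0, g1]
  have e9 : σ₁.reg 9 = (G.goal j).guarantees.length + 1 := by simp [σ₁, r4, g0, g2]
  constructor
  · rw [hfin 0 (by decide), h₁ 0 (by decide)]; rfl
  · rw [hfin 1 (by decide), h₁ 1 (by decide)]; rfl
  · rw [hfin 2 (by decide), h₁ 2 (by decide)]; rfl
  · rw [hfin 3 (by decide), h₁ 3 (by decide)]; rfl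
  · rw [hfin 4 (by decide), h₁ 4 (by decide)]; rfl
  · rw [h₁ 0 (by decide)] at key
    exact key
  · rw [hfin 8 (by decide), e8]
  · rw [hfin 9 (by decide), e9]
  · rw [hfin 10 (by decide), GR1.formulas, List.length_append]
    change σ₁.reg 8 + σ₁.reg 9 - 2 = _
    rw [e8, e9]
    omega
  · rw [hfin 12 (by decide)]
    simp [σ₁, r4, g0]
  · rw [hfin 13 (by decide)]
    change σ₁.reg 8 + σ₁.reg 9 = _
    rw [e8, e9]
    omega
  all_goals rw [eval_mem_of_notMem (by decide)]; rfl

variable {G j}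

/-- Only some bound for the length of each formula is needed. The sum is one, and it does not exceed
the size of the goal. -/
theorem readLength_reg {σ : Store} (h : Loaded G j σ) :
    (readLength.eval σ).reg 11 = ((G.goal j).formulas.map fun f => f.code.length).sum := by
  let σ₁ := (assign 11 (lit 0) ;; assign 23 (reg 12)).eval σ
  have key := eval_loop (i := 20) (n := 10) (P := assign 11 (add (reg 11) (load 3 (reg 23))) ;;
     assign 23 (add (add (reg 23) (load 3 (reg 23))) (lit 1))) (σ := σ₁)
    (fun N τ => τ.reg 23 = G.goalPos j + 2 + entryPos (G.goal j).formulas N ∧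
      τ.reg 11 = (((G.goal j).formulas.take N).map fun f => f.code.length).sum)
    (by simp [σ₁, h.base, entryPos]) (by
      intro N hN τ tr tk hi ⟨e1, e2⟩
      replace hN : N < (G.goal j).formulas.length := by
        rw [← h.formulas]; exact hN
      obtain ⟨c1, -⟩ := entry_eq (σ := τ) (j := j) (by rw [tk 3 (by decide)]; exact h.goals) hN
      rw [entryPos_succ hN, List.take_succ_eq_append_getElem hN, List.map_append,
        List.sum_append, ← e2]
      simp [e1, c1]
      omega)
  rw [show σ₁.reg 10 = _ from h.formulas, List.take_length] at key
  exact key.2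

theorem holds_solve {σ : Store} (h : Loaded G j σ) (h0 : σ.mem 5 = fun _ => 0)
    (hL : ∀ f ∈ (G.goal j).formulas, f.code.length ≤ σ.reg 11) :
    Holds (solve.eval σ) 4 (G.Pun j) := by
  have h₁ := ready_tables h h0 hL
  have h₂ : Ready G j (iterZ.eval ((truthTable ;; profileTables).eval σ)) :=
    h₁.eval (by decide) (by decide)
  have hZ := holds_iterZ h₁
  rw [G.Pun_eq_compl_winRegion j (K := m) (by simp)]
  refine holds_map (σ := iterZ.eval ((truthTable ;; profileTables).eval σ)) _ h₂.states
    fun s τ _ hk _ hi => ?_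
  simp only [val, hi, hk 13 (by decide), hZ s, one_sub_ind]
  rfl

end Cmd

end GRGame

/-! ### The theorem. -/

open GRGame Cmd in
theorem mainTheorem7 :
    ∃ (P : GRGame.Program) (p : Polynomial ℕ),
      ∀ (n k m a : ℕ) (G : GRGame.Game (Fin n) (Fin k) (Fin m) (Fin a)) (j : Fin n),
        ∃ (t : ℕ) (σ : GRGame.Store),
          GRGame.Exec P (G.input j) t σ ∧
          t ≤ p.eval (G.arena.size + (G.goal j).size) ∧
          GRGame.Outputs σ (G.Pun j) := by
  -- The program is compiled in three pieces because loop bounds must not be written by the command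
  -- that uses them: the header computes the bound of `readLength`, and both together supply the
  -- bounds of `solve`.
  refine ⟨.seq readHeader.compile (.seq readLength.compile solve.compile),
    -- The summand 2 comes from the two added copies of `⊤`: register `13` holds the number of
    -- assumptions and guarantees plus 2.
    (readHeader.cost + readLength.cost + solve.cost).comp (.X + 2), ?_⟩
  intro n k m a G j
  let B := G.arena.size + (G.goal j).size + 2
  let σ₁ := readHeader.eval (G.input j)
  let σ₂ := readLength.eval σ₁
  have h₁ : Loaded G j σ₁ := loaded_readHeader G j
  have h₂ : Loaded G j σ₂ := h₁.eval (by decide) (by decide)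
  have hlen : σ₂.reg 11 = ((G.goal j).formulas.map fun f => f.code.length).sum := readLength_reg h₁
  have hγ := (G.goal j).sum_length_code_add_length_le
  have hfs : (G.goal j).formulas.length =
      (G.goal j).assumptions.length + (G.goal j).guarantees.length := by
    simp [GR1.formulas]
  -- The initial state shows `0 < m`, so the number of profiles is at most the size of the
  -- transition table.
  have hK : k ^ n ≤ m * k ^ n := Nat.le_mul_of_pos_left _ ((Nat.zero_le _).trans_lt G.arena.init.2)
  have hsize : n + k + m + n * k + m * k ^ n + m * a = G.arena.size := rfl
  obtain ⟨t₁, ρ₁, x₁, c₁, s₁⟩ := exec_compile (c := readHeader) (by decide) (by decide) (B := B)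
    (σ := G.input j) (σ' := G.input j) (by
      intro r hr
      have : r = 0 ∨ r = 1 := by revert r; decide
      rcases this with rfl | rfl
      · change n ≤ B; omega
      · change k ≤ B; omega) ⟨fun _ _ => rfl, rfl⟩
  obtain ⟨t₂, ρ₂, x₂, c₂, s₂⟩ := exec_compile (c := readLength) (by decide) (by decide) (B := B)
    (by
      intro r hr
      have : r = 10 := by revert r; decide
      subst this
      rw [h₁.formulas]
      omega) s₁
  obtain ⟨t₃, ρ₃, x₃, c₃, s₃⟩ := exec_compile (c := solve) (by decide) (by decide) (B := B)
    (by
      intro r hr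
      have : r ∈ [0, 1, 2, 7, 8, 9, 10, 11, 13] := by revert r; decide
      simp only [List.mem_cons, List.not_mem_nil, or_false] at this
      rcases this with rfl | rfl | rfl | rfl | rfl | rfl | rfl | rfl | rfl
      · rw [h₂.players]; omega
      · rw [h₂.actions]; omega
      · rw [h₂.states]; omega
      · rw [h₂.profiles]; omega
      · rw [h₂.assumptions]; omega
      · rw [h₂.guarantees]; omega
      · rw [h₂.formulas]; omega
      · rw [hlen]; omega
      · rw [h₂.rows]; omega) s₂
  refine ⟨_, ρ₃, .seq x₁ (.seq x₂ x₃), ?_, ?_⟩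
  · simp only [Polynomial.eval_comp, Polynomial.eval_add, Polynomial.eval_X,
      Polynomial.eval_ofNat]
    change _ ≤ readHeader.cost.eval B + readLength.cost.eval B + solve.cost.eval B
    omega
  · have hsolve := holds_solve h₂
      (by rw [eval_mem_of_notMem (by decide), eval_mem_of_notMem (by decide)]; rfl)
      (fun f hf => by
        rw [hlen]
        exact List.single_le_sum (fun _ _ => Nat.zero_le _) _ (List.mem_map_of_mem hf))
    intro s
    rw [s₃.2]
    exact ⟨fun h => (hsolve s).trans (ind_of h), fun h => (hsolve s).trans (ind_of_not h)⟩
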